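/- Logarithms, powers and square roots are principal, and $\mathrm{Li}_2(z)=-\int_0^z\frac{\ln(1-u)}{u}\,du$ is the principal dilogarithm on $\mathbb C\setminus[1,\infty)$. For $b>0$ put $Q=b+b^{-1}$ and, for $|\operatorname{Im}z|<Q/2$, $$s_b(z)=\exp\left[i\int_0^\infty\left(\frac{\sin 2yz}{2\sinh(b^{-1}y)\sinh(by)}-\frac zy\right)\frac{dy}{y}\right].$$ For $\zeta\in\mathbb R$ and $0<\operatorname{Im}\omega<Q/2$ let $$\mathcal M(b,\zeta,\omega)=s_b(\zeta)\int_{\mathbb R-ic}e^{i\pi x(\zeta-\frac{iQ}{2}+2\omega)}\,\frac{s_b(x-\zeta)}{s_b(x+\frac{iQ}{2})}\,dx ,\qquad 0<c<Q/2 .$$ **Theorem 2.2 (Semiclassical limit of $\mathcal M$).** Let $\zeta\in\mathbb R$ and $\omega\in\mathbb C$ with $0<\operatorname{Im}\omega<1/2$. For every $b>0$ the integral defining $\mathcal M(b,\zeta/b,\omega/b)$ converges absolutely for each $c\in(0,Q/2)$ and does not depend on $c$, and $$\mathcal M\left(b,\frac{\zeta}{b},\frac{\omega}{b}\right)=\sqrt{\frac{\coth(\pi(\zeta+\omega))+1}{2}}\;e^{f_{\mathcal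 M}(\zeta,\omega)/b^2}\,(1+O(b))\qquad\text{as } b\to0^+,$$ where $$f_{\mathcal M}(\zeta,\omega)=-\frac{\mathrm{Li}_2(-e^{2\pi\zeta})+\mathrm{Li}_2\left(-e^{-\pi\zeta}\frac{\cosh(\pi\omega)}{\sinh(\pi(\zeta+\omega))}\right)-\mathrm{Li}_2\left(e^{\pi\zeta}\frac{\cosh(\pi\omega)}{\sinh(\pi(\zeta+\omega))}\right)}{2\pi i}+i\pi\zeta^2+i\left(\omega-\frac i2\right)\ln\left(e^{\pi\zeta}\frac{\cosh(\pi\omega)}{\sinh(\pi(\zeta+\omega))}\right)+\frac{i\pi}{6}.$$ Moreover, for $\zeta\in-\frac12+i\mathbb R$ and $\frac12<\operatorname{Re}\omega<1$ define $$Y(\zeta,\omega)=f_{\mathcal M}\left(i\zeta+\frac i2,\,i\omega-\frac i2\right)+2\pi i\zeta\omega+\pi i\zeta(\zeta-1).$$ Let $D$ be the set of all $(\zeta,\omega)\in\mathbb C^2$ with $e^{2\pi i\omega}\ne1$ such that neither $1-e^{2\pi i(\zeta+\omega)}$ nor $\frac{1-e^{2\pi i(\zeta+\omega)}}{1-e^{2\pi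 i\omega}}$ lies in $(-\infty,0]$. Then $D$ contains the set on which $Y$ was just defined, $Y$ has a unique analytic extension to $D$, and this extension, again denoted by $Y$, is a Painlevé I generating function, that is, throughout $D$, $$\frac{\partial Y}{\partial\zeta}=\ln\left(1-e^{2\pi i(\zeta+\omega)}\right),\qquad \frac{\partial Y}{\partial\omega}=\ln\left(\frac{1-e^{2\pi i(\zeta+\omega)}}{1-e^{2\pi i\omega}}\right).$$ -/

import Mathlib

namespace HypM

noncomputable section

/-- The principal branch of the dilogarithm on `ℂ ∖ [1, ∞)`:
`Li₂(z) = -∫₀ᶻ ln(1 - u) / u du`, taken along the straight segment `u = t z`, `0 ≤ t ≤ 1`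
(so that `du / u = dt / t`). -/
def dilog (z : ℂ) : ℂ :=
  -∫ t in (0 : ℝ)..1, Complex.log (1 - (t : ℂ) * z) / (t : ℂ)

/-- The hyperbolic cotangent on `ℂ`. -/
def coth (z : ℂ) : ℂ := Complex.cosh z / Complex.sinh z

/-- `Q = b + b⁻¹`. -/
def Q (b : ℝ) : ℝ := b + b⁻¹

/-- The hyperbolic gamma function `s_b(z)`, by its integral representation in the strip
`|Im z| < Q / 2` (the only values that are used below lie in this strip). -/
def sb (b : ℝ) (z : ℂ) : ℂ :=
  Complex.exp (Complex.I * ∫ y in Set.Ioi (0 : ℝ),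
    (Complex.sin (2 * (y : ℂ) * z) /
        (2 * Complex.sinh ((b : ℂ)⁻¹ * (y : ℂ)) * Complex.sinh ((b : ℂ) * (y : ℂ)))
      - z / (y : ℂ)) / (y : ℂ))

/-- The integrand
`e^{i π x (ζ - i Q / 2 + 2 ω)} s_b(x - ζ) / s_b(x + i Q / 2)`. -/
def integrandM (b : ℝ) (ζ ω x : ℂ) : ℂ :=
  Complex.exp (Complex.I * Real.pi * x * (ζ - Complex.I * (Q b : ℂ) / 2 + 2 * ω)) *
    (sb b (x - ζ) / sb b (x + Complex.I * (Q b : ℂ) / 2))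

/-- The function `𝓜(b, ζ, ω)` for `b > 0`, `ζ` real and `0 < Im ω < Q / 2`:
`s_b(ζ)` times the integral of the integrand over a curve from `-∞` to `+∞` in the strip
`-Q / 2 < Im x < 0`; the curve chosen here is the horizontal line in the middle of the strip. -/
def M (b : ℝ) (ζ ω : ℂ) : ℂ :=
  sb b ζ * ∫ x : ℝ, integrandM b ζ ω ((x : ℂ) - Complex.I * (Q b : ℂ) / 4)

/-- The exponent `f_𝓜(ζ, ω)`, with principal branches. -/
def fM (ζ ω : ℂ) : ℂ :=
  -((dilog (-Complex.exp (2 * Real.pi * ζ))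
      + dilog (-Complex.exp (-(Real.pi * ζ)) *
          (Complex.cosh (Real.pi * ω) / Complex.sinh (Real.pi * (ζ + ω))))
      - dilog (Complex.exp (Real.pi * ζ) *
          (Complex.cosh (Real.pi * ω) / Complex.sinh (Real.pi * (ζ + ω)))))
      / (2 * Real.pi * Complex.I))
    + Complex.I * Real.pi * ζ ^ 2
    + Complex.I * (ω - Complex.I / 2) *
        Complex.log (Complex.exp (Real.pi * ζ) *
          (Complex.cosh (Real.pi * ω) / Complex.sinh (Real.pi * (ζ + ω))))
    + Complex.I * Real.pi / 6

/-- The right-hand side of the definition of `Y`. -/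
def YFormula (ζ ω : ℂ) : ℂ :=
  fM (Complex.I * ζ + Complex.I / 2) (Complex.I * ω - Complex.I / 2)
    + 2 * Complex.I * Real.pi * ζ * ω + Complex.I * Real.pi * ζ * (ζ - 1)

/-- The set of all `(ζ, ω)` with `ζ ∈ -1/2 + i ℝ` and `1/2 < Re ω < 1`,
on which `Y` is given by the explicit formula. -/
def initialSet : Set (ℂ × ℂ) :=
  {p | p.1.re = -(1 / 2) ∧ 1 / 2 < p.2.re ∧ p.2.re < 1}

/-- `1 - e^{2 π i (ζ + ω)}`. -/
def argζ (ζ ω : ℂ) : ℂ := 1 - Complex.exp (2 * Complex.I * Real.pi * (ζ + ω))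

/-- `(1 - e^{2 π i (ζ + ω)}) / (1 - e^{2 π i ω})`. -/
def argω (ζ ω : ℂ) : ℂ :=
  (1 - Complex.exp (2 * Complex.I * Real.pi * (ζ + ω))) /
    (1 - Complex.exp (2 * Complex.I * Real.pi * ω))

/-- The set of all `(ζ, ω)` with `e^{2 π i ω} ≠ 1` at which both principal logarithms in the
Painlevé I equations are analytic: neither argument lies in `(-∞, 0]`. (Where
`e^{2 π i ω} = 1`, the second argument is `0` by the convention on division, so
these points are not in the set.) -/
def domainY : Set (ℂ × ℂ) :=
  {p | argζ p.1 p.2 ∈ Complex.slitPlane ∧ argω p.1 p.2 ∈ Complex.slitPlane}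

/-- `Y` is a Painlevé I generating function on `U`: at each point of `U` it has partial
derivatives, which are
`∂Y/∂ζ = ln(1 - e^{2πi(ζ+ω)})` and `∂Y/∂ω = ln((1 - e^{2πi(ζ+ω)}) / (1 - e^{2πiω}))`. -/
def IsPainleveIGeneratingFunctionOn (Y : ℂ × ℂ → ℂ) (U : Set (ℂ × ℂ)) : Prop :=
  ∀ ζ ω : ℂ, (ζ, ω) ∈ U →
    HasDerivAt (fun z => Y (z, ω)) (Complex.log (argζ ζ ω)) ζ ∧
    HasDerivAt (fun w => Y (ζ, w)) (Complex.log (argω ζ ω)) ω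

/-- `Y` is the analytic continuation to `U` of the explicit formula on the initial set: `Y` is
analytic on `U` and is given there by the formula at the points of the initial set, all of which
are in `U`. -/
def IsContinuationOn (Y : ℂ × ℂ → ℂ) (U : Set (ℂ × ℂ)) : Prop :=
  initialSet ⊆ U ∧ AnalyticOnNhd ℂ Y U ∧ ∀ p ∈ initialSet, Y p = YFormula p.1 p.2

end

end HypM

namespace HypM

open Set Filter Topology MeasureTheory

/-! ### Elementary bounds for hyperbolic and trigonometric functions -/

/-! The integral in `M` is a Fourier integral with a closed form, and the asymptotics are those of
the closed form. Write `M` as `sb b ζ` times `FM`, the Fourier integral of the `ω`-independent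
function `gM`. The relation s_b(z + ib/2) = 2 cosh(πbz) s_b(z − ib/2) (`sb_add`) gives a first-order
difference relation for `gM` and, after contour shifts by ±ib/2, one linking FM(ω − ib) to FM(ω).
The function `GM`, an exponential times s_b(ω + ζ − iQ/2)/s_b(ω), obeys the same relation, so the
quotient `RM` has period ib. It is holomorphic in 0 < Im ω < Q/2 and, near the middle line, grows at
most like exp(πQ|Re ω|/2). Since Q/2 < 1/b for b < 1, a Liouville argument
(`eq_zero_of_periodic_strip`) makes it constant. The constant comes from ω → −ζ, where `FM` and `GM`
both blow up like a simple pole: for `FM` because gM(x) behaves like a constant times e^{2πixζ} at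
+∞, for `GM` because s_b has a pole at −iQ/2. The outcome is `sb_mul_FM`, proved for b ≤ 1/2.

Next, log s_b is i times `Lam (kerS b)`. Rescaling t to bt turns the kernel into 1/(sinh t sinh
b²t), and replacing 1/sinh(b²t) by 1/(b²t) costs O(b²) in the integral (`exists_norm_Lam_sub_le`).
The leading term is `Lam (kerOne 1)` over b²; a residual shift of the argument by −ib/2 produces the
order-zero term `Psi (kerOne 1)`, which is −log(2 cosh πz). Hence M = exp(expB/b²) exp(expP) (1 +
O(b²)). The second factor is the square-root prefactor (`exp_expP`). The first exponent equals f_M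
(`fM_eq_expB`): the two have the same `ω`-derivative and the same limit at ω = i/2, where
cosh(πω)/sinh(π(ζ + ω)) tends to 0.

For the last part put u = 1 − e^{2πi(ζ+ω)} and v = 1 − e^{2πiω}. Since `Lam (kerOne 1)` is a
dilogarithm plus a quadratic polynomial (`Lam_kerOne_eq`), Y equals (Li₂(1 − v) − Li₂(1 − u))/(2πi)
on the initial set, all polynomial terms cancelling. In the variable l = log(1 − z) the dilogarithm
becomes `Kap`, which is holomorphic for |Im l| < 2π. Replacing log v by log u − log(u/v), whose
imaginary part stays below 2π in modulus on all of D, gives the continuation `genY`, and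
differentiation gives the two equations. Uniqueness is the identity theorem on D, which is path
connected. -/

lemma sinh_le_mul_cosh {x : ℝ} (hx : 0 ≤ x) : Real.sinh x ≤ x * Real.cosh x := by
  have hmono : MonotoneOn (fun x : ℝ => x * Real.cosh x - Real.sinh x) (Ici 0) := by
    apply monotoneOn_of_deriv_nonneg (convex_Ici 0) (by fun_prop) (by fun_prop)
    intro y hy
    rw [interior_Ici] at hy
    have h : HasDerivAt (fun x : ℝ => x * Real.cosh x - Real.sinh x)
        (1 * Real.cosh y + y * Real.sinh y - Real.cosh y) y :=
      ((hasDerivAt_id y).mul (Real.hasDerivAt_cosh y)).sub (Real.hasDerivAt_sinh y)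
    rw [h.deriv]
    have hy' : (0 : ℝ) < y := hy
    have := Real.sinh_nonneg_iff.2 hy'.le
    nlinarith
  have := hmono (mem_Ici.2 le_rfl) (mem_Ici.2 hx) hx
  simp at this
  linarith

lemma inv_sinh_bounds {x : ℝ} (hx : 0 < x) :
    1 / Real.sinh x ≤ 1 / x ∧ 1 / x - 1 / Real.sinh x ≤ x := by
  have hs : x ≤ Real.sinh x := Real.self_le_sinh_iff.2 hx.le
  have hs0 : 0 < Real.sinh x := hx.trans_le hs
  refine ⟨one_div_le_one_div_of_le hx hs, ?_⟩
  rw [div_sub_div _ _ hx.ne' hs0.ne', div_le_iff₀ (mul_pos hx hs0)]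
  have h1 := sinh_le_mul_cosh hx.le
  have h2 := Real.cosh_le_exp_half_sq x
  have h3 := Real.add_one_le_exp (-(x ^ 2 / 2))
  have h4 : Real.exp (x ^ 2 / 2) * Real.exp (-(x ^ 2 / 2)) = 1 := by
    rw [← Real.exp_add]; simp
  -- The claim is equivalent to this inequality, which follows from sinh x ≤ x cosh x ≤ x e^{x²/2}
  -- and 1 − x² ≤ e^{−x²/2}.
  have h5 : Real.sinh x * (1 - x ^ 2) ≤ x := by
    by_cases h : 1 - x ^ 2 ≤ 0
    · nlinarith
    · push Not at h
      have h6 : Real.sinh x * (1 - x ^ 2) ≤ (x * Real.exp (x ^ 2 / 2)) * Real.exp (-(x ^ 2 / 2)) := by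
        apply mul_le_mul _ _ h.le (by positivity)
        · exact h1.trans (mul_le_mul_of_nonneg_left h2 hx.le)
        · nlinarith [sq_nonneg x]
      rw [mul_assoc, h4] at h6
      linarith
  nlinarith

/-- Split coth x into (cosh x − 1)/sinh x, which lies in [0, x], and 1/sinh x, which differs from
1/x by an amount in [−x, 0]. -/
lemma abs_coth_sub_le {x : ℝ} (hx : 0 < x) : |Real.cosh x / Real.sinh x - 1 / x| ≤ x := by
  obtain ⟨h1, h2⟩ := inv_sinh_bounds hx
  have hs0 : 0 < Real.sinh x := Real.sinh_pos_iff.2 hx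
  have h3 : (Real.cosh x - 1) / Real.sinh x ≤ x := by
    rw [div_le_iff₀ hs0]
    have e : x = 2 * (x / 2) := by ring
    have h := sinh_le_mul_cosh (x := x / 2) (by positivity)
    have hsn := Real.sinh_nonneg_iff.2 (show 0 ≤ x / 2 by positivity)
    rw [e, Real.cosh_two_mul, Real.sinh_two_mul, ← e]
    nlinarith [Real.cosh_sq (x / 2), Real.cosh_pos (x / 2)]
  have h4 : 0 ≤ (Real.cosh x - 1) / Real.sinh x :=
    div_nonneg (by linarith [Real.one_le_cosh x]) hs0.le
  have h5 : Real.cosh x / Real.sinh x = (Real.cosh x - 1) / Real.sinh x + 1 / Real.sinh x := by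
    rw [← add_div]; ring
  rw [h5, abs_le]
  constructor <;> linarith

lemma inv_sinh_le_exp {x x₀ : ℝ} (h₀ : 0 < x₀) (hx : x₀ ≤ x) :
    1 / Real.sinh x ≤ 2 / (1 - Real.exp (-2 * x₀)) * Real.exp (-x) := by
  have h1 : Real.exp (-2 * x) ≤ Real.exp (-2 * x₀) := Real.exp_le_exp.2 (by linarith)
  have h2 : Real.exp (-2 * x₀) < 1 := by rw [Real.exp_lt_one_iff]; linarith
  have h3 : Real.sinh x = Real.exp x * (1 - Real.exp (-2 * x)) / 2 := by
    rw [Real.sinh_eq, mul_sub, ← Real.exp_add]; ring_nf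
  rw [h3, div_mul_eq_mul_div, div_le_div_iff₀ _ (by linarith)]
  · have : Real.exp (-x) * Real.exp x = 1 := by rw [← Real.exp_add]; simp
    have e : 2 * Real.exp (-x) * (Real.exp x * (1 - Real.exp (-2 * x)) / 2) =
      (Real.exp (-x) * Real.exp x) * (1 - Real.exp (-2 * x)) := by ring
    rw [e, this]; linarith
  · have := Real.exp_pos x
    have : 0 < 1 - Real.exp (-2 * x) := by linarith
    positivity

lemma norm_cos_le_exp (w : ℂ) : ‖Complex.cos w‖ ≤ Real.exp |w.im| := by
  rw [Complex.cos, norm_div, Complex.norm_two]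
  have h := norm_add_le (Complex.exp (w * Complex.I)) (Complex.exp (-w * Complex.I))
  rw [Complex.norm_exp, Complex.norm_exp] at h
  have h1 : Real.exp (w * Complex.I).re ≤ Real.exp |w.im| := by
    apply Real.exp_le_exp.2; simp [neg_le_abs]
  have h2 : Real.exp (-w * Complex.I).re ≤ Real.exp |w.im| := by
    apply Real.exp_le_exp.2; simp [le_abs_self]
  linarith

lemma norm_sin_le_exp (w : ℂ) : ‖Complex.sin w‖ ≤ Real.exp |w.im| := by
  rw [Complex.sin, norm_div, Complex.norm_two, norm_mul, Complex.norm_I, mul_one]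
  have h := norm_sub_le (Complex.exp (-w * Complex.I)) (Complex.exp (w * Complex.I))
  rw [Complex.norm_exp, Complex.norm_exp] at h
  have h1 : Real.exp (w * Complex.I).re ≤ Real.exp |w.im| := by
    apply Real.exp_le_exp.2; simp [neg_le_abs]
  have h2 : Real.exp (-w * Complex.I).re ≤ Real.exp |w.im| := by
    apply Real.exp_le_exp.2; simp [le_abs_self]
  linarith

lemma norm_cos_sub_one_le (w : ℂ) : ‖Complex.cos w - 1‖ ≤ ‖w‖ ^ 2 * Real.exp ‖w‖ := by
  have e : Complex.cos w - 1 = ((Complex.exp (w * Complex.I) -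
      ∑ m ∈ Finset.range 2, (w * Complex.I) ^ m / (m.factorial : ℂ)) +
      (Complex.exp (-w * Complex.I) -
      ∑ m ∈ Finset.range 2, (-w * Complex.I) ^ m / (m.factorial : ℂ))) / 2 := by
    rw [Complex.cos]; simp [Finset.sum_range_succ]; ring
  have h1 := Complex.norm_exp_sub_sum_le_norm_mul_exp (w * Complex.I) 2
  have h2 := Complex.norm_exp_sub_sum_le_norm_mul_exp (-w * Complex.I) 2
  simp only [norm_mul, norm_neg, Complex.norm_I, mul_one] at h1 h2
  rw [e, norm_div, Complex.norm_two]
  have := norm_add_le (Complex.exp (w * Complex.I) -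
      ∑ m ∈ Finset.range 2, (w * Complex.I) ^ m / (m.factorial : ℂ)) (Complex.exp (-w * Complex.I) -
      ∑ m ∈ Finset.range 2, (-w * Complex.I) ^ m / (m.factorial : ℂ))
  linarith

/-- Mean value inequality on the convex strip |Im u| ≤ |Im w|, where the derivative cos is at most
e^{|Im w|}. -/
lemma norm_sin_le_mul_exp (w : ℂ) : ‖Complex.sin w‖ ≤ ‖w‖ * Real.exp |w.im| := by
  have hconv : Convex ℝ {u : ℂ | |u.im| ≤ |w.im|} := by
    have : {u : ℂ | |u.im| ≤ |w.im|} = Complex.imLm ⁻¹' (Icc (-|w.im|) |w.im|) := by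
      ext u; simp [abs_le]
    rw [this]; exact (convex_Icc _ _).is_linear_preimage Complex.imLm.isLinear
  have h := hconv.norm_image_sub_le_of_norm_hasDerivWithin_le (f := Complex.sin) (f' := Complex.cos)
    (C := Real.exp |w.im|) (x := 0) (y := w)
    (fun u _ => (Complex.hasDerivAt_sin u).hasDerivWithinAt)
    (fun u hu => (norm_cos_le_exp u).trans (Real.exp_le_exp.2 hu))
    (show |(0 : ℂ).im| ≤ |w.im| by simp) (le_refl |w.im|)
  simpa [mul_comm] using h

/-! ### Sine transforms of kernels with a double pole at the origin -/

/-- A continuous function on `(0, ∞)` that equals `t⁻²` up to a bounded error at the origin and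
is `O(e^{-a t})` at infinity. -/
structure IsKernel (k : ℝ → ℝ) (a : ℝ) : Prop where
  cont : ContinuousOn k (Ioi 0)
  near : ∃ C, ∀ t, 0 < t → t ≤ 1 → |k t - 1 / t ^ 2| ≤ C
  far : ∃ C, ∀ t, 1 < t → |k t| ≤ C * Real.exp (-(a * t))

/-- The integrand of `Psi`. -/
noncomputable def psi (k : ℝ → ℝ) (z : ℂ) (t : ℝ) : ℂ :=
  Complex.cos (2 * (t : ℂ) * z) * (k t : ℂ) - 1 / (t : ℂ) ^ 2

/-- The integrand of `Lam`. -/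
noncomputable def lam (k : ℝ → ℝ) (z : ℂ) (t : ℝ) : ℂ :=
  (Complex.sin (2 * (t : ℂ) * z) * (k t : ℂ) / 2 - z / (t : ℂ)) / (t : ℂ)

/-- The regularized sine transform of a kernel; for `k t = 1 / (sinh (t / b) sinh (b t))` it is
`-i log s_b`. -/
noncomputable def Lam (k : ℝ → ℝ) (z : ℂ) : ℂ := ∫ t in Ioi (0 : ℝ), lam k z t

/-- The regularized cosine transform of a kernel, the derivative of `Lam`. -/
noncomputable def Psi (k : ℝ → ℝ) (z : ℂ) : ℂ := ∫ t in Ioi (0 : ℝ), psi k z t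

lemma integrableOn_near_far {f : ℝ → ℝ} (h0 : IntegrableOn f (Ioc 0 1))
    (h1 : IntegrableOn f (Ioi 1)) : IntegrableOn f (Ioi 0) := by
  rw [← Ioc_union_Ioi_eq_Ioi (zero_le_one (α := ℝ))]
  exact h0.union h1

lemma integrableOn_piecewise {f g : ℝ → ℝ} (h0 : IntegrableOn f (Ioc 0 1))
    (h1 : IntegrableOn g (Ioi 1)) :
    IntegrableOn (fun t => if t ≤ 1 then f t else g t) (Ioi 0) := by
  apply integrableOn_near_far
  · exact h0.congr_fun (fun t ht => by simp [ht.2]) measurableSet_Ioc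
  · exact h1.congr_fun (fun t ht => by simp [not_le.2 (mem_Ioi.1 ht)]) measurableSet_Ioi

lemma integrableOn_inv_sq : IntegrableOn (fun t : ℝ => 1 / t ^ 2) (Ioi 1) := by
  refine (integrableOn_Ioi_rpow_of_lt (a := -2) (c := 1) (by norm_num) one_pos).congr_fun ?_
    measurableSet_Ioi
  intro t ht
  have : (0 : ℝ) < t := one_pos.trans ht
  simp [Real.rpow_neg this.le]

lemma integrableOn_exp_neg {δ : ℝ} (hδ : 0 < δ) (c : ℝ) :
    IntegrableOn (fun t : ℝ => Real.exp (-(δ * t))) (Ioi c) := by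
  simpa using integrableOn_exp_mul_Ioi (a := -δ) (by linarith) c

lemma im_two_mul_ofReal (t : ℝ) (z : ℂ) : (2 * (t : ℂ) * z).im = 2 * t * z.im := by
  simp [Complex.mul_im]

lemma norm_two_mul_ofReal {t : ℝ} (ht : 0 < t) (z : ℂ) : ‖2 * (t : ℂ) * z‖ = 2 * t * ‖z‖ := by
  simp [abs_of_pos ht]

lemma IsKernel.near_le {k : ℝ → ℝ} {a : ℝ} (hk : IsKernel k a) :
    ∃ C, 0 ≤ C ∧ ∀ t, 0 < t → t ≤ 1 → t ^ 2 * |k t| ≤ C := by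
  obtain ⟨C, hC⟩ := hk.near
  have hC0 : 0 ≤ C := (abs_nonneg _).trans (hC 1 one_pos le_rfl)
  refine ⟨C + 1, by linarith, fun t h0 h1 => ?_⟩
  have h2 := hC t h0 h1
  have h3 : |k t| ≤ C + 1 / t ^ 2 := by
    have := abs_add_le (k t - 1 / t ^ 2) (1 / t ^ 2)
    rw [sub_add_cancel, abs_of_pos (show 0 < 1 / t ^ 2 by positivity)] at this
    linarith
  calc t ^ 2 * |k t| ≤ t ^ 2 * (C + 1 / t ^ 2) := by gcongr
    _ = t ^ 2 * C + 1 := by field_simp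
    _ ≤ C + 1 := by nlinarith [pow_le_one₀ h0.le h1 (n := 2)]

lemma abs_im_two_mul_le {t y : ℝ} (ht : 0 < t) {z : ℂ} (hz : |z.im| ≤ y) :
    |(2 * (t : ℂ) * z).im| ≤ 2 * t * y := by
  rw [im_two_mul_ofReal, abs_mul, abs_of_pos (by positivity : 0 < 2 * t)]
  gcongr

/-- A single majorant for a bounded piece of a closed substrip feeds every dominated convergence
argument below. Near 0 the double pole of the kernel cancels against 1/t², and beyond 1 the growth
e^{2ty} loses to e^{−at}. -/
lemma IsKernel.exists_bound_psi {k : ℝ → ℝ} {a : ℝ} (hk : IsKernel k a) (R : ℝ) {y : ℝ}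
    (hy : 2 * y < a) : ∃ B : ℝ → ℝ, IntegrableOn B (Ioi 0) ∧ ∀ t, 0 < t → ∀ z : ℂ, ‖z‖ ≤ R →
      |z.im| ≤ y → ‖psi k z t‖ ≤ B t := by
  obtain ⟨C, hC⟩ := hk.near
  obtain ⟨D, hD0, hD⟩ := hk.near_le
  obtain ⟨E, hE⟩ := hk.far
  refine ⟨fun t => if t ≤ 1 then (2 * R) ^ 2 * Real.exp (2 * R) * D + C else
    E * Real.exp (-((a - 2 * y) * t)) + 1 / t ^ 2, ?_, ?_⟩
  · refine integrableOn_piecewise ?_ ?_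
    · exact integrableOn_const (by simp)
    · exact ((integrableOn_exp_neg (by linarith) 1).const_mul E).add integrableOn_inv_sq
  · intro t ht z hzR hzy
    have hR : 0 ≤ R := (norm_nonneg z).trans hzR
    by_cases h1 : t ≤ 1
    · simp only [h1, if_true]
      have e : psi k z t = (Complex.cos (2 * (t : ℂ) * z) - 1) * (k t : ℂ) +
          ((k t - 1 / t ^ 2 : ℝ) : ℂ) := by
        simp [psi]; ring
      rw [e]
      refine (norm_add_le _ _).trans (add_le_add ?_ ?_)
      · rw [norm_mul, Complex.norm_real, Real.norm_eq_abs]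
        have h2 := norm_cos_sub_one_le (2 * (t : ℂ) * z)
        rw [norm_two_mul_ofReal ht] at h2
        have h3 : (2 * t * ‖z‖) ^ 2 * Real.exp (2 * t * ‖z‖) ≤
            (2 * R) ^ 2 * Real.exp (2 * R) * t ^ 2 := by
          have h4 : Real.exp (2 * t * ‖z‖) ≤ Real.exp (2 * R) := by
            apply Real.exp_le_exp.2
            nlinarith [norm_nonneg z]
          calc (2 * t * ‖z‖) ^ 2 * Real.exp (2 * t * ‖z‖) ≤ (2 * t * R) ^ 2 * Real.exp (2 * R) := by
                gcongr
            _ = _ := by ring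
        calc _ ≤ (2 * R) ^ 2 * Real.exp (2 * R) * t ^ 2 * |k t| := by
              gcongr; exact h2.trans h3
          _ = (2 * R) ^ 2 * Real.exp (2 * R) * (t ^ 2 * |k t|) := by ring
          _ ≤ _ := by gcongr; exact hD t ht h1
      · rw [Complex.norm_real, Real.norm_eq_abs]; exact hC t ht h1
    · simp only [h1, if_false]
      push Not at h1
      refine (norm_sub_le _ _).trans (add_le_add ?_ ?_)
      · rw [norm_mul, Complex.norm_real, Real.norm_eq_abs]
        calc _ ≤ Real.exp (2 * t * y) * (E * Real.exp (-(a * t))) := by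
              gcongr
              · exact (norm_cos_le_exp _).trans (Real.exp_le_exp.2 (abs_im_two_mul_le ht hzy))
              · exact hE t h1
          _ = E * Real.exp (-((a - 2 * y) * t)) := by
              rw [mul_left_comm, ← Real.exp_add]; ring_nf
      · simp

lemma hasDerivAt_lam (k : ℝ → ℝ) (z : ℂ) {t : ℝ} (ht : 0 < t) :
    HasDerivAt (fun z => lam k z t) (psi k z t) z := by
  have h1 : HasDerivAt (fun z : ℂ => 2 * (t : ℂ) * z) (2 * (t : ℂ)) z := by
    simpa using (hasDerivAt_id z).const_mul (2 * (t : ℂ))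
  have h2 := ((((h1.csin).mul_const (k t : ℂ)).div_const 2).sub
    ((hasDerivAt_id z).div_const (t : ℂ))).div_const (t : ℂ)
  have ht' : (t : ℂ) ≠ 0 := by exact_mod_cast ht.ne'
  refine h2.congr_deriv ?_
  rw [psi]; field_simp

lemma convex_norm_im (R y : ℝ) : Convex ℝ {u : ℂ | ‖u‖ ≤ R ∧ |u.im| ≤ y} := by
  have : {u : ℂ | ‖u‖ ≤ R ∧ |u.im| ≤ y} =
      Metric.closedBall 0 R ∩ Complex.imLm ⁻¹' (Icc (-y) y) := by
    ext u; simp [abs_le]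
  rw [this]
  exact (convex_closedBall _ _).inter ((convex_Icc _ _).is_linear_preimage Complex.imLm.isLinear)

/-- `lam` vanishes at z = 0 and has `z`-derivative `psi`, so a bound for `psi` on a convex set
containing 0 passes to `lam`. -/
lemma norm_lam_le {k : ℝ → ℝ} {R y b : ℝ} {t : ℝ} (ht : 0 < t)
    (hB : ∀ z : ℂ, ‖z‖ ≤ R → |z.im| ≤ y → ‖psi k z t‖ ≤ b) {z : ℂ} (hz : ‖z‖ ≤ R)
    (hzy : |z.im| ≤ y) : ‖lam k z t‖ ≤ R * b := by
  have h := (convex_norm_im R y).norm_image_sub_le_of_norm_hasDerivWithin_le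
    (f := fun z => lam k z t) (f' := fun z => psi k z t) (C := b) (x := 0) (y := z)
    (fun u _ => (hasDerivAt_lam k u ht).hasDerivWithinAt) (fun u hu => hB u hu.1 hu.2)
    (by simp [(norm_nonneg z).trans hz, (abs_nonneg z.im).trans hzy]) ⟨hz, hzy⟩
  have h0 : lam k 0 t = 0 := by simp [lam]
  simp only [h0, sub_zero] at h
  have hb : 0 ≤ b := (norm_nonneg _).trans (hB z hz hzy)
  nlinarith

lemma IsKernel.aestronglyMeasurable_psi {k : ℝ → ℝ} {a : ℝ} (hk : IsKernel k a) (z : ℂ) :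
    AEStronglyMeasurable (psi k z) (volume.restrict (Ioi 0)) := by
  apply ContinuousOn.aestronglyMeasurable _ measurableSet_Ioi
  have h1 : ContinuousOn (fun t : ℝ => (k t : ℂ)) (Ioi 0) :=
    Complex.continuous_ofReal.comp_continuousOn hk.cont
  have h2 : ContinuousOn (fun t : ℝ => Complex.cos (2 * (t : ℂ) * z)) (Ioi 0) := by fun_prop
  refine (h2.mul h1).sub ?_
  refine continuousOn_const.div (by fun_prop) (fun t ht => ?_)
  have : (t : ℂ) ≠ 0 := by exact_mod_cast (mem_Ioi.1 ht).ne'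
  exact pow_ne_zero _ this

lemma IsKernel.aestronglyMeasurable_lam {k : ℝ → ℝ} {a : ℝ} (hk : IsKernel k a) (z : ℂ) :
    AEStronglyMeasurable (lam k z) (volume.restrict (Ioi 0)) := by
  apply ContinuousOn.aestronglyMeasurable _ measurableSet_Ioi
  have h1 : ContinuousOn (fun t : ℝ => (k t : ℂ)) (Ioi 0) :=
    Complex.continuous_ofReal.comp_continuousOn hk.cont
  have h2 : ContinuousOn (fun t : ℝ => Complex.sin (2 * (t : ℂ) * z)) (Ioi 0) := by fun_prop
  have h3 : ∀ t ∈ Ioi (0 : ℝ), (t : ℂ) ≠ 0 := fun t ht => by exact_mod_cast (mem_Ioi.1 ht).ne'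
  refine ContinuousOn.div (((h2.mul h1).div_const 2).sub ?_) (by fun_prop) h3
  exact continuousOn_const.div (by fun_prop) h3

lemma IsKernel.integrableOn_psi {k : ℝ → ℝ} {a : ℝ} (hk : IsKernel k a) {z : ℂ}
    (hz : 2 * |z.im| < a) : IntegrableOn (psi k z) (Ioi 0) := by
  obtain ⟨B, hB, hle⟩ := hk.exists_bound_psi ‖z‖ hz
  refine Integrable.mono' hB (hk.aestronglyMeasurable_psi z) ?_
  exact (ae_restrict_mem measurableSet_Ioi).mono fun t ht => hle t ht z le_rfl le_rfl

lemma IsKernel.integrableOn_lam {k : ℝ → ℝ} {a : ℝ} (hk : IsKernel k a) {z : ℂ}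
    (hz : 2 * |z.im| < a) : IntegrableOn (lam k z) (Ioi 0) := by
  obtain ⟨B, hB, hle⟩ := hk.exists_bound_psi ‖z‖ hz
  refine Integrable.mono' (hB.const_mul ‖z‖) (hk.aestronglyMeasurable_lam z) ?_
  exact (ae_restrict_mem measurableSet_Ioi).mono fun t ht =>
    norm_lam_le ht (hle t ht) le_rfl le_rfl

/-- The height (2|Im z| + a)/4 is the midpoint of |Im z| and a/2, so there is room both around z and
below the edge of the strip. -/
lemma strip_mem_nhds {a : ℝ} {z : ℂ} (hz : 2 * |z.im| < a) :
    {w : ℂ | ‖w‖ ≤ ‖z‖ + 1 ∧ |w.im| ≤ (2 * |z.im| + a) / 4} ∈ 𝓝 z := by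
  have h1 : ∀ᶠ w : ℂ in 𝓝 z, ‖w‖ < ‖z‖ + 1 :=
    continuous_norm.continuousAt.eventually_lt continuousAt_const (by simp)
  have h2 : ∀ᶠ w : ℂ in 𝓝 z, |w.im| < (2 * |z.im| + a) / 4 :=
    (Complex.continuous_im.abs.continuousAt).eventually_lt continuousAt_const (by linarith)
  filter_upwards [h1, h2] with w h3 h4 using ⟨h3.le, h4.le⟩

lemma IsKernel.hasDerivAt_Lam {k : ℝ → ℝ} {a : ℝ} (hk : IsKernel k a) {z : ℂ}
    (hz : 2 * |z.im| < a) : HasDerivAt (Lam k) (Psi k z) z := by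
  obtain ⟨B, hB, hle⟩ := hk.exists_bound_psi (‖z‖ + 1) (y := (2 * |z.im| + a) / 4) (by linarith)
  refine (hasDerivAt_integral_of_dominated_loc_of_deriv_le (F := fun z t => lam k z t)
    (F' := fun z t => psi k z t) (strip_mem_nhds hz)
    (Eventually.of_forall fun w => hk.aestronglyMeasurable_lam w) (hk.integrableOn_lam hz)
    (hk.aestronglyMeasurable_psi z) ?_ hB ?_).2
  · exact (ae_restrict_mem measurableSet_Ioi).mono fun t ht w hw => hle t ht w hw.1 hw.2
  · exact (ae_restrict_mem measurableSet_Ioi).mono fun t ht w _ => hasDerivAt_lam k w ht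

lemma isOpen_strip (a : ℝ) : IsOpen {z : ℂ | 2 * |z.im| < a} :=
  isOpen_lt (by fun_prop) continuous_const

lemma IsKernel.differentiableAt_Psi {k : ℝ → ℝ} {a : ℝ} (hk : IsKernel k a) {z : ℂ}
    (hz : 2 * |z.im| < a) : DifferentiableAt ℂ (Psi k) z := by
  have h : DifferentiableOn ℂ (Lam k) {z : ℂ | 2 * |z.im| < a} := fun w hw =>
    (hk.hasDerivAt_Lam hw).differentiableAt.differentiableWithinAt
  have h2 : DifferentiableOn ℂ (Psi k) {z : ℂ | 2 * |z.im| < a} :=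
    (h.deriv (isOpen_strip a)).congr fun w hw => (hk.hasDerivAt_Lam hw).deriv.symm
  exact h2.differentiableAt ((isOpen_strip a).mem_nhds hz)

lemma Lam_neg (k : ℝ → ℝ) (z : ℂ) : Lam k (-z) = -Lam k z := by
  rw [Lam, Lam, ← integral_neg]
  congr 1; ext t
  simp only [lam, mul_neg, Complex.sin_neg]; ring

lemma Lam_conj (k : ℝ → ℝ) (z : ℂ) :
    Lam k ((starRingEnd ℂ) z) = (starRingEnd ℂ) (Lam k z) := by
  rw [Lam, Lam, ← integral_conj]
  congr 1; ext t
  simp [lam, ← Complex.sin_conj, map_ofNat]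

lemma Lam_zero (k : ℝ → ℝ) : Lam k 0 = 0 := by simp [Lam, lam]

/-- The kernel `q / (t sinh (q t))`. -/
noncomputable def kerOne (q t : ℝ) : ℝ := q / (t * Real.sinh (q * t))

/-- `kerOne` is the model kernel, with an elementary cosine transform. It serves with q = 1 as the
semiclassical limit and with q = Q b as the comparison kernel for s_b at infinity. -/
lemma isKernel_kerOne {q : ℝ} (hq : 0 < q) : IsKernel (kerOne q) q where
  cont := by
    unfold kerOne
    refine continuousOn_const.div (by fun_prop) fun t ht => ?_
    have := Real.sinh_pos_iff.2 (mul_pos hq (mem_Ioi.1 ht))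
    exact mul_ne_zero (mem_Ioi.1 ht).ne' this.ne'
  near := by
    refine ⟨q ^ 2, fun t h0 _ => ?_⟩
    obtain ⟨h1, h2⟩ := inv_sinh_bounds (mul_pos hq h0)
    have e : kerOne q t - 1 / t ^ 2 = -(q / t * (1 / (q * t) - 1 / Real.sinh (q * t))) := by
      unfold kerOne; field_simp; ring
    rw [e, abs_neg, abs_of_nonneg (mul_nonneg (by positivity) (by linarith))]
    calc _ ≤ q / t * (q * t) := by gcongr
      _ = _ := by field_simp
  far := by
    refine ⟨q * (2 / (1 - Real.exp (-2 * q))), fun t ht => ?_⟩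
    have h0 : 0 < t := one_pos.trans ht
    have h1 := inv_sinh_le_exp hq (show q ≤ q * t by nlinarith)
    have h2 := Real.sinh_pos_iff.2 (mul_pos hq h0)
    unfold kerOne
    rw [abs_of_pos (by positivity), mul_assoc]
    calc q / (t * Real.sinh (q * t)) ≤ q / (1 * Real.sinh (q * t)) := by gcongr
      _ = q * (1 / Real.sinh (q * t)) := by ring
      _ ≤ _ := by gcongr

/-- The `z`-derivative of `psi`. -/
noncomputable def dpsi (k : ℝ → ℝ) (z : ℂ) (t : ℝ) : ℂ :=
  -(2 * (t : ℂ) * Complex.sin (2 * (t : ℂ) * z) * (k t : ℂ))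

lemma hasDerivAt_psi (k : ℝ → ℝ) (z : ℂ) (t : ℝ) :
    HasDerivAt (fun z => psi k z t) (dpsi k z t) z := by
  have h1 : HasDerivAt (fun z : ℂ => 2 * (t : ℂ) * z) (2 * (t : ℂ)) z := by
    simpa using (hasDerivAt_id z).const_mul (2 * (t : ℂ))
  refine (((h1.ccos).mul_const (k t : ℂ)).sub_const (1 / (t : ℂ) ^ 2)).congr_deriv ?_
  rw [dpsi]; ring

lemma IsKernel.exists_bound_dpsi {k : ℝ → ℝ} {a : ℝ} (hk : IsKernel k a) (R : ℝ) {y : ℝ}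
    (hy : 2 * y < a) : ∃ B : ℝ → ℝ, IntegrableOn B (Ioi 0) ∧ ∀ t, 0 < t → ∀ z : ℂ, ‖z‖ ≤ R →
      |z.im| ≤ y → ‖dpsi k z t‖ ≤ B t := by
  obtain ⟨D, hD0, hD⟩ := hk.near_le
  obtain ⟨E, hE⟩ := hk.far
  set δ := a - 2 * y with hδ
  have hδ0 : 0 < δ := by linarith
  refine ⟨fun t => if t ≤ 1 then 4 * R * Real.exp (2 * R) * D else
    4 / δ * E * Real.exp (-(δ / 2 * t)), ?_, ?_⟩
  · exact integrableOn_piecewise (integrableOn_const (by simp))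
      ((integrableOn_exp_neg (by linarith) 1).const_mul _)
  · intro t ht z hzR hzy
    have hR : 0 ≤ R := (norm_nonneg z).trans hzR
    have hn : ‖dpsi k z t‖ = 2 * t * ‖Complex.sin (2 * (t : ℂ) * z)‖ * |k t| := by
      simp [dpsi, abs_of_pos ht]
    rw [hn]
    by_cases h1 : t ≤ 1
    · simp only [h1, if_true]
      have h2 := norm_sin_le_mul_exp (2 * (t : ℂ) * z)
      rw [norm_two_mul_ofReal ht] at h2
      have h3 : Real.exp |(2 * (t : ℂ) * z).im| ≤ Real.exp (2 * R) := by
        apply Real.exp_le_exp.2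
        refine (Complex.abs_im_le_norm _).trans ?_
        rw [norm_two_mul_ofReal ht]
        nlinarith [norm_nonneg z]
      calc _ ≤ 2 * t * (2 * t * R * Real.exp (2 * R)) * |k t| := by
            gcongr; exact h2.trans (by gcongr)
        _ = 4 * R * Real.exp (2 * R) * (t ^ 2 * |k t|) := by ring
        _ ≤ _ := by gcongr; exact hD t ht h1
    · simp only [h1, if_false]
      push Not at h1
      have h2 : 2 * t ≤ 4 / δ * Real.exp (δ / 2 * t) := by
        have := Real.add_one_le_exp (δ / 2 * t)
        rw [div_mul_eq_mul_div, le_div_iff₀ hδ0]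
        linarith
      calc _ ≤ 4 / δ * Real.exp (δ / 2 * t) * Real.exp (2 * t * y) * (E * Real.exp (-(a * t))) := by
            gcongr
            · exact (norm_sin_le_exp _).trans (Real.exp_le_exp.2 (abs_im_two_mul_le ht hzy))
            · exact hE t h1
        _ = 4 / δ * E * (Real.exp (δ / 2 * t) * Real.exp (2 * t * y) * Real.exp (-(a * t))) := by ring
        _ = _ := by
          rw [← Real.exp_add, ← Real.exp_add, hδ]; ring_nf

lemma IsKernel.hasDerivAt_Psi {k : ℝ → ℝ} {a : ℝ} (hk : IsKernel k a) {z : ℂ}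
    (hz : 2 * |z.im| < a) : HasDerivAt (Psi k) (∫ t in Ioi (0 : ℝ), dpsi k z t) z := by
  obtain ⟨B, hB, hle⟩ := hk.exists_bound_dpsi (‖z‖ + 1) (y := (2 * |z.im| + a) / 4) (by linarith)
  refine (hasDerivAt_integral_of_dominated_loc_of_deriv_le (F := fun z t => psi k z t)
    (F' := fun z t => dpsi k z t) (strip_mem_nhds hz)
    (Eventually.of_forall fun w => hk.aestronglyMeasurable_psi w) (hk.integrableOn_psi hz)
    ?_ ?_ hB ?_).2
  · apply ContinuousOn.aestronglyMeasurable _ measurableSet_Ioi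
    have h1 : ContinuousOn (fun t : ℝ => (k t : ℂ)) (Ioi 0) :=
      Complex.continuous_ofReal.comp_continuousOn hk.cont
    have h2 : ContinuousOn (fun t : ℝ => 2 * (t : ℂ) * Complex.sin (2 * (t : ℂ) * z)) (Ioi 0) := by
      fun_prop
    exact (h2.mul h1).neg
  · exact (ae_restrict_mem measurableSet_Ioi).mono fun t ht w hw => hle t ht w hw.1 hw.2
  · exact (ae_restrict_mem measurableSet_Ioi).mono fun t ht w _ => hasDerivAt_psi k w t

/-! ### The partial fraction expansion of `tanh` -/

lemma mem_integerComplement_of_re {x : ℂ} (h0 : 0 < x.re) (h1 : x.re < 1) :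
    x ∈ Complex.integerComplement := by
  rintro ⟨n, rfl⟩
  simp only [Complex.intCast_re] at h0 h1
  have h2 : 0 < n := by exact_mod_cast h0
  have h3 : n < 1 := by exact_mod_cast h1
  omega

lemma two_mul_add_one_ne {z : ℂ} (hz : 2 * |z.im| < 1) (j : ℕ) :
    Complex.I * z + 1 / 2 + j ≠ 0 ∧ Complex.I * z - 1 / 2 - j ≠ 0 := by
  obtain ⟨h1, h2⟩ := abs_lt.1 (show |z.im| < 1 / 2 by linarith)
  have hj : (0 : ℝ) ≤ j := j.cast_nonneg
  constructor <;> intro h <;> have := congrArg Complex.re h <;> simp at this <;> linarith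

lemma cot_pi_half_add (w : ℂ) :
    Complex.cot (Real.pi * (1 / 2 + Complex.I * w)) =
      -(Complex.I * (Complex.sinh (Real.pi * w) / Complex.cosh (Real.pi * w))) := by
  have e : (Real.pi : ℂ) * (1 / 2 + Complex.I * w) =
      (Real.pi : ℂ) * w * Complex.I + (Real.pi : ℂ) / 2 := by ring
  rw [e, Complex.cot, Complex.cos_add_pi_div_two, Complex.sin_add_pi_div_two,
    Complex.sin_mul_I, Complex.cos_mul_I]
  ring

/-- This is the partial fraction series of π cot(πx) at x = 1/2 + iz. -/
lemma tendsto_tanh_series {z : ℂ} (hz : 2 * |z.im| < 1) :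
    Tendsto (fun N : ℕ => ∑ j ∈ Finset.range N, 8 * z / ((2 * j + 1) ^ 2 + 4 * z ^ 2)) atTop
      (𝓝 (Real.pi * (Complex.sinh (Real.pi * z) / Complex.cosh (Real.pi * z)))) := by
  obtain ⟨h1, h2⟩ := abs_lt.1 (show |z.im| < 1 / 2 by linarith)
  have hx : (1 / 2 + Complex.I * z) ∈ Complex.integerComplement := by
    apply mem_integerComplement_of_re <;> simp <;> linarith
  have h := tendsto_logDeriv_euler_cot_sub hx
  rw [cot_pi_half_add] at h
  -- `cotTerm` pairs x − (j + 1) with x + (j + 1), whereas the series for tanh pairs x − (j + 1)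
  -- with x + j. The regrouping leaves one boundary term at each end, and the far one tends to 0.
  have key : ∀ N : ℕ, ∑ j ∈ Finset.range N, cotTerm (1 / 2 + Complex.I * z) j =
      -Complex.I * (∑ j ∈ Finset.range N, 8 * z / ((2 * j + 1) ^ 2 + 4 * z ^ 2)) +
        1 / (Complex.I * z + 1 / 2 + N) - 1 / (1 / 2 + Complex.I * z) := by
    intro N
    induction N with
    | zero => simp; ring
    | succ N ih =>
      rw [Finset.sum_range_succ, Finset.sum_range_succ, ih, cotTerm]
      obtain ⟨n1, n2⟩ := two_mul_add_one_ne hz N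
      have e1 : 1 / 2 + Complex.I * z - (N + 1) = Complex.I * z - 1 / 2 - N := by ring
      have e2 : 1 / 2 + Complex.I * z + (N + 1) = Complex.I * z + 1 / 2 + (N + 1 : ℕ) := by
        push_cast; ring
      have e3 : (8 * z / ((2 * N + 1) ^ 2 + 4 * z ^ 2) : ℂ) * -Complex.I =
          1 / (Complex.I * z + 1 / 2 + N) + 1 / (Complex.I * z - 1 / 2 - N) := by
        have n3 : ((2 * N + 1) ^ 2 + 4 * z ^ 2 : ℂ) =
            -4 * ((Complex.I * z + 1 / 2 + N) * (Complex.I * z - 1 / 2 - N)) := by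
          ring_nf; simp [Complex.I_sq]
        rw [n3, one_div_add_one_div n1 n2, div_mul_eq_mul_div, div_eq_div_iff
          (mul_ne_zero (by norm_num) (mul_ne_zero n1 n2)) (mul_ne_zero n1 n2)]
        ring
      rw [e1, e2, mul_add, mul_comm (-Complex.I) (8 * z / _), e3]
      ring
  have hlim : Tendsto (fun N : ℕ => 1 / (Complex.I * z + 1 / 2 + N)) atTop (𝓝 0) := by
    simp only [one_div]
    apply tendsto_inv₀_cobounded.comp
    apply (tendsto_const_add_cobounded _).comp
    exact tendsto_natCast_atTop_cobounded
  have h3 : Tendsto (fun N : ℕ => Complex.I * ((∑ j ∈ Finset.range N,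
      cotTerm (1 / 2 + Complex.I * z) j) - 1 / (Complex.I * z + 1 / 2 + N) +
        1 / (1 / 2 + Complex.I * z))) atTop
      (𝓝 (Complex.I * ((Real.pi * -(Complex.I * (Complex.sinh (Real.pi * z) /
        Complex.cosh (Real.pi * z))) - 1 / (1 / 2 + Complex.I * z)) - 0 +
        1 / (1 / 2 + Complex.I * z)))) :=
    ((h.sub hlim).add_const _).const_mul _
  convert h3 using 2
  · rw [key]
    linear_combination (∑ j ∈ Finset.range _, 8 * z / ((2 * (j : ℂ) + 1) ^ 2 + 4 * z ^ 2)) *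
      Complex.I_sq
  · linear_combination ((Real.pi : ℂ) * (Complex.sinh (Real.pi * z) /
      Complex.cosh (Real.pi * z))) * Complex.I_sq

lemma integral_sin_mul_exp {z : ℂ} {a : ℝ} (ha : 2 * |z.im| < a) :
    ∫ t in Ioi (0 : ℝ), Complex.sin (2 * (t : ℂ) * z) * Complex.exp (-(a * t)) =
      2 * z / (a ^ 2 + 4 * z ^ 2) := by
  obtain ⟨h1, h2⟩ := abs_lt.1 (show |z.im| < a / 2 by linarith)
  have r1 : (-(2 * z * Complex.I) - a).re < 0 := by simp; linarith
  have r2 : (2 * z * Complex.I - a).re < 0 := by simp; linarith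
  have n1 : -(2 * z * Complex.I) - a ≠ 0 := fun h => by simp [h] at r1
  have n2 : 2 * z * Complex.I - a ≠ 0 := fun h => by simp [h] at r2
  have e : ∀ t : ℝ, Complex.sin (2 * (t : ℂ) * z) * Complex.exp (-(a * t)) =
      Complex.I / 2 * (Complex.exp ((-(2 * z * Complex.I) - a) * t) -
        Complex.exp ((2 * z * Complex.I - a) * t)) := by
    intro t
    have x1 : (-(2 * z * Complex.I) - a) * t = -(2 * (t : ℂ) * z) * Complex.I + -(a * t) := by ring
    have x2 : (2 * z * Complex.I - a) * t = (2 * (t : ℂ) * z) * Complex.I + -(a * t) := by ring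
    rw [x1, x2, Complex.exp_add, Complex.exp_add, Complex.sin]
    ring
  simp_rw [e]
  rw [integral_const_mul, integral_sub (integrableOn_exp_mul_complex_Ioi r1 0)
    (integrableOn_exp_mul_complex_Ioi r2 0), integral_exp_mul_complex_Ioi r1,
    integral_exp_mul_complex_Ioi r2]
  have n3 : (a ^ 2 + 4 * z ^ 2 : ℂ) = (-(2 * z * Complex.I) - a) * (2 * z * Complex.I - a) := by
    ring_nf; simp [Complex.I_sq]
  rw [n3]
  simp only [Complex.ofReal_zero, mul_zero, Complex.exp_zero]
  rw [div_sub_div _ _ n1 n2, ← mul_div_assoc]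
  congr 1
  linear_combination (-2 * z) * Complex.I_sq

lemma hasSum_exp_odd {t : ℝ} (ht : 0 < t) :
    HasSum (fun n : ℕ => Complex.exp (-(((2 * n + 1 : ℝ) : ℂ) * t)))
      ((1 / (2 * Real.sinh t) : ℝ) : ℂ) := by
  have hr : Real.exp (-(2 * t)) < 1 := by rw [Real.exp_lt_one_iff]; linarith
  have h := (hasSum_geometric_of_lt_one (Real.exp_pos _).le hr).mul_left (Real.exp (-t))
  have h2 : HasSum (fun n : ℕ => Real.exp (-((2 * n + 1) * t))) (1 / (2 * Real.sinh t)) := by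
    have e1 : (fun n : ℕ => Real.exp (-((2 * n + 1) * t))) =
        fun n : ℕ => Real.exp (-t) * Real.exp (-(2 * t)) ^ n := by
      ext n
      rw [← Real.exp_nat_mul, ← Real.exp_add]; ring_nf
    have e2 : 1 / (2 * Real.sinh t) = Real.exp (-t) * (1 - Real.exp (-(2 * t)))⁻¹ := by
      have hs := Real.sinh_pos_iff.2 ht
      have h3 : 0 < 1 - Real.exp (-(2 * t)) := by linarith
      rw [← div_eq_mul_inv, div_eq_div_iff (by positivity) h3.ne', Real.sinh_eq]
      have x1 : Real.exp (-(2 * t)) = Real.exp (-t) * Real.exp (-t) := by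
        rw [← Real.exp_add]; ring_nf
      have x2 : Real.exp (-t) * Real.exp t = 1 := by rw [← Real.exp_add]; simp
      rw [x1]
      linear_combination -x2
    rw [e1, e2]; exact h
  have h3 := (Complex.hasSum_ofReal).2 h2
  convert h3 using 2 with n
  push_cast; ring_nf

lemma integral_mul_exp {δ : ℝ} (hδ : 0 < δ) :
    IntegrableOn (fun t : ℝ => t * Real.exp (-(δ * t))) (Ioi 0) ∧
      ∫ t in Ioi (0 : ℝ), t * Real.exp (-(δ * t)) = 1 / δ ^ 2 := by
  have h := Real.integral_rpow_mul_exp_neg_mul_Ioi (a := 2) (by norm_num) hδ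
  have h1 : (2 : ℝ) - 1 = 1 := by norm_num
  simp only [h1, Real.rpow_one, Real.Gamma_two, mul_one, Real.rpow_two] at h
  refine ⟨?_, by rw [h]; simp⟩
  apply Integrable.of_integral_ne_zero
  rw [h]; positivity

lemma integral_sin_div_sinh {z : ℂ} (hz : 2 * |z.im| < 1) :
    ∫ t in Ioi (0 : ℝ), 2 * Complex.sin (2 * (t : ℂ) * z) / Complex.sinh t =
      Real.pi * (Complex.sinh (Real.pi * z) / Complex.cosh (Real.pi * z)) := by
  set y := |z.im| with hy
  have hy0 : 0 ≤ y := abs_nonneg _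
  let F : ℕ → ℝ → ℂ := fun n t =>
    4 * (Complex.sin (2 * (t : ℂ) * z) * Complex.exp (-(((2 * n + 1 : ℝ) : ℂ) * t)))
  have hδ : ∀ n : ℕ, 0 < (2 * n + 1 : ℝ) - 2 * y := fun n => by
    have : (0 : ℝ) ≤ n := n.cast_nonneg
    linarith
  -- The factor t from |sin w| ≤ |w| e^{|Im w|} makes the integrated norms O(n⁻²); the bound by
  -- e^{|Im w|} alone would give only O(n⁻¹), which is not summable.
  have hbound : ∀ (n : ℕ) (t : ℝ), 0 < t →
      ‖F n t‖ ≤ 8 * ‖z‖ * (t * Real.exp (-((2 * n + 1 - 2 * y) * t))) := by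
    intro n t ht
    have h1 := norm_sin_le_mul_exp (2 * (t : ℂ) * z)
    rw [norm_two_mul_ofReal ht] at h1
    have h2 := abs_im_two_mul_le ht (le_refl |z.im|)
    have h3 : ‖Complex.exp (-(((2 * n + 1 : ℝ) : ℂ) * t))‖ = Real.exp (-((2 * n + 1) * t)) := by
      rw [Complex.norm_exp]; congr 1; simp
    simp only [F, norm_mul, h3]
    rw [show ‖(4 : ℂ)‖ = 4 by simp]
    calc _ ≤ 4 * (2 * t * ‖z‖ * Real.exp (2 * t * y) * Real.exp (-((2 * n + 1) * t))) := by
          gcongr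
          refine h1.trans ?_
          gcongr
      _ = 8 * ‖z‖ * (t * (Real.exp (2 * t * y) * Real.exp (-((2 * n + 1) * t)))) := by ring
      _ = _ := by rw [← Real.exp_add]; ring_nf
  have hFint : ∀ n, Integrable (F n) (volume.restrict (Ioi 0)) := by
    intro n
    refine Integrable.mono' ((integral_mul_exp (hδ n)).1.const_mul (8 * ‖z‖)) ?_ ?_
    · exact (by fun_prop : Continuous (F n)).aestronglyMeasurable
    · exact (ae_restrict_mem measurableSet_Ioi).mono fun t ht => hbound n t ht
  have hsum : Summable fun n => ∫ t in Ioi (0 : ℝ), ‖F n t‖ := by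
    have hb : ∀ n : ℕ, ∫ t in Ioi (0 : ℝ), ‖F n t‖ ≤
        8 * ‖z‖ / (1 - 2 * y) ^ 2 * (1 / ((n : ℝ) + 1) ^ 2) := by
      intro n
      calc _ ≤ ∫ t in Ioi (0 : ℝ), 8 * ‖z‖ * (t * Real.exp (-((2 * n + 1 - 2 * y) * t))) := by
            refine setIntegral_mono_on (hFint n).norm
              ((integral_mul_exp (hδ n)).1.const_mul _) measurableSet_Ioi
              fun t ht => hbound n t ht
        _ = 8 * ‖z‖ * (1 / (2 * n + 1 - 2 * y) ^ 2) := by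
            rw [integral_const_mul, (integral_mul_exp (hδ n)).2]
        _ ≤ 8 * ‖z‖ * (1 / ((1 - 2 * y) * (n + 1)) ^ 2) := by
            have hn : (0 : ℝ) ≤ n := n.cast_nonneg
            have h1 : 0 < 1 - 2 * y := by linarith
            gcongr
            nlinarith
        _ = _ := by
            rw [mul_pow]; field_simp
    refine Summable.of_nonneg_of_le (fun n => integral_nonneg fun t => norm_nonneg _) hb ?_
    apply Summable.mul_left
    exact_mod_cast (summable_nat_add_iff (f := fun n : ℕ => 1 / (n : ℝ) ^ 2) 1).2
      (Real.summable_one_div_nat_pow.2 one_lt_two)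
  have h := hasSum_integral_of_summable_integral_norm hFint hsum
  have hval : ∀ n : ℕ, ∫ t in Ioi (0 : ℝ), F n t = 8 * z / ((2 * n + 1) ^ 2 + 4 * z ^ 2) := by
    intro n
    have : 2 * |z.im| < (2 * n + 1 : ℝ) := by have := hδ n; linarith
    simp only [F]
    rw [integral_const_mul, integral_sin_mul_exp this]
    push_cast; ring
  simp_rw [hval] at h
  rw [← tendsto_nhds_unique h.tendsto_sum_nat (tendsto_tanh_series hz)]
  refine setIntegral_congr_fun measurableSet_Ioi fun t ht => ?_
  have h2 := ((hasSum_exp_odd (mem_Ioi.1 ht)).mul_left (4 * Complex.sin (2 * (t : ℂ) * z))).tsum_eq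
  simp only [F]
  simp only [mul_assoc] at h2 ⊢
  rw [h2]
  push_cast
  have : Complex.sinh t ≠ 0 := by
    rw [← Complex.ofReal_sinh]; exact_mod_cast (Real.sinh_pos_iff.2 (mem_Ioi.1 ht)).ne'
  field_simp
  ring

lemma eq_of_hasDerivAt_zero {𝕜 : Type*} [RCLike 𝕜] {s : Set 𝕜} (hs : Convex ℝ s) {f : 𝕜 → ℂ}
    [NormedSpace 𝕜 ℂ] (hf : ∀ z ∈ s, HasDerivAt f 0 z) {x y : 𝕜} (hx : x ∈ s) (hy : y ∈ s) :
    f x = f y := by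
  have h := hs.norm_image_sub_le_of_norm_hasDerivWithin_le (f := f) (f' := fun _ => 0) (C := 0)
    (fun z hz => (hf z hz).hasDerivWithinAt) (by simp) hy hx
  rw [zero_mul] at h
  exact sub_eq_zero.1 (norm_le_zero_iff.1 h)

lemma convex_strip (a : ℝ) : Convex ℝ {z : ℂ | 2 * |z.im| < a} := by
  have : {z : ℂ | 2 * |z.im| < a} = Complex.imLm ⁻¹' (Ioo (-(a / 2)) (a / 2)) := by
    ext u
    simp only [mem_ofPred_eq, mem_preimage, Complex.imLm_coe, mem_Ioo, ← abs_lt]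
    constructor <;> intro h <;> linarith
  rw [this]
  exact (convex_Ioo _ _).is_linear_preimage Complex.imLm.isLinear

/-! ### The logarithm of `2 cosh (π z)` -/

lemma re_cosh (w : ℂ) : (Complex.cosh w).re = Real.cosh w.re * Real.cos w.im := by
  conv_lhs => rw [← Complex.re_add_im w, Complex.cosh_add, Complex.cosh_mul_I, Complex.sinh_mul_I]
  simp [← Complex.ofReal_cosh, ← Complex.ofReal_sinh, ← Complex.ofReal_cos, ← Complex.ofReal_sin]

lemma re_two_cosh_pos {w : ℂ} (hw : |w.im| < Real.pi / 2) : 0 < (2 * Complex.cosh w).re := by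
  have h : 0 < Real.cos w.im := Real.cos_pos_of_mem_Ioo (abs_lt.1 hw)
  have : (2 * Complex.cosh w).re = 2 * (Real.cosh w.re * Real.cos w.im) := by
    rw [← re_cosh]; simp
  rw [this]
  have := Real.cosh_pos w.re
  positivity

/-- The principal logarithm of `2 cosh (π z)`. -/
noncomputable def logCosh (z : ℂ) : ℂ := Complex.log (2 * Complex.cosh (Real.pi * z))

lemma abs_im_pi_mul {z : ℂ} (hz : 2 * |z.im| < 1) : |((Real.pi : ℂ) * z).im| < Real.pi / 2 := by
  have : ((Real.pi : ℂ) * z).im = Real.pi * z.im := by simp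
  rw [this, abs_mul, abs_of_pos Real.pi_pos]
  nlinarith [Real.pi_pos]

lemma two_cosh_mem_slitPlane {z : ℂ} (hz : 2 * |z.im| < 1) :
    2 * Complex.cosh (Real.pi * z) ∈ Complex.slitPlane :=
  Complex.mem_slitPlane_iff.2 (Or.inl (re_two_cosh_pos (abs_im_pi_mul hz)))

lemma hasDerivAt_logCosh {z : ℂ} (hz : 2 * |z.im| < 1) :
    HasDerivAt logCosh
      (Real.pi * (Complex.sinh (Real.pi * z) / Complex.cosh (Real.pi * z))) z := by
  have h1 : HasDerivAt (fun z : ℂ => (Real.pi : ℂ) * z) (Real.pi : ℂ) z := by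
    simpa using (hasDerivAt_id z).const_mul (Real.pi : ℂ)
  have hs := two_cosh_mem_slitPlane hz
  have h2 := ((h1.ccosh).const_mul 2).clog hs
  refine h2.congr_deriv ?_
  have h3 : Complex.cosh (Real.pi * z) ≠ 0 := by
    intro h; rw [h, mul_zero] at hs; exact Complex.slitPlane_ne_zero hs rfl
  field_simp

lemma exp_logCosh {z : ℂ} (hz : 2 * |z.im| < 1) :
    Complex.exp (logCosh z) = 2 * Complex.cosh (Real.pi * z) :=
  Complex.exp_log (Complex.slitPlane_ne_zero (two_cosh_mem_slitPlane hz))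

/-- At z = i/4 the cosine is cosh(t/2), and sinh t = 2 sinh(t/2) cosh(t/2) turns the kernel into a
rescaling of itself. This fixes the integration constant in `Psi_kerOne_one`. -/
lemma Psi_kerOne_quarter :
    2 * Psi (kerOne 1) (Complex.I / 4) = Psi (kerOne 1) 0 := by
  have hint := integral_comp_mul_left_Ioi (fun t => psi (kerOne 1) 0 t) 0
    (show (0 : ℝ) < 1 / 2 by norm_num)
  rw [mul_zero] at hint
  have e : Psi (kerOne 1) 0 = (1 / 2 : ℝ) • ∫ t in Ioi (0 : ℝ), psi (kerOne 1) 0 (1 / 2 * t) := by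
    rw [hint, smul_smul]; norm_num [Psi]
  rw [e, Psi, ← integral_const_mul, ← integral_smul]
  refine setIntegral_congr_fun measurableSet_Ioi fun t ht => ?_
  have ht0 : (0 : ℝ) < t := ht
  have e1 : 2 * (t : ℂ) * (Complex.I / 4) = ((t / 2 : ℝ) : ℂ) * Complex.I := by push_cast; ring
  have hs : (Real.sinh (t / 2)) ≠ 0 := (Real.sinh_pos_iff.2 (by positivity)).ne'
  have hc : (Real.cosh (t / 2)) ≠ 0 := (Real.cosh_pos _).ne'
  have e2 : Real.sinh t = 2 * Real.sinh (t / 2) * Real.cosh (t / 2) := by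
    rw [← Real.sinh_two_mul]; ring_nf
  have e3 : 1 / 2 * t = t / 2 := by ring
  simp only [psi, e1, Complex.cos_mul_I, kerOne, one_mul, mul_zero, Complex.cos_zero, e2,
    Complex.real_smul, ← Complex.ofReal_cosh, e3]
  norm_cast
  field_simp

/-- `∫₀^∞ (cos (2 t z) / sinh t - 1 / t) dt / t = -log (2 cosh (π z))`. -/
lemma Psi_kerOne_one {z : ℂ} (hz : 2 * |z.im| < 1) : Psi (kerOne 1) z = -logCosh z := by
  have hk := isKernel_kerOne one_pos
  have hd : ∀ w ∈ {w : ℂ | 2 * |w.im| < 1},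
      HasDerivAt (fun w => Psi (kerOne 1) w + logCosh w) 0 w := by
    intro w hw
    refine ((hk.hasDerivAt_Psi hw).add (hasDerivAt_logCosh hw)).congr_deriv ?_
    rw [← integral_sin_div_sinh hw, ← eq_neg_iff_add_eq_zero, ← integral_neg]
    refine setIntegral_congr_fun measurableSet_Ioi fun t ht => ?_
    have ht0 : (t : ℂ) ≠ 0 := by exact_mod_cast (mem_Ioi.1 ht).ne'
    simp only [dpsi, kerOne, one_mul]
    push_cast
    field_simp
  have h0 : (0 : ℂ) ∈ {w : ℂ | 2 * |w.im| < 1} := by simp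
  have h4 : (Complex.I / 4 : ℂ) ∈ {w : ℂ | 2 * |w.im| < 1} := by
    simp only [mem_ofPred_eq]; norm_num [abs_of_pos]
  -- Psi + logCosh is a constant c. As logCosh(i/4) is half of logCosh(0), the relation 2 Psi(i/4) =
  -- Psi(0) reads 2c = c.
  have e1 := eq_of_hasDerivAt_zero (convex_strip 1) hd h4 h0
  have e2 := eq_of_hasDerivAt_zero (convex_strip 1) hd hz h0
  have hq := Psi_kerOne_quarter
  have l0 : logCosh 0 = (Real.log 2 : ℝ) := by
    simp [logCosh]
  have l4 : logCosh (Complex.I / 4) = ((1 / 2 * Real.log 2 : ℝ) : ℂ) := by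
    have : (Real.pi : ℂ) * (Complex.I / 4) = ((Real.pi / 4 : ℝ) : ℂ) * Complex.I := by
      push_cast; ring
    rw [logCosh, this, Complex.cosh_mul_I, ← Complex.ofReal_cos, Real.cos_pi_div_four]
    have : (2 : ℂ) * ((Real.sqrt 2 / 2 : ℝ) : ℂ) = ((Real.sqrt 2 : ℝ) : ℂ) := by push_cast; ring
    rw [this, ← Complex.ofReal_log (Real.sqrt_nonneg 2), Real.log_sqrt (by norm_num)]
    push_cast; ring
  simp only [l0, l4] at e1 e2
  push_cast at e1 e2
  linear_combination e2 + hq - 2 * e1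

lemma Psi_kerOne {q : ℝ} (hq : 0 < q) {z : ℂ} (hz : 2 * |z.im| < q) :
    Psi (kerOne q) z = -(q * logCosh (z / q)) := by
  have h1 : 2 * |(z / q).im| < 1 := by
    rw [Complex.div_ofReal_im, abs_div, abs_of_pos hq, ← mul_div_assoc, div_lt_one hq]; exact hz
  have hint := integral_comp_mul_left_Ioi (fun t => psi (kerOne 1) (z / q) t) 0 hq
  rw [mul_zero] at hint
  have e : Psi (kerOne q) z = ((q ^ 2 : ℝ) : ℂ) *
      ∫ t in Ioi (0 : ℝ), psi (kerOne 1) (z / q) (q * t) := by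
    rw [Psi, ← integral_const_mul]
    refine setIntegral_congr_fun measurableSet_Ioi fun t ht => ?_
    have hq' : (q : ℂ) ≠ 0 := by exact_mod_cast hq.ne'
    have ht' : (t : ℂ) ≠ 0 := by exact_mod_cast (mem_Ioi.1 ht).ne'
    have e1 : 2 * ((q * t : ℝ) : ℂ) * (z / q) = 2 * (t : ℂ) * z := by
      push_cast; field_simp
    simp only [psi, kerOne, e1, one_mul]
    push_cast
    field_simp
  rw [e, hint, ← Psi, Psi_kerOne_one h1, Complex.real_smul]
  have hq' : (q : ℂ) ≠ 0 := by exact_mod_cast hq.ne'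
  push_cast
  field_simp

/-! ### The hyperbolic gamma function -/

/-- The kernel `1 / (sinh (b⁻¹ t) sinh (b t))` of `s_b`. -/
noncomputable def kerS (b t : ℝ) : ℝ := 1 / (Real.sinh (b⁻¹ * t) * Real.sinh (b * t))

lemma Q_pos {b : ℝ} (hb : 0 < b) : 0 < Q b := by unfold Q; positivity

lemma kerS_sub_le {b t : ℝ} (hb : 0 < b) (ht : 0 < t) :
    |kerS b t - 1 / t ^ 2| ≤ b⁻¹ * b⁻¹ + b * b := by
  obtain ⟨h1, h2⟩ := inv_sinh_bounds (mul_pos (inv_pos.2 hb) ht)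
  obtain ⟨h3, h4⟩ := inv_sinh_bounds (mul_pos hb ht)
  have s1 := Real.sinh_pos_iff.2 (mul_pos (inv_pos.2 hb) ht)
  have s2 := Real.sinh_pos_iff.2 (mul_pos hb ht)
  have e : kerS b t - 1 / t ^ 2 =
      -((1 / (b⁻¹ * t) - 1 / Real.sinh (b⁻¹ * t)) * (1 / Real.sinh (b * t)) +
        1 / (b⁻¹ * t) * (1 / (b * t) - 1 / Real.sinh (b * t))) := by
    unfold kerS
    have : 1 / t ^ 2 = 1 / (b⁻¹ * t) * (1 / (b * t)) := by field_simp
    rw [this]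
    field_simp
    ring
  have p1 : 0 ≤ 1 / (b⁻¹ * t) - 1 / Real.sinh (b⁻¹ * t) := by linarith
  have p2 : 0 ≤ 1 / (b * t) - 1 / Real.sinh (b * t) := by linarith
  rw [e, abs_neg, abs_of_nonneg (by positivity)]
  refine add_le_add ?_ ?_
  · calc _ ≤ (b⁻¹ * t) * (1 / (b * t)) := by gcongr
      _ = _ := by field_simp
  · calc _ ≤ 1 / (b⁻¹ * t) * (b * t) := by gcongr
      _ = _ := by field_simp

lemma isKernel_kerS {b : ℝ} (hb : 0 < b) : IsKernel (kerS b) (Q b) where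
  cont := by
    unfold kerS
    refine continuousOn_const.div (by fun_prop) fun t ht => ?_
    have h1 := Real.sinh_pos_iff.2 (mul_pos (inv_pos.2 hb) (mem_Ioi.1 ht))
    have h2 := Real.sinh_pos_iff.2 (mul_pos hb (mem_Ioi.1 ht))
    positivity
  near := ⟨_, fun t h0 _ => kerS_sub_le hb h0⟩
  far := by
    refine ⟨2 / (1 - Real.exp (-2 * b⁻¹)) * (2 / (1 - Real.exp (-2 * b))), fun t ht => ?_⟩
    have h0 : 0 < t := one_pos.trans ht
    have hb' : 0 < b⁻¹ := inv_pos.2 hb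
    have h1 := inv_sinh_le_exp hb' (show b⁻¹ ≤ b⁻¹ * t by nlinarith)
    have h2 := inv_sinh_le_exp hb (show b ≤ b * t by nlinarith)
    have s1 := Real.sinh_pos_iff.2 (mul_pos hb' h0)
    have s2 := Real.sinh_pos_iff.2 (mul_pos hb h0)
    have e : kerS b t = 1 / Real.sinh (b⁻¹ * t) * (1 / Real.sinh (b * t)) := by
      unfold kerS; field_simp
    rw [e, abs_of_pos (by positivity)]
    calc _ ≤ _ := mul_le_mul h1 h2 (by positivity) ((by positivity : (0 : ℝ) ≤ _).trans h1)
      _ = 2 / (1 - Real.exp (-2 * b⁻¹)) * (2 / (1 - Real.exp (-2 * b))) *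
          (Real.exp (-(b⁻¹ * t)) * Real.exp (-(b * t))) := by ring
      _ = _ := by rw [← Real.exp_add, Q]; ring_nf

lemma sb_eq (b : ℝ) (z : ℂ) : sb b z = Complex.exp (Complex.I * Lam (kerS b) z) := by
  rw [sb, Lam]
  congr 3
  ext t
  simp only [lam, kerS]
  push_cast
  congr 2
  ring

lemma sb_ne_zero (b : ℝ) (z : ℂ) : sb b z ≠ 0 := Complex.exp_ne_zero _

lemma sb_neg (b : ℝ) (z : ℂ) : sb b (-z) = (sb b z)⁻¹ := by
  rw [sb_eq, sb_eq, Lam_neg, mul_neg, Complex.exp_neg]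

/-- The kernel is symmetric under b ↔ b⁻¹; this symmetry later normalizes the pole of s_b. -/
lemma sb_inv (b : ℝ) (z : ℂ) : sb b⁻¹ z = sb b z := by
  have : kerS b⁻¹ = kerS b := by ext t; simp only [kerS, inv_inv]; ring
  rw [sb_eq, sb_eq, this]

lemma Q_inv (b : ℝ) : Q b⁻¹ = Q b := by simp [Q, add_comm]

lemma hasDerivAt_sb {b : ℝ} (hb : 0 < b) {z : ℂ} (hz : 2 * |z.im| < Q b) :
    HasDerivAt (sb b) (sb b z * (Complex.I * Psi (kerS b) z)) z := by
  have h := (((isKernel_kerS hb).hasDerivAt_Lam hz).const_mul Complex.I).cexp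
  rw [← sb_eq] at h
  exact h.congr_of_eventuallyEq (Eventually.of_forall fun w => sb_eq b w)

/-- The first-order difference equation of `s_b`. -/
lemma sb_add {b : ℝ} (hb : 0 < b) {z : ℂ} (hz : 2 * |(b * z : ℂ).im| < 1) :
    sb b (z + Complex.I * b / 2) =
      2 * Complex.cosh (Real.pi * (b * z)) * sb b (z - Complex.I * b / 2) := by
  have hz' : |z.im| < b⁻¹ / 2 := by
    have : (b * z : ℂ).im = b * z.im := by simp
    rw [this, abs_mul, abs_of_pos hb] at hz
    rw [lt_div_iff₀ two_pos, ← one_div, lt_div_iff₀ hb]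
    linarith
  have hp : 2 * |(z + Complex.I * b / 2).im| < Q b := by
    have : (z + Complex.I * b / 2).im = z.im + b / 2 := by simp
    rw [this]
    have := abs_add_le z.im (b / 2)
    rw [abs_of_pos (by positivity : 0 < b / 2)] at this
    unfold Q; linarith
  have hm : 2 * |(z - Complex.I * b / 2).im| < Q b := by
    have : (z - Complex.I * b / 2).im = z.im - b / 2 := by simp
    rw [this]
    have := abs_sub z.im (b / 2)
    rw [abs_of_pos (by positivity : 0 < b / 2)] at this
    unfold Q; linarith
  have hk := isKernel_kerS hb
  -- The two sines differ by 2i cos(2tz) sinh(bt), so sinh(bt) cancels from the kernel and only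
  -- sinh(t/b) survives, a rescaled `kerOne 1`.
  have key : Lam (kerS b) (z + Complex.I * b / 2) - Lam (kerS b) (z - Complex.I * b / 2) =
      Complex.I * Psi (kerOne 1) (b * z) := by
    rw [Lam, Lam, ← integral_sub (hk.integrableOn_lam hp) (hk.integrableOn_lam hm)]
    have hint := integral_comp_mul_left_Ioi (fun t => psi (kerOne 1) (b * z) t) 0 (inv_pos.2 hb)
    rw [mul_zero, inv_inv] at hint
    have e : Psi (kerOne 1) (b * z) = ((b⁻¹ : ℝ) : ℂ) *
        ∫ t in Ioi (0 : ℝ), psi (kerOne 1) (b * z) (b⁻¹ * t) := by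
      rw [hint, Psi, Complex.real_smul, ← mul_assoc, ← Complex.ofReal_mul, inv_mul_cancel₀ hb.ne']
      simp
    rw [e, ← mul_assoc, ← integral_const_mul]
    refine setIntegral_congr_fun measurableSet_Ioi fun t ht => ?_
    have ht0 : (0 : ℝ) < t := ht
    have hb' : (b : ℂ) ≠ 0 := by exact_mod_cast hb.ne'
    have ht' : (t : ℂ) ≠ 0 := by exact_mod_cast ht0.ne'
    have s1 : Complex.sinh ((b : ℂ)⁻¹ * t) ≠ 0 := by
      have := (Real.sinh_pos_iff.2 (mul_pos (inv_pos.2 hb) ht0)).ne'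
      exact_mod_cast this
    have s2 : Complex.sinh ((b : ℂ) * t) ≠ 0 := by
      have := (Real.sinh_pos_iff.2 (mul_pos hb ht0)).ne'
      exact_mod_cast this
    have e1 : 2 * (t : ℂ) * (z + Complex.I * b / 2) = 2 * t * z + (b * t) * Complex.I := by ring
    have e2 : 2 * (t : ℂ) * (z - Complex.I * b / 2) = 2 * t * z - (b * t) * Complex.I := by ring
    have e3 : 2 * (((b⁻¹ * t : ℝ) : ℝ) : ℂ) * (b * z) = 2 * t * z := by
      push_cast; field_simp
    simp only [lam, psi, kerS, kerOne, one_mul, e1, e2, e3, Complex.sin_add, Complex.sin_sub,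
      Complex.cos_mul_I, Complex.sin_mul_I]
    push_cast
    generalize Complex.sinh ((b : ℂ)⁻¹ * t) = S1 at s1 ⊢
    generalize Complex.sinh ((b : ℂ) * t) = S2 at s2 ⊢
    field_simp
    ring
  have h2 : Complex.I * Lam (kerS b) (z + Complex.I * b / 2) =
      logCosh (b * z) + Complex.I * Lam (kerS b) (z - Complex.I * b / 2) := by
    rw [Psi_kerOne_one hz] at key
    linear_combination Complex.I * key - logCosh (b * z) * Complex.I_sq
  rw [sb_eq, sb_eq, h2, Complex.exp_add, exp_logCosh hz]

/-- `Lam` is odd and commutes with conjugation, hence is purely imaginary on the imaginary axis. -/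
lemma sb_pos_of_imaginary (b y : ℝ) : ∃ r : ℝ, 0 < r ∧ sb b (y * Complex.I) = r := by
  have h := Lam_conj (kerS b) (y * Complex.I)
  have e : (starRingEnd ℂ) (y * Complex.I) = -(y * Complex.I) := by simp
  rw [e, Lam_neg] at h
  have hre : (Lam (kerS b) (y * Complex.I)).re = 0 := by
    have := congrArg Complex.re h
    simp at this
    linarith
  refine ⟨Real.exp (-(Lam (kerS b) (y * Complex.I)).im), Real.exp_pos _, ?_⟩
  rw [sb_eq, Complex.ofReal_exp]
  congr 1
  apply Complex.ext <;> simp [hre]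

/-! ### Behaviour of `s_b` at infinity -/

/-- The double poles at the origin cancel in the difference, which is therefore bounded there and
keeps the common decay rate. -/
lemma IsKernel.exists_sub_le {k₁ k₂ : ℝ → ℝ} {a : ℝ} (h₁ : IsKernel k₁ a) (h₂ : IsKernel k₂ a)
    (ha : 0 < a) : ∃ D, 0 ≤ D ∧ ∀ t, 0 < t → |k₁ t - k₂ t| ≤ D * Real.exp (-(a * t)) := by
  obtain ⟨C₁, hC₁⟩ := h₁.near
  obtain ⟨C₂, hC₂⟩ := h₂.near
  obtain ⟨E₁, hE₁⟩ := h₁.far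
  obtain ⟨E₂, hE₂⟩ := h₂.far
  have hC : 0 ≤ C₁ + C₂ := add_nonneg ((abs_nonneg _).trans (hC₁ 1 one_pos le_rfl))
    ((abs_nonneg _).trans (hC₂ 1 one_pos le_rfl))
  refine ⟨max ((C₁ + C₂) * Real.exp a) (E₁ + E₂), le_max_of_le_left (by positivity),
    fun t ht => ?_⟩
  by_cases h1 : t ≤ 1
  · have e : k₁ t - k₂ t = (k₁ t - 1 / t ^ 2) - (k₂ t - 1 / t ^ 2) := by ring
    have h3 := abs_sub (k₁ t - 1 / t ^ 2) (k₂ t - 1 / t ^ 2)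
    rw [← e] at h3
    have h4 : 1 ≤ Real.exp a * Real.exp (-(a * t)) := by
      rw [← Real.exp_add]; apply Real.one_le_exp; nlinarith
    calc |k₁ t - k₂ t| ≤ C₁ + C₂ := by linarith [hC₁ t ht h1, hC₂ t ht h1]
      _ ≤ (C₁ + C₂) * (Real.exp a * Real.exp (-(a * t))) := le_mul_of_one_le_right hC h4
      _ = (C₁ + C₂) * Real.exp a * Real.exp (-(a * t)) := by ring
      _ ≤ _ := by gcongr; exact le_max_left _ _
  · push Not at h1
    calc |k₁ t - k₂ t| ≤ |k₁ t| + |k₂ t| := abs_sub _ _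
      _ ≤ (E₁ + E₂) * Real.exp (-(a * t)) := by linarith [hE₁ t h1, hE₂ t h1]
      _ ≤ _ := by gcongr; exact le_max_right _ _

/-- The cosine transform of a function on `(0, ∞)`. -/
noncomputable def cosTransform (φ : ℝ → ℝ) (z : ℂ) : ℂ :=
  ∫ t in Ioi (0 : ℝ), Complex.cos (2 * (t : ℂ) * z) * (φ t : ℂ)

lemma norm_cosTransform_le {φ : ℝ → ℝ} {a D η : ℝ}
    (hφ : ∀ t, 0 < t → |φ t| ≤ D * Real.exp (-(a * t))) (hη : 2 * η < a) {z : ℂ}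
    (hz : |z.im| ≤ η) : ‖cosTransform φ z‖ ≤ D * (1 / (a - 2 * η)) := by
  have h := norm_integral_le_of_norm_le (μ := volume.restrict (Ioi (0 : ℝ)))
    (f := fun t : ℝ => Complex.cos (2 * (t : ℂ) * z) * (φ t : ℂ))
    (g := fun t => D * Real.exp (-((a - 2 * η) * t)))
    ((integrableOn_exp_neg (by linarith) 0).const_mul D) ?_
  · refine h.trans_eq ?_
    rw [integral_const_mul]
    have := integral_exp_mul_Ioi (a := -(a - 2 * η)) (by linarith) 0
    simp only [neg_mul] at this
    rw [this, mul_zero, neg_zero, Real.exp_zero, neg_div_neg_eq]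
  · refine (ae_restrict_mem measurableSet_Ioi).mono fun t ht => ?_
    have ht0 : (0 : ℝ) < t := ht
    rw [norm_mul, Complex.norm_real, Real.norm_eq_abs]
    calc _ ≤ Real.exp (2 * t * η) * (D * Real.exp (-(a * t))) := by
          gcongr
          · exact (norm_cos_le_exp _).trans (Real.exp_le_exp.2 (abs_im_two_mul_le ht0 hz))
          · exact hφ t ht0
      _ = D * Real.exp (-((a - 2 * η) * t)) := by
          rw [mul_left_comm, ← Real.exp_add]; ring_nf

/-- Riemann–Lebesgue for each of the two exponentials of the cosine; the complex shift w is absorbed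
into the integrable function e^{±2itw} φ(t). -/
lemma tendsto_cosTransform {φ : ℝ → ℝ} {a D : ℝ} (hcont : ContinuousOn φ (Ioi 0))
    (hφ : ∀ t, 0 < t → |φ t| ≤ D * Real.exp (-(a * t))) {w : ℂ}
    (hw : 2 * |w.im| < a) :
    Tendsto (fun x : ℝ => cosTransform φ (x + w)) atTop (𝓝 0) := by
  have hexp : ∀ σ : ℝ, |σ| ≤ 1 → IntegrableOn (fun t : ℝ =>
      Complex.exp (σ * 2 * t * w * Complex.I) * (φ t : ℂ)) (Ioi 0) := by
    intro σ hσ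
    refine Integrable.mono' ((integrableOn_exp_neg (δ := a - 2 * |w.im|) (by linarith) 0).const_mul D)
      ?_ ?_
    · apply ContinuousOn.aestronglyMeasurable _ measurableSet_Ioi
      exact (by fun_prop : Continuous fun t : ℝ =>
        Complex.exp (σ * 2 * t * w * Complex.I)).continuousOn.mul
        (Complex.continuous_ofReal.comp_continuousOn hcont)
    · refine (ae_restrict_mem measurableSet_Ioi).mono fun t ht => ?_
      have ht0 : (0 : ℝ) < t := ht
      rw [norm_mul, Complex.norm_real, Real.norm_eq_abs, Complex.norm_exp]
      have h1 : (σ * 2 * t * w * Complex.I).re ≤ 2 * |w.im| * t := by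
        have : (σ * 2 * t * w * Complex.I).re = (-σ * w.im) * (2 * t) := by
          simp; ring
        rw [this]
        have h2 : -σ * w.im ≤ |w.im| := by
          calc -σ * w.im ≤ |-σ * w.im| := le_abs_self _
            _ = |σ| * |w.im| := by rw [abs_mul, abs_neg]
            _ ≤ 1 * |w.im| := by gcongr
            _ = _ := one_mul _
        nlinarith
      calc _ ≤ Real.exp (2 * |w.im| * t) * (D * Real.exp (-(a * t))) := by
            gcongr; exact hφ t ht0
        _ = D * Real.exp (-((a - 2 * |w.im|) * t)) := by
            rw [mul_left_comm, ← Real.exp_add]; ring_nf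
  have hosc : ∀ (σ : ℝ) (x : ℝ), |σ| ≤ 1 → IntegrableOn (fun t : ℝ =>
      Complex.exp (σ * 2 * t * x * Complex.I) *
        (Complex.exp (σ * 2 * t * w * Complex.I) * (φ t : ℂ))) (Ioi 0) := by
    intro σ x hσ
    refine (hexp σ hσ).bdd_mul (c := 1) ?_ ?_
    · exact (by fun_prop : Continuous fun t : ℝ =>
        Complex.exp (σ * 2 * t * x * Complex.I)).aestronglyMeasurable
    · refine Eventually.of_forall fun t => ?_
      rw [Complex.norm_exp]; simp
  have hRL : ∀ σ : ℝ, |σ| = 1 → Tendsto (fun x : ℝ => ∫ t in Ioi (0 : ℝ),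
      Complex.exp (σ * 2 * t * x * Complex.I) *
        (Complex.exp (σ * 2 * t * w * Complex.I) * (φ t : ℂ))) atTop (𝓝 0) := by
    intro σ hσ
    have h := Real.tendsto_integral_exp_smul_cocompact
      ((Ioi (0 : ℝ)).indicator fun t : ℝ => Complex.exp (σ * 2 * t * w * Complex.I) * (φ t : ℂ))
    have hcc : Tendsto (fun x : ℝ => -σ * x / Real.pi) atTop (cocompact ℝ) := by
      rw [← Metric.cobounded_eq_cocompact, ← tendsto_norm_atTop_iff_cobounded]
      have : (fun x : ℝ => ‖-σ * x / Real.pi‖) = fun x : ℝ => |x| / Real.pi := by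
        ext x
        rw [Real.norm_eq_abs, abs_div, abs_mul, abs_neg, hσ, one_mul, abs_of_pos Real.pi_pos]
      rw [this]
      exact tendsto_abs_atTop_atTop.atTop_div_const Real.pi_pos
    refine (h.comp hcc).congr fun x => ?_
    simp only [Function.comp]
    rw [← integral_indicator measurableSet_Ioi]
    congr 1; ext t
    by_cases ht : t ∈ Ioi (0 : ℝ)
    · rw [indicator_of_mem ht, indicator_of_mem ht, Real.fourierChar_apply', Circle.smul_def]
      simp only [smul_eq_mul, Circle.coe_exp]
      congr 2
      have : (Real.pi : ℂ) ≠ 0 := by exact_mod_cast Real.pi_ne_zero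
      push_cast; field_simp
    · rw [indicator_of_notMem ht, indicator_of_notMem ht, smul_zero]
  have h1 := hRL 1 (by simp)
  have h2 := hRL (-1) (by simp)
  have h3 := (h1.add h2).div_const 2
  rw [add_zero, zero_div] at h3
  refine h3.congr fun x => ?_
  rw [← integral_add (hosc 1 x (by simp)) (hosc (-1) x (by simp)), ← integral_div, cosTransform]
  congr 1; ext t
  rw [← mul_assoc, ← mul_assoc, ← Complex.exp_add, ← Complex.exp_add, Complex.cos]
  push_cast; ring_nf

lemma norm_two_cosh_bounds (w : ℂ) :
    Real.exp |w.re| * Real.cos w.im ≤ ‖2 * Complex.cosh w‖ ∧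
      ‖2 * Complex.cosh w‖ ≤ 2 * Real.exp |w.re| := by
  constructor
  · by_cases hc : 0 ≤ Real.cos w.im
    · have h1 : (2 * Complex.cosh w).re = 2 * (Real.cosh w.re * Real.cos w.im) := by
        rw [← re_cosh]; simp
      have h2 := Complex.re_le_norm (2 * Complex.cosh w)
      rw [h1] at h2
      refine le_trans ?_ h2
      have h3 : Real.exp |w.re| ≤ 2 * Real.cosh w.re := by
        rw [← Real.cosh_abs, Real.cosh_eq]
        linarith [Real.exp_pos (-|w.re|)]
      nlinarith
    · push Not at hc
      exact (mul_nonpos_of_nonneg_of_nonpos (Real.exp_pos _).le hc.le).trans (norm_nonneg _)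
  · have e : 2 * Complex.cosh w = Complex.exp w + Complex.exp (-w) := by rw [Complex.cosh]; ring
    rw [e]
    refine (norm_add_le _ _).trans ?_
    rw [Complex.norm_exp, Complex.norm_exp, two_mul]
    exact add_le_add (Real.exp_le_exp.2 (le_abs_self _))
      (Real.exp_le_exp.2 (by simpa using neg_le_abs w.re))

lemma cos_pi_mul_pos {η : ℝ} (h0 : 0 ≤ η) (hη : 2 * η < 1) : 0 < Real.cos (Real.pi * η) :=
  Real.cos_pos_of_mem_Ioo ⟨by nlinarith [Real.pi_pos], by nlinarith [Real.pi_pos]⟩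

lemma cos_le_cos_im {η : ℝ} (hη : 2 * η < 1) {z : ℂ} (hz : |z.im| ≤ η) :
    Real.cos (Real.pi * η) ≤ Real.cos (Real.pi * z.im) := by
  rw [← Real.cos_abs (Real.pi * z.im), abs_mul, abs_of_pos Real.pi_pos]
  apply Real.cos_le_cos_of_nonneg_of_le_pi
  · positivity
  · nlinarith [Real.pi_pos]
  · gcongr

lemma abs_re_logCosh_sub_le {η : ℝ} (h0 : 0 ≤ η) (hη : 2 * η < 1) {z : ℂ} (hz : |z.im| ≤ η) :
    |(logCosh z).re - Real.pi * (|z.re|)| ≤ |Real.log (Real.cos (Real.pi * η))| + Real.log 2 := by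
  obtain ⟨h1, h2⟩ := norm_two_cosh_bounds (Real.pi * z)
  have hc := cos_pi_mul_pos h0 hη
  have hre : |((Real.pi : ℂ) * z).re| = Real.pi * |z.re| := by
    rw [Complex.re_ofReal_mul, abs_mul, abs_of_pos Real.pi_pos]
  have him : ((Real.pi : ℂ) * z).im = Real.pi * z.im := by simp
  rw [hre, him] at h1
  rw [hre] at h2
  have h1' : Real.exp (Real.pi * |z.re|) * Real.cos (Real.pi * η) ≤
      ‖2 * Complex.cosh (Real.pi * z)‖ :=
    (mul_le_mul_of_nonneg_left (cos_le_cos_im hη hz) (Real.exp_pos _).le).trans h1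
  have hpos : 0 < ‖2 * Complex.cosh (Real.pi * z)‖ := lt_of_lt_of_le (by positivity) h1'
  have l1 := Real.log_le_log (by positivity) h1'
  have l2 := Real.log_le_log hpos h2
  rw [Real.log_mul (Real.exp_pos _).ne' hc.ne', Real.log_exp] at l1
  rw [Real.log_mul two_ne_zero (Real.exp_pos _).ne', Real.log_exp] at l2
  rw [logCosh, Complex.log_re, abs_le]
  have := Real.log_pos one_lt_two
  constructor <;> linarith [neg_abs_le (Real.log (Real.cos (Real.pi * η))),
    abs_nonneg (Real.log (Real.cos (Real.pi * η)))]

/-- 1 + e^{−2πz} = 2 cosh(πz) e^{−πz}. No branch jump occurs, since both factors have argument in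
(−π/2, π/2). -/
lemma logCosh_sub_eq {z : ℂ} (hz : 2 * |z.im| < 1) :
    logCosh z - Real.pi * z = Complex.log (1 + Complex.exp (-(2 * Real.pi * z))) := by
  have hs := two_cosh_mem_slitPlane hz
  have him := abs_im_pi_mul hz
  have h1 := Complex.abs_arg_lt_pi_div_two_iff.2 (Or.inl (re_two_cosh_pos him))
  have e : 1 + Complex.exp (-(2 * Real.pi * z)) =
      2 * Complex.cosh (Real.pi * z) * Complex.exp (-(Real.pi * z)) := by
    rw [Complex.cosh]
    have : Complex.exp (Real.pi * z) * Complex.exp (-(Real.pi * z)) = 1 := by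
      rw [← Complex.exp_add]; simp
    have h2 : Complex.exp (-(2 * Real.pi * z)) =
        Complex.exp (-(Real.pi * z)) * Complex.exp (-(Real.pi * z)) := by
      rw [← Complex.exp_add]; ring_nf
    rw [h2]
    linear_combination -this
  have him2 : (-(Real.pi * z : ℂ)).im = -((Real.pi : ℂ) * z).im := by simp
  obtain ⟨a1, a2⟩ := abs_lt.1 him
  obtain ⟨b1, b2⟩ := abs_lt.1 h1
  have hlog : Complex.log (Complex.exp (-(Real.pi * z))) = -(Real.pi * z) := by
    apply Complex.log_exp <;> rw [him2] <;> linarith [Real.pi_pos]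
  have harg : (Complex.exp (-(Real.pi * z))).arg = -((Real.pi : ℂ) * z).im := by
    rw [← Complex.log_im, hlog, him2]
  rw [e, Complex.log_mul (Complex.slitPlane_ne_zero hs) (Complex.exp_ne_zero _), hlog, logCosh]
  · ring
  · rw [harg]; constructor <;> linarith

lemma norm_logCosh_sub_le {η : ℝ} (h0 : 0 ≤ η) (hη : 2 * η < 1) {z : ℂ} (hz : |z.im| ≤ η)
    (hre : 0 ≤ z.re) : ‖logCosh z - Real.pi * z‖ ≤
      |Real.log (Real.cos (Real.pi * η))| + Real.log 2 + Real.pi := by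
  have h := abs_re_logCosh_sub_le h0 hη hz
  rw [abs_of_nonneg hre] at h
  refine (Complex.norm_le_abs_re_add_abs_im _).trans (add_le_add ?_ ?_)
  · simpa using h
  · rw [logCosh_sub_eq (by linarith), Complex.log_im]; exact Complex.abs_arg_le_pi _

lemma tendsto_logCosh_sub {w : ℂ} (hw : 2 * |w.im| < 1) :
    Tendsto (fun x : ℝ => logCosh (x + w) - Real.pi * (x + w)) atTop (𝓝 0) := by
  have h1 : Tendsto (fun x : ℝ => Complex.exp (-(2 * Real.pi * (x + w)))) atTop (𝓝 0) := by
    rw [tendsto_zero_iff_norm_tendsto_zero]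
    have : (fun x : ℝ => ‖Complex.exp (-(2 * Real.pi * (x + w)))‖) =
        fun x : ℝ => Real.exp (-(2 * Real.pi * (x + w.re))) := by
      ext x; rw [Complex.norm_exp]; simp
    rw [this]
    apply Real.tendsto_exp_neg_atTop_nhds_zero.comp
    exact (tendsto_atTop_add_const_right _ _ tendsto_id).const_mul_atTop (by positivity)
  have h2 : Tendsto (fun x : ℝ => Complex.log (1 + Complex.exp (-(2 * Real.pi * (x + w))))) atTop
      (𝓝 (Complex.log (1 + 0))) :=
    (h1.const_add 1).clog (by simp [Complex.one_mem_slitPlane])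
  rw [add_zero, Complex.log_one] at h2
  refine h2.congr fun x => ?_
  rw [logCosh_sub_eq (by simpa using hw)]

/-- The remainder of `Psi (kerS b)` after the explicit part. -/
noncomputable def remS (b : ℝ) (t : ℝ) : ℝ := kerS b t - kerOne (Q b) t

/-- Subtracting the model kernel with the same pole and decay rate puts the linear growth at
infinity into an explicit logarithm. What remains is the cosine transform of an exponentially
decaying function. -/
lemma Psi_kerS_eq {b : ℝ} (hb : 0 < b) {z : ℂ} (hz : 2 * |z.im| < Q b) :
    Psi (kerS b) z = -(Q b * logCosh (z / Q b)) + cosTransform (remS b) z := by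
  rw [← Psi_kerOne (Q_pos hb) hz, cosTransform, Psi, Psi, ← sub_eq_iff_eq_add',
    ← integral_sub ((isKernel_kerS hb).integrableOn_psi hz)
      ((isKernel_kerOne (Q_pos hb)).integrableOn_psi hz)]
  congr 1; ext t
  simp only [psi, remS]; push_cast; ring

lemma abs_div_Q_im {b : ℝ} (hb : 0 < b) (z : ℂ) : |(z / Q b).im| = |z.im| / Q b := by
  rw [Complex.div_ofReal_im, abs_div, abs_of_pos (Q_pos hb)]

lemma exists_abs_re_Psi_add_le {b : ℝ} (hb : 0 < b) {η : ℝ} (h0 : 0 ≤ η) (hη : 2 * η < Q b) :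
    ∃ C, ∀ z : ℂ, |z.im| ≤ η → |(Psi (kerS b) z).re + Real.pi * (|z.re|)| ≤ C := by
  have hQ := Q_pos hb
  obtain ⟨D, hD0, hD⟩ := (isKernel_kerS hb).exists_sub_le (isKernel_kerOne hQ) hQ
  have hη' : 2 * (η / Q b) < 1 := by rw [← mul_div_assoc, div_lt_one hQ]; exact hη
  refine ⟨Q b * (|Real.log (Real.cos (Real.pi * (η / Q b)))| + Real.log 2) +
    D * (1 / (Q b - 2 * η)), fun z hz => ?_⟩
  rw [Psi_kerS_eq hb (by linarith)]
  have h1 := abs_re_logCosh_sub_le (by positivity) hη' (z := z / Q b)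
    (by rw [abs_div_Q_im hb]; gcongr)
  have h2 := norm_cosTransform_le hD hη hz
  have h3 := (Complex.abs_re_le_norm _).trans h2
  have e : (-(Q b * logCosh (z / Q b)) + cosTransform (remS b) z).re + Real.pi * |z.re| =
      -(Q b * ((logCosh (z / Q b)).re - Real.pi * |(z / Q b).re|)) +
        (cosTransform (remS b) z).re := by
    rw [Complex.div_ofReal_re, abs_div, abs_of_pos hQ]
    simp
    field_simp
    ring
  rw [e]
  refine (abs_add_le _ _).trans (add_le_add ?_ h3)
  rw [abs_neg, abs_mul, abs_of_pos hQ]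
  gcongr

/-- `|s_b(z)|` is comparable to `exp (π Im z |Re z|)`, uniformly on closed substrips. -/
lemma exists_norm_sb_bounds {b : ℝ} (hb : 0 < b) {η : ℝ} (h0 : 0 ≤ η) (hη : 2 * η < Q b) :
    ∃ C, 0 < C ∧ ∀ z : ℂ, |z.im| ≤ η →
      ‖sb b z‖ ≤ C * Real.exp (Real.pi * z.im * |z.re|) ∧
      ‖sb b z‖⁻¹ ≤ C * Real.exp (-(Real.pi * z.im * |z.re|)) := by
  obtain ⟨C, hC⟩ := exists_abs_re_Psi_add_le hb h0 hη
  have hC0 : 0 ≤ C := (abs_nonneg _).trans (hC 0 (by simpa using h0))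
  have hk := isKernel_kerS hb
  -- log |s_b| = −Im Lam vanishes on the real line and has vertical derivative −Re Psi. Integrating
  -- the bound on Re Psi + π|Re z| from height 0 to Im z gives the estimate.
  have key : ∀ z : ℂ, |z.im| ≤ η →
      |-(Lam (kerS b) z).im - Real.pi * z.im * (|z.re|)| ≤ C * η := by
    intro z hz
    set x := z.re
    let g : ℝ → ℝ := fun y => -(Lam (kerS b) (x + y * Complex.I)).im - Real.pi * y * |x|
    have hg : ∀ y ∈ Icc (-η) η, HasDerivWithinAt g
        (-((Psi (kerS b) (x + y * Complex.I)).re + Real.pi * |x|)) (Icc (-η) η) y := by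
      intro y hy
      have hy' : 2 * |((x : ℂ) + y * Complex.I).im| < Q b := by
        have := abs_le.2 hy
        simp; linarith
      have h1 : HasDerivAt (fun y : ℝ => (x : ℂ) + y * Complex.I) Complex.I y := by
        simpa using ((Complex.ofRealCLM.hasDerivAt (x := y)).mul_const Complex.I).const_add (x : ℂ)
      have h2 := (hk.hasDerivAt_Lam hy').comp y h1
      have h3 := Complex.imCLM.hasFDerivAt.comp_hasDerivAt y h2
      have h4 : HasDerivAt (fun y : ℝ => Real.pi * y * |x|) (Real.pi * |x|) y := by
        simpa using ((hasDerivAt_id y).const_mul Real.pi).mul_const |x|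
      have h5 := (h3.neg.sub h4)
      refine (h5.congr_deriv ?_).hasDerivWithinAt
      simp; ring
    have h := (convex_Icc (-η) η).norm_image_sub_le_of_norm_hasDerivWithin_le hg (C := C)
      (fun y hy => by
        rw [norm_neg, Real.norm_eq_abs]
        have := hC (x + y * Complex.I) (by simpa using abs_le.2 hy)
        simpa using this) (x := 0) (y := z.im) ⟨by linarith, h0⟩ (abs_le.1 hz)
    have g0 : g 0 = 0 := by
      have hr := Lam_conj (kerS b) (x : ℂ)
      rw [Complex.conj_ofReal] at hr
      have : (Lam (kerS b) (x : ℂ)).im = 0 := Complex.conj_eq_iff_im.1 hr.symm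
      simp [g, this]
    have gz : g z.im = -(Lam (kerS b) z).im - Real.pi * z.im * |x| := by
      simp only [g, x, Complex.re_add_im]
    rw [g0, gz, sub_zero, sub_zero, Real.norm_eq_abs, Real.norm_eq_abs] at h
    exact h.trans (by gcongr)
  refine ⟨Real.exp (C * η), Real.exp_pos _, fun z hz => ?_⟩
  obtain ⟨h1, h2⟩ := abs_le.1 (key z hz)
  have e : ‖sb b z‖ = Real.exp (-(Lam (kerS b) z).im) := by
    rw [sb_eq, Complex.norm_exp]; simp
  rw [e, ← Real.exp_neg, ← Real.exp_add, ← Real.exp_add, Real.exp_le_exp, Real.exp_le_exp]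
  constructor <;> linarith

/-- `gM` contains only a quotient of two values of s_b, so a difference of `Lam` suffices and no
constant at infinity has to be found. The expression is the integral of Psi(z) + πz over the segment
from x + v to x + u, and that integrand is bounded and tends to 0. -/
lemma tendsto_Lam_sub {b : ℝ} (hb : 0 < b) {u v : ℂ} (hu : 2 * |u.im| < Q b)
    (hv : 2 * |v.im| < Q b) :
    Tendsto (fun x : ℝ => Lam (kerS b) (x + u) - Lam (kerS b) (x + v) +
      Real.pi / 2 * ((x + u) ^ 2 - (x + v) ^ 2)) atTop (𝓝 0) := by
  have hQ := Q_pos hb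
  have hQ' : (Q b : ℂ) ≠ 0 := by exact_mod_cast hQ.ne'
  have hk := isKernel_kerS hb
  obtain ⟨D, hD0, hD⟩ := (isKernel_kerS hb).exists_sub_le (isKernel_kerOne hQ) hQ
  set η := max |u.im| |v.im| with hηdef
  have h0 : 0 ≤ η := le_max_of_le_left (abs_nonneg _)
  have hη : 2 * η < Q b := by
    rcases max_choice |u.im| |v.im| with h | h <;> rw [hηdef, h] <;> assumption
  have hη' : 2 * (η / Q b) < 1 := by rw [← mul_div_assoc, div_lt_one hQ]; exact hη
  let θ : ℂ → ℂ := fun z => Psi (kerS b) z + Real.pi * z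
  have hθ : ∀ z : ℂ, |z.im| ≤ η → θ z =
      -(Q b * (logCosh (z / Q b) - Real.pi * (z / Q b))) + cosTransform (remS b) z := by
    intro z hz
    simp only [θ]
    rw [Psi_kerS_eq hb (by linarith)]
    field_simp
    ring
  let p : ℝ → ℂ := fun s => v + s * (u - v)
  have hp : ∀ s ∈ Icc (0 : ℝ) 1, |(p s).im| ≤ η := by
    intro s hs
    have : (p s).im = (1 - s) * v.im + s * u.im := by simp [p]; ring
    rw [this]
    have h1 := abs_add_le ((1 - s) * v.im) (s * u.im)
    rw [abs_mul, abs_mul, abs_of_nonneg hs.1, abs_of_nonneg (by linarith [hs.2] : 0 ≤ 1 - s)] at h1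
    have h2 : |v.im| ≤ η := le_max_right _ _
    have h3 : |u.im| ≤ η := le_max_left _ _
    nlinarith [hs.1, hs.2]
  have hder : ∀ (x s : ℝ), s ∈ Icc (0 : ℝ) 1 → HasDerivAt
      (fun s : ℝ => Lam (kerS b) (x + p s) + Real.pi / 2 * (x + p s) ^ 2)
      (θ (x + p s) * (u - v)) s := by
    intro x s hs
    have hs' : 2 * |((x : ℂ) + p s).im| < Q b := by
      have := hp s hs
      simp only [Complex.add_im, Complex.ofReal_im, zero_add]
      linarith
    have h1 : HasDerivAt (fun s : ℝ => (x : ℂ) + p s) (u - v) s := by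
      simpa [p] using (((Complex.ofRealCLM.hasDerivAt (x := s)).mul_const (u - v)).const_add v).const_add
        (x : ℂ)
    have h2 := (hk.hasDerivAt_Lam hs').comp s h1
    have h3 := (h1.pow 2).const_mul ((Real.pi : ℂ) / 2)
    refine (h2.add h3).congr_deriv ?_
    simp only [θ]; push_cast; ring
  have hcont : ∀ x : ℝ, ContinuousOn (fun s : ℝ => θ (x + p s) * (u - v)) (Icc 0 1) := by
    intro x s hs
    have hs' : 2 * |((x : ℂ) + p s).im| < Q b := by
      have := hp s hs
      simp only [Complex.add_im, Complex.ofReal_im, zero_add]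
      linarith
    have h1 : ContinuousAt (fun s : ℝ => (x : ℂ) + p s) s := by
      simp only [p]; fun_prop
    have h2 : ContinuousAt θ ((x : ℂ) + p s) := by
      refine ContinuousAt.add (hk.differentiableAt_Psi hs').continuousAt ?_
      fun_prop
    exact ((ContinuousAt.comp (f := fun s : ℝ => (x : ℂ) + p s) h2 h1).mul
      continuousAt_const).continuousWithinAt
  have hFTC : ∀ x : ℝ, Lam (kerS b) (x + u) - Lam (kerS b) (x + v) +
      Real.pi / 2 * ((x + u) ^ 2 - (x + v) ^ 2) = ∫ s in (0 : ℝ)..1, θ (x + p s) * (u - v) := by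
    intro x
    rw [intervalIntegral.integral_eq_sub_of_hasDerivAt (fun s hs => hder x s
        (by rwa [uIcc_of_le zero_le_one] at hs))
      (ContinuousOn.intervalIntegrable ?_)]
    · simp only [p]; push_cast; ring_nf
    · rw [uIcc_of_le zero_le_one]; exact hcont x
  simp_rw [hFTC]
  set B : ℝ := (Q b * (|Real.log (Real.cos (Real.pi * (η / Q b)))| + Real.log 2 + Real.pi) +
    D * (1 / (Q b - 2 * η))) * ‖u - v‖
  have hlim : Tendsto (fun x : ℝ => ∫ s in (0 : ℝ)..1, θ (x + p s) * (u - v)) atTop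
      (𝓝 (∫ s in (0 : ℝ)..1, (0 : ℂ))) := by
    refine intervalIntegral.tendsto_integral_filter_of_dominated_convergence (fun _ => B) ?_ ?_ ?_ ?_
    · refine Eventually.of_forall fun x => ?_
      rw [uIoc_of_le zero_le_one]
      exact ((hcont x).mono Ioc_subset_Icc_self).aestronglyMeasurable measurableSet_Ioc
    · filter_upwards [eventually_ge_atTop (|u.re| + |v.re|)] with x hx
      refine Eventually.of_forall fun s hs => ?_
      rw [uIoc_of_le zero_le_one] at hs
      have hs1 := hp s (Ioc_subset_Icc_self hs)
      have him : |((x : ℂ) + p s).im| ≤ η := by simpa using hs1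
      have hre : 0 ≤ ((x : ℂ) + p s).re := by
        have : ((x : ℂ) + p s).re = x + (1 - s) * v.re + s * u.re := by simp [p]; ring
        rw [this]
        nlinarith [neg_abs_le u.re, neg_abs_le v.re, hs.1, hs.2, abs_nonneg u.re, abs_nonneg v.re]
      rw [norm_mul, hθ _ him]
      simp only [B]
      gcongr
      refine (norm_add_le _ _).trans (add_le_add ?_ (norm_cosTransform_le hD hη him))
      rw [norm_neg, norm_mul, Complex.norm_real, Real.norm_eq_abs, abs_of_pos hQ]
      gcongr
      refine norm_logCosh_sub_le (by positivity) hη' ?_ ?_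
      · rw [abs_div_Q_im hb]; gcongr
      · rw [Complex.div_ofReal_re]; positivity
    · exact intervalIntegrable_const
    · refine Eventually.of_forall fun s hs => ?_
      rw [uIoc_of_le zero_le_one] at hs
      have hs1 := hp s (Ioc_subset_Icc_self hs)
      have hc : Tendsto (fun x : ℝ => cosTransform (remS b) (x + p s)) atTop (𝓝 0) :=
        tendsto_cosTransform ((isKernel_kerS hb).cont.sub (isKernel_kerOne hQ).cont) hD (by linarith)
      have hl := (tendsto_logCosh_sub (w := p s / Q b)
        (by rw [abs_div_Q_im hb, ← mul_div_assoc, div_lt_one hQ]; linarith)).comp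
        (tendsto_id.atTop_div_const hQ)
      have h := ((((hl.const_mul (Q b : ℂ)).neg).add hc).mul_const (u - v))
      simp only [mul_zero, neg_zero, add_zero, zero_mul] at h
      refine h.congr fun x => ?_
      have him : |((x : ℂ) + p s).im| ≤ η := by simpa using hs1
      rw [hθ _ him]
      simp only [Function.comp, id]
      push_cast
      rw [← add_div]
  simpa using hlim

/-! ### Horizontal contour shifts -/

lemma integrable_exp_neg_mul_abs {δ : ℝ} (hδ : 0 < δ) :
    Integrable (fun x : ℝ => Real.exp (-(δ * |x|))) := by
  have h1 : IntegrableOn (fun x : ℝ => Real.exp (-(δ * |x|))) (Ioi 0) :=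
    (integrableOn_exp_neg hδ 0).congr_fun (fun x hx => by rw [abs_of_pos (mem_Ioi.1 hx)])
      measurableSet_Ioi
  have h2 : IntegrableOn (fun x : ℝ => Real.exp (-(δ * |x|))) (Iic 0) := by
    refine (integrableOn_exp_mul_Iic hδ 0).congr_fun (fun x hx => ?_) measurableSet_Iic
    rw [abs_of_nonpos hx]; ring_nf
  rw [← integrableOn_univ, ← Iic_union_Ioi (a := (0 : ℝ))]
  exact h2.union h1

lemma integrable_line_of_bound {f : ℂ → ℂ} {c C δ : ℝ} (hδ : 0 < δ)
    (hf : Continuous fun x : ℝ => f (x + c * Complex.I))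
    (hb : ∀ x : ℝ, ‖f (x + c * Complex.I)‖ ≤ C * Real.exp (-(δ * |x|))) :
    Integrable fun x : ℝ => f (x + c * Complex.I) :=
  Integrable.mono' ((integrable_exp_neg_mul_abs hδ).const_mul C) hf.aestronglyMeasurable
    (Eventually.of_forall hb)

lemma continuous_line {f : ℂ → ℂ} {c : ℝ} (hf : ∀ z : ℂ, z.im = c → DifferentiableAt ℂ f z) :
    Continuous fun x : ℝ => f (x + c * Complex.I) := by
  rw [continuous_iff_continuousAt]
  intro x
  exact ContinuousAt.comp (f := fun x : ℝ => (x : ℂ) + c * Complex.I)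
    (hf _ (by simp)).continuousAt (by fun_prop)

/-- Cauchy's theorem on rectangles; the decay in |Re z| kills the vertical sides. -/
lemma integral_line_eq {f : ℂ → ℂ} {c₁ c₂ C δ : ℝ} (hc : c₁ ≤ c₂) (hδ : 0 < δ)
    (hf : ∀ z : ℂ, c₁ ≤ z.im → z.im ≤ c₂ → DifferentiableAt ℂ f z)
    (hb : ∀ z : ℂ, c₁ ≤ z.im → z.im ≤ c₂ → ‖f z‖ ≤ C * Real.exp (-(δ * |z.re|))) :
    ∫ x : ℝ, f (x + c₁ * Complex.I) = ∫ x : ℝ, f (x + c₂ * Complex.I) := by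
  have hint : ∀ c, c₁ ≤ c → c ≤ c₂ → Integrable fun x : ℝ => f (x + c * Complex.I) := by
    intro c h1 h2
    refine integrable_line_of_bound (C := C) hδ (continuous_line fun z hz => hf z ?_ ?_) fun x => ?_
    · rw [hz]; exact h1
    · rw [hz]; exact h2
    · simpa using hb (x + c * Complex.I) (by simpa using h1) (by simpa using h2)
  have hbot : Tendsto (fun T : ℝ => -T) atTop atBot := tendsto_neg_atTop_atBot
  have l1 := intervalIntegral_tendsto_integral (hint c₁ le_rfl hc) hbot tendsto_id
  have l2 := intervalIntegral_tendsto_integral (hint c₂ hc le_rfl) hbot tendsto_id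
  have hside : ∀ σ : ℝ, |σ| = 1 → Tendsto (fun T : ℝ =>
      ∫ y in c₁..c₂, f (((σ * T : ℝ) : ℂ) + y * Complex.I)) atTop (𝓝 0) := by
    intro σ hσ
    have hz : Tendsto (fun T : ℝ => C * Real.exp (-(δ * |T|)) * |c₂ - c₁|) atTop (𝓝 0) := by
      have : Tendsto (fun T : ℝ => Real.exp (-(δ * |T|))) atTop (𝓝 0) :=
        Real.tendsto_exp_neg_atTop_nhds_zero.comp
          (tendsto_abs_atTop_atTop.const_mul_atTop hδ)
      simpa using (this.const_mul C).mul_const |c₂ - c₁|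
    refine squeeze_zero_norm (fun T => ?_) hz
    refine intervalIntegral.norm_integral_le_of_norm_le_const fun y hy => ?_
    rw [uIoc_of_le hc] at hy
    have := hb (((σ * T : ℝ) : ℂ) + y * Complex.I) (by simpa using hy.1.le) (by simpa using hy.2)
    have e : (((σ * T : ℝ) : ℂ) + y * Complex.I).re = σ * T := by simp
    rwa [e, abs_mul, hσ, one_mul] at this
  have hrect : ∀ T : ℝ, (∫ x : ℝ in (-T)..T, f (x + c₁ * Complex.I)) -
      (∫ x : ℝ in (-T)..T, f (x + c₂ * Complex.I)) =
      Complex.I • (∫ y in c₁..c₂, f ((((-1) * T : ℝ) : ℂ) + y * Complex.I)) -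
      Complex.I • (∫ y in c₁..c₂, f (((1 * T : ℝ) : ℂ) + y * Complex.I)) := by
    intro T
    have h := Complex.integral_boundary_rect_eq_zero_of_differentiableOn f
      (((-T : ℝ) : ℂ) + c₁ * Complex.I) ((T : ℂ) + c₂ * Complex.I) (fun z hz => by
        have hz2 := hz.2
        simp only [mem_preimage] at hz2
        have e1 : (((-T : ℝ) : ℂ) + c₁ * Complex.I).im = c₁ := by simp
        have e2 : ((T : ℂ) + c₂ * Complex.I).im = c₂ := by simp
        rw [e1, e2, uIcc_of_le hc] at hz2
        exact (hf z hz2.1 hz2.2).differentiableWithinAt)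
    have e1 : (((-T : ℝ) : ℂ) + c₁ * Complex.I).im = c₁ := by simp
    have e2 : ((T : ℂ) + c₂ * Complex.I).im = c₂ := by simp
    have e3 : (((-T : ℝ) : ℂ) + c₁ * Complex.I).re = -T := by simp
    have e4 : ((T : ℂ) + c₂ * Complex.I).re = T := by simp
    rw [e1, e2, e3, e4] at h
    rw [neg_one_mul, one_mul, ← sub_eq_zero, ← h]
    ring
  have l3 := (l1.sub l2).congr hrect
  have l4 := ((hside (-1) (by simp)).const_smul Complex.I).sub
    ((hside 1 (by simp)).const_smul Complex.I)
  simp only [smul_zero, sub_zero] at l4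
  exact sub_eq_zero.1 (tendsto_nhds_unique l3 l4)

/-! ### The Fourier integral -/

/-- The `ω`-independent part of `integrandM`. -/
noncomputable def gM (b ζ : ℝ) (x : ℂ) : ℂ :=
  Complex.exp (Complex.I * Real.pi * x * (ζ - Complex.I * (Q b : ℂ) / 2)) *
    (sb b (x - ζ) / sb b (x + Complex.I * (Q b : ℂ) / 2))

/-- The Fourier kernel times `gM`. -/
noncomputable def hM (b ζ : ℝ) (ω x : ℂ) : ℂ :=
  gM b ζ x * Complex.exp (2 * Real.pi * Complex.I * x * ω)

lemma integrandM_eq (b ζ : ℝ) (ω x : ℂ) : integrandM b ζ ω x = hM b ζ ω x := by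
  have e : Complex.exp (Complex.I * Real.pi * x * (ζ - Complex.I * (Q b : ℂ) / 2 + 2 * ω)) =
      Complex.exp (Complex.I * Real.pi * x * (ζ - Complex.I * (Q b : ℂ) / 2)) *
        Complex.exp (2 * Real.pi * Complex.I * x * ω) := by
    rw [← Complex.exp_add]; ring_nf
  rw [integrandM, hM, gM, e]
  ring

lemma differentiableAt_gM {b : ℝ} (hb : 0 < b) (ζ : ℝ) {x : ℂ} (h1 : -(Q b / 2) < x.im)
    (h2 : x.im < 0) : DifferentiableAt ℂ (gM b ζ) x := by
  have hQ := Q_pos hb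
  have d1 : DifferentiableAt ℂ (fun x : ℂ => sb b (x - ζ)) x := by
    refine DifferentiableAt.comp (g := sb b) x (hasDerivAt_sb hb ?_).differentiableAt (by fun_prop)
    have : |(x - ζ).im| < Q b / 2 := by
      rw [abs_lt]; constructor <;> simp <;> linarith
    linarith
  have d2 : DifferentiableAt ℂ (fun x : ℂ => sb b (x + Complex.I * (Q b : ℂ) / 2)) x := by
    refine DifferentiableAt.comp (g := sb b) x (hasDerivAt_sb hb ?_).differentiableAt (by fun_prop)
    have : |(x + Complex.I * (Q b : ℂ) / 2).im| < Q b / 2 := by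
      rw [abs_lt]; constructor <;> simp <;> linarith
    linarith
  exact (by fun_prop : DifferentiableAt ℂ (fun x : ℂ =>
    Complex.exp (Complex.I * Real.pi * x * (ζ - Complex.I * (Q b : ℂ) / 2))) x).mul
    (d1.div d2 (sb_ne_zero _ _))

lemma differentiableAt_hM {b : ℝ} (hb : 0 < b) (ζ : ℝ) (ω : ℂ) {x : ℂ} (h1 : -(Q b / 2) < x.im)
    (h2 : x.im < 0) : DifferentiableAt ℂ (hM b ζ ω) x :=
  (differentiableAt_gM hb ζ h1 h2).mul (by fun_prop)

/-- The exponential contributes e^{πQ Re x/2}, and the quotient of s_b contributes e^{−πQ|Re x|/2},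
because the imaginary parts of its arguments differ by Q/2. So `gM` is bounded to the right and
decays like e^{πQ Re x} to the left. -/
lemma exists_norm_gM_le {b : ℝ} (hb : 0 < b) (ζ : ℝ) {c₁ c₂ : ℝ} (h1 : 0 < c₁) (h12 : c₁ ≤ c₂)
    (h2 : c₂ < Q b / 2) : ∃ C, 0 < C ∧ ∀ x : ℂ, -c₂ ≤ x.im → x.im ≤ -c₁ →
      ‖gM b ζ x‖ ≤ C * Real.exp (Real.pi * (Q b / 2) * (x.re - |x.re|)) := by
  have hQ := Q_pos hb
  obtain ⟨A, hA0, hA⟩ := exists_norm_sb_bounds hb (h1.le.trans h12) (show 2 * c₂ < Q b by linarith)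
  obtain ⟨B, hB0, hB⟩ := exists_norm_sb_bounds hb (η := Q b / 2 - c₁)
    (by linarith) (by linarith)
  refine ⟨Real.exp (Real.pi * c₂ * |ζ|) * (A * Real.exp (Real.pi * c₂ * |ζ|) * B), by positivity,
    fun x hx1 hx2 => ?_⟩
  have i1 : (x - ζ).im = x.im := by simp
  have r1 : (x - ζ).re = x.re - ζ := by simp
  have i2 : (x + Complex.I * (Q b : ℂ) / 2).im = x.im + Q b / 2 := by simp
  have r2 : (x + Complex.I * (Q b : ℂ) / 2).re = x.re := by simp
  have b1 := (hA (x - ζ) (by rw [i1, abs_le]; constructor <;> linarith)).1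
  have b2 := (hB (x + Complex.I * (Q b : ℂ) / 2) (by rw [i2, abs_le]; constructor <;> linarith)).2
  rw [i1, r1] at b1
  rw [i2, r2] at b2
  rw [gM, norm_mul, norm_div, div_eq_mul_inv ‖_‖, Complex.norm_exp]
  have e : (Complex.I * Real.pi * x * (ζ - Complex.I * (Q b : ℂ) / 2)).re =
      Real.pi * (Q b / 2) * x.re - Real.pi * x.im * ζ := by
    simp; ring
  have hexp1 : Real.exp (Real.pi * (Q b / 2) * x.re - Real.pi * x.im * ζ) ≤
      Real.exp (Real.pi * c₂ * |ζ|) * Real.exp (Real.pi * (Q b / 2) * x.re) := by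
    rw [← Real.exp_add]
    apply Real.exp_le_exp.2
    have : -(x.im * ζ) ≤ c₂ * |ζ| := by
      have h3 : |x.im| ≤ c₂ := by rw [abs_le]; constructor <;> linarith
      calc -(x.im * ζ) ≤ |x.im * ζ| := neg_le_abs _
        _ = |x.im| * |ζ| := abs_mul _ _
        _ ≤ _ := by gcongr
    nlinarith [Real.pi_pos]
  have hexp2 : Real.exp (Real.pi * x.im * |x.re - ζ|) ≤
      Real.exp (Real.pi * c₂ * |ζ|) * Real.exp (Real.pi * x.im * |x.re|) := by
    rw [← Real.exp_add]
    apply Real.exp_le_exp.2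
    have h3 : |x.re| ≤ |x.re - ζ| + |ζ| := by
      have := abs_add_le (x.re - ζ) ζ
      simpa using this
    have h4 : x.im * |x.re - ζ| ≤ x.im * |x.re| + c₂ * |ζ| := by
      nlinarith [abs_nonneg ζ, abs_nonneg (x.re - ζ)]
    nlinarith [Real.pi_pos]
  rw [e]
  calc _ ≤ (Real.exp (Real.pi * c₂ * |ζ|) * Real.exp (Real.pi * (Q b / 2) * x.re)) *
        ((A * (Real.exp (Real.pi * c₂ * |ζ|) * Real.exp (Real.pi * x.im * |x.re|))) *
        (B * Real.exp (-(Real.pi * (x.im + Q b / 2) * |x.re|)))) := by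
        gcongr
        exact b1.trans (by gcongr)
    _ = Real.exp (Real.pi * c₂ * |ζ|) * (A * Real.exp (Real.pi * c₂ * |ζ|) * B) *
        (Real.exp (Real.pi * (Q b / 2) * x.re) * Real.exp (Real.pi * x.im * |x.re|) *
        Real.exp (-(Real.pi * (x.im + Q b / 2) * |x.re|))) := by ring
    _ = _ := by
        rw [← Real.exp_add, ← Real.exp_add]; ring_nf

/-- The Fourier factor creates decay of rate 2π Im ω to the right and reduces the rate to the left
to πQ − 2π Im ω. Both rates are positive precisely when 0 < Im ω < Q/2. -/
lemma exists_norm_hM_le {b : ℝ} (hb : 0 < b) (ζ : ℝ) {c₁ c₂ y₁ y₂ : ℝ} (h1 : 0 < c₁)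
    (h12 : c₁ ≤ c₂) (h2 : c₂ < Q b / 2) (hy1 : 0 < y₁) (hy2 : y₂ < Q b / 2) :
    ∃ C δ, 0 < C ∧ 0 < δ ∧ ∀ x ω : ℂ, -c₂ ≤ x.im → x.im ≤ -c₁ → y₁ ≤ ω.im → ω.im ≤ y₂ →
      ‖hM b ζ ω x‖ ≤
        C * Real.exp (-(2 * Real.pi * x.im * ω.re)) * Real.exp (-(δ * |x.re|)) := by
  obtain ⟨C, hC0, hC⟩ := exists_norm_gM_le hb ζ h1 h12 h2
  have hpi := Real.pi_pos
  refine ⟨C, 2 * Real.pi * min y₁ (Q b / 2 - y₂), hC0, ?_, fun x ω hx1 hx2 hω1 hω2 => ?_⟩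
  · have : 0 < min y₁ (Q b / 2 - y₂) := lt_min hy1 (by linarith)
    positivity
  have h := hC x hx1 hx2
  rw [hM, norm_mul, Complex.norm_exp]
  have e : (2 * Real.pi * Complex.I * x * ω).re = -(2 * Real.pi * x.im * ω.re) -
      2 * Real.pi * x.re * ω.im := by
    simp
  rw [e]
  calc _ ≤ C * Real.exp (Real.pi * (Q b / 2) * (x.re - |x.re|)) *
        Real.exp (-(2 * Real.pi * x.im * ω.re) - 2 * Real.pi * x.re * ω.im) := by gcongr
    _ = C * Real.exp (-(2 * Real.pi * x.im * ω.re)) *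
        Real.exp (Real.pi * (Q b / 2) * (x.re - |x.re|) - 2 * Real.pi * x.re * ω.im) := by
        rw [mul_assoc C, mul_assoc C, ← Real.exp_add, ← Real.exp_add]; ring_nf
    _ ≤ _ := by
        gcongr
        set m := min y₁ (Q b / 2 - y₂)
        have m1 : m ≤ ω.im := (min_le_left _ _).trans hω1
        have m2 : m ≤ Q b / 2 - ω.im := (min_le_right _ _).trans (by linarith)
        rcases le_total 0 x.re with hx | hx
        · rw [abs_of_nonneg hx]
          have := mul_le_mul_of_nonneg_right m1 hx
          nlinarith
        · rw [abs_of_nonpos hx]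
          have := mul_le_mul_of_nonneg_right m2 (neg_nonneg.2 hx)
          nlinarith

lemma line_eq (x c : ℝ) : (x : ℂ) - Complex.I * c = x + ((-c : ℝ) : ℂ) * Complex.I := by
  push_cast; ring

lemma integrable_hM {b : ℝ} (hb : 0 < b) (ζ : ℝ) {ω : ℂ} (h0 : 0 < ω.im) (h1 : ω.im < Q b / 2)
    {c : ℝ} (hc0 : 0 < c) (hc1 : c < Q b / 2) :
    Integrable fun x : ℝ => hM b ζ ω (x - Complex.I * c) := by
  obtain ⟨C, δ, hC0, hδ, hC⟩ := exists_norm_hM_le hb ζ hc0 le_rfl hc1 h0 h1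
  simp_rw [line_eq]
  refine integrable_line_of_bound (C := C * Real.exp (2 * Real.pi * c * ω.re)) hδ
    (continuous_line fun z hz => differentiableAt_hM hb ζ ω ?_ ?_) fun x => ?_
  · rw [hz]; linarith
  · rw [hz]; linarith
  · simpa using hC (x + ((-c : ℝ) : ℂ) * Complex.I) ω (by simp) (by simp) le_rfl le_rfl

/-- The Fourier integral over the line `Im x = -c`. -/
noncomputable def FM (b ζ c : ℝ) (ω : ℂ) : ℂ := ∫ x : ℝ, hM b ζ ω (x - Complex.I * c)

lemma FM_eq {b : ℝ} (hb : 0 < b) (ζ : ℝ) {ω : ℂ} (h0 : 0 < ω.im) (h1 : ω.im < Q b / 2)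
    {c c' : ℝ} (hc0 : 0 < c) (hc1 : c < Q b / 2) (hc0' : 0 < c') (hc1' : c' < Q b / 2) :
    FM b ζ c ω = FM b ζ c' ω := by
  wlog h : c' ≤ c generalizing c c'
  · exact (this hc0' hc1' hc0 hc1 (not_le.1 h).le).symm
  obtain ⟨C, δ, hC0, hδ, hC⟩ := exists_norm_hM_le hb ζ hc0' h hc1 h0 h1
  simp_rw [FM, line_eq]
  refine integral_line_eq (C := C * Real.exp (2 * Real.pi * c * |ω.re|)) (neg_le_neg h) hδ
    (fun z hz1 hz2 => differentiableAt_hM hb ζ ω (by linarith) (by linarith)) fun z hz1 hz2 => ?_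
  refine (hC z ω hz1 hz2 le_rfl le_rfl).trans ?_
  gcongr
  have h3 : -(z.im * ω.re) ≤ c * |ω.re| := by
    calc -(z.im * ω.re) ≤ |z.im * ω.re| := neg_le_abs _
      _ = |z.im| * |ω.re| := abs_mul _ _
      _ ≤ _ := by gcongr; rw [abs_le]; constructor <;> linarith
  nlinarith [Real.pi_pos]

lemma exists_norm_FM_le {b : ℝ} (hb : 0 < b) (ζ : ℝ) {c y₁ y₂ : ℝ} (hc0 : 0 < c)
    (hc1 : c < Q b / 2) (hy1 : 0 < y₁) (hy2 : y₂ < Q b / 2) :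
    ∃ C, ∀ ω : ℂ, y₁ ≤ ω.im → ω.im ≤ y₂ →
      ‖FM b ζ c ω‖ ≤ C * Real.exp (2 * Real.pi * c * ω.re) := by
  obtain ⟨C, δ, hC0, hδ, hC⟩ := exists_norm_hM_le hb ζ hc0 le_rfl hc1 hy1 hy2
  refine ⟨C * ∫ x : ℝ, Real.exp (-(δ * |x|)), fun ω hω1 hω2 => ?_⟩
  have h := norm_integral_le_of_norm_le (μ := volume)
    (f := fun x : ℝ => hM b ζ ω (x - Complex.I * c))
    (g := fun x => C * Real.exp (2 * Real.pi * c * ω.re) * Real.exp (-(δ * |x|)))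
    ((integrable_exp_neg_mul_abs hδ).const_mul _) (Eventually.of_forall fun x => by
      simpa using hC (x - Complex.I * c) ω (by simp) (by simp) hω1 hω2)
  rw [integral_const_mul] at h
  exact h.trans_eq (by ring)

lemma differentiableAt_FM {b : ℝ} (hb : 0 < b) (ζ : ℝ) {ω : ℂ} (h0 : 0 < ω.im)
    (h1 : ω.im < Q b / 2) {c : ℝ} (hc0 : 0 < c) (hc1 : c < Q b / 2) :
    DifferentiableAt ℂ (FM b ζ c) ω := by
  set y₁ := ω.im / 2
  set y₂ := (ω.im + Q b / 2) / 2
  obtain ⟨C, δ, hC0, hδ, hC⟩ := exists_norm_hM_le hb ζ hc0 le_rfl hc1 (y₁ := y₁) (y₂ := y₂)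
    (by positivity) (by simp only [y₂]; linarith)
  have hcont : ∀ ω, Continuous fun x : ℝ => hM b ζ ω (x - Complex.I * c) := fun ω => by
    simp_rw [line_eq]
    refine continuous_line fun z hz => differentiableAt_hM hb ζ ω ?_ ?_ <;> rw [hz] <;> linarith
  set S : Set ℂ := {w : ℂ | y₁ < w.im ∧ w.im < y₂ ∧ w.re < ω.re + 1}
  have hS : S ∈ 𝓝 ω := by
    have hO : IsOpen S := by
      refine (isOpen_lt continuous_const Complex.continuous_im).inter
        ((isOpen_lt Complex.continuous_im continuous_const).inter
        (isOpen_lt Complex.continuous_re continuous_const))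
    refine hO.mem_nhds ⟨?_, ?_, ?_⟩
    · simp only [y₁]; linarith
    · simp only [y₂]; linarith
    · linarith
  set K := C * Real.exp (2 * Real.pi * c * (ω.re + 1))
  refine (hasDerivAt_integral_of_dominated_loc_of_deriv_le (μ := volume)
    (F := fun ω (x : ℝ) => hM b ζ ω (x - Complex.I * c))
    (F' := fun ω (x : ℝ) => hM b ζ ω (x - Complex.I * c) *
      (2 * Real.pi * Complex.I * (x - Complex.I * c)))
    (bound := fun x => 2 * Real.pi * (c + 2 / δ) * K * Real.exp (-(δ / 2 * |x|))) hS
    (Eventually.of_forall fun w => (hcont w).aestronglyMeasurable)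
    (integrable_hM hb ζ h0 h1 hc0 hc1) ?_ ?_ ?_ ?_).2.differentiableAt
  · exact ((hcont ω).mul (by fun_prop)).aestronglyMeasurable
  · refine Eventually.of_forall fun x w hw => ?_
    have hbd : ‖hM b ζ w (x - Complex.I * c)‖ ≤ K * Real.exp (-(δ * |x|)) := by
      have := hC (x - Complex.I * c) w (by simp) (by simp) hw.1.le hw.2.1.le
      have e1 : ((x : ℂ) - Complex.I * c).im = -c := by simp
      have e2 : ((x : ℂ) - Complex.I * c).re = x := by simp
      rw [e1, e2] at this
      refine this.trans ?_
      simp only [K]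
      gcongr
      have := hw.2.2
      have := Real.pi_pos
      nlinarith [mul_pos this hc0]
    have hx : ‖2 * Real.pi * Complex.I * ((x : ℂ) - Complex.I * c)‖ ≤
        2 * Real.pi * ((c + 2 / δ) * Real.exp (δ / 2 * |x|)) := by
      have h2 : ‖(x : ℂ) - Complex.I * c‖ ≤ |x| + c := by
        refine (norm_sub_le _ _).trans ?_
        simp [abs_of_pos hc0]
      have h3 := Real.add_one_le_exp (δ / 2 * |x|)
      have h4 : 1 ≤ Real.exp (δ / 2 * |x|) := Real.one_le_exp (by positivity)
      -- Half of the exponential decay pays for the factor x produced by differentiating in `ω`.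
      have h5 : |x| ≤ 2 / δ * Real.exp (δ / 2 * |x|) := by
        rw [div_mul_eq_mul_div, le_div_iff₀ hδ]; linarith
      rw [norm_mul]
      have e3 : ‖2 * (Real.pi : ℂ) * Complex.I‖ = 2 * Real.pi := by
        simp [abs_of_pos Real.pi_pos]
      rw [e3]
      gcongr
      nlinarith
    calc _ ≤ K * Real.exp (-(δ * |x|)) * (2 * Real.pi * ((c + 2 / δ) * Real.exp (δ / 2 * |x|))) := by
          rw [norm_mul]; gcongr
      _ = 2 * Real.pi * (c + 2 / δ) * K * (Real.exp (-(δ * |x|)) * Real.exp (δ / 2 * |x|)) := by ring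
      _ = _ := by rw [← Real.exp_add]; ring_nf
  · exact (integrable_exp_neg_mul_abs (by positivity)).const_mul _
  · refine Eventually.of_forall fun x w _ => ?_
    have h3 : HasDerivAt (fun w : ℂ => 2 * Real.pi * Complex.I * ((x : ℂ) - Complex.I * c) * w)
        (2 * Real.pi * Complex.I * ((x : ℂ) - Complex.I * c)) w := by
      simpa using (hasDerivAt_id w).const_mul (2 * Real.pi * Complex.I * ((x : ℂ) - Complex.I * c))
    refine (h3.cexp.const_mul (gM b ζ (x - Complex.I * c))).congr_deriv ?_
    rw [hM]; ring

/-! ### A Liouville theorem for periodic functions in a strip -/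

lemma norm_sinh_sq (w : ℂ) :
    ‖Complex.sinh w‖ ^ 2 = Real.sinh w.re ^ 2 + Real.sin w.im ^ 2 := by
  have h : Complex.sinh w = ((Real.sinh w.re * Real.cos w.im : ℝ) : ℂ) +
      ((Real.cosh w.re * Real.sin w.im : ℝ) : ℂ) * Complex.I := by
    conv_lhs => rw [← Complex.re_add_im w, Complex.sinh_add, Complex.cosh_mul_I, Complex.sinh_mul_I]
    push_cast; ring
  rw [h, ← Complex.normSq_eq_norm_sq, Complex.normSq_add_mul_I]
  have := Real.cosh_sq w.re
  have := Real.sin_sq_add_cos_sq w.im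
  nlinarith

lemma sinh_ne_zero_of_im {w : ℂ} (hw : |w.im| < Real.pi) (h0 : w ≠ 0) : Complex.sinh w ≠ 0 := by
  intro h
  have h1 := norm_sinh_sq w
  rw [h, norm_zero] at h1
  have h2 : Real.sinh w.re = 0 := by nlinarith [sq_nonneg (Real.sinh w.re), sq_nonneg (Real.sin w.im)]
  have h3 : Real.sin w.im = 0 := by nlinarith [sq_nonneg (Real.sinh w.re), sq_nonneg (Real.sin w.im)]
  obtain ⟨a1, a2⟩ := abs_lt.1 hw
  exact h0 (Complex.ext (Real.sinh_eq_zero.1 h2)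
    ((Real.sin_eq_zero_iff_of_lt_of_lt a1 a2).1 h3))

lemma sinh_abs_re_le (w : ℂ) : Real.sinh |w.re| ≤ ‖Complex.sinh w‖ := by
  apply le_of_sq_le_sq _ (norm_nonneg _)
  rw [norm_sinh_sq]
  rcases abs_choice w.re with h | h <;> rw [h] <;> try rw [Real.sinh_neg]
  all_goals nlinarith [sq_nonneg (Real.sin w.im)]

/-- The difference quotient of `f` at `0` with respect to `sinh (π z / b)`. -/
noncomputable def sinhSlope (b : ℝ) (f : ℂ → ℂ) (z : ℂ) : ℂ :=
  dslope f 0 z / dslope (fun z => Complex.sinh (Real.pi / b * z)) 0 z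

lemma sinhSlope_of_ne (b : ℝ) (f : ℂ → ℂ) {z : ℂ} (hz : z ≠ 0) :
    sinhSlope b f z = (f z - f 0) / Complex.sinh (Real.pi / b * z) := by
  rw [sinhSlope, dslope_of_ne _ hz, dslope_of_ne _ hz, slope_def_field, slope_def_field]
  simp only [mul_zero, Complex.sinh_zero, sub_zero]
  rw [div_div_div_cancel_right₀ hz]

lemma im_pi_div_mul {b : ℝ} (z : ℂ) : ((Real.pi : ℂ) / b * z).im = Real.pi / b * z.im := by
  rw [← Complex.ofReal_div, Complex.im_ofReal_mul]

/-- In |Im z| < b the only zero of sinh(πz/b) is the simple one at 0, which the quotient of slopes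
removes. -/
lemma differentiableOn_sinhSlope {b : ℝ} (hb : 0 < b) {f : ℂ → ℂ}
    (hf : ∀ z : ℂ, |z.im| < b → DifferentiableAt ℂ f z) :
    DifferentiableOn ℂ (sinhSlope b f) {z : ℂ | |z.im| < b} := by
  have hU : IsOpen {z : ℂ | |z.im| < b} := isOpen_lt (by fun_prop) continuous_const
  have h0 : {z : ℂ | |z.im| < b} ∈ 𝓝 (0 : ℂ) := hU.mem_nhds (by simpa using hb)
  refine DifferentiableOn.div ((Complex.differentiableOn_dslope h0).2
    fun z hz => (hf z hz).differentiableWithinAt) ((Complex.differentiableOn_dslope h0).2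
    (by fun_prop)) fun z hz => ?_
  have hpb : (Real.pi : ℂ) / b ≠ 0 := by
    rw [← Complex.ofReal_div]; exact_mod_cast (div_pos Real.pi_pos hb).ne'
  by_cases h : z = 0
  · rw [h, dslope_same]
    have h1 : HasDerivAt (fun z : ℂ => (Real.pi : ℂ) / b * z) ((Real.pi : ℂ) / b) 0 := by
      simpa using (hasDerivAt_id (0 : ℂ)).const_mul ((Real.pi : ℂ) / b)
    rw [h1.csinh.deriv]
    simpa using hpb
  · rw [dslope_of_ne _ h, slope_def_field]
    simp only [mul_zero, Complex.sinh_zero, sub_zero]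
    refine div_ne_zero (sinh_ne_zero_of_im ?_ (mul_ne_zero hpb h)) h
    rw [im_pi_div_mul, abs_mul, abs_of_pos (div_pos Real.pi_pos hb)]
    have : |z.im| < b := hz
    calc Real.pi / b * |z.im| < Real.pi / b * b := by
          have := div_pos Real.pi_pos hb
          gcongr
      _ = Real.pi := by field_simp

/-- H = (f − f(0))/sinh(πz/b) changes sign under z ↦ z − ib, so |H| is periodic, and κ < π/b makes H
vanish at both ends of the strip. If H were not zero, |H| would have a maximum over |Im z| ≤ b/2,
which by periodicity is a maximum over the open strip |Im z| < b. The maximum principle then makes H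
constant, against the decay. -/
lemma eq_zero_of_periodic_strip {b : ℝ} (hb : 0 < b) {f : ℂ → ℂ}
    (hf : ∀ z : ℂ, |z.im| < b → DifferentiableAt ℂ f z)
    (hp : ∀ z : ℂ, 0 < z.im → z.im < b → f (z - Complex.I * b) = f z)
    {C κ : ℝ} (hκ0 : 0 ≤ κ) (hκ : κ < Real.pi / b)
    (hg : ∀ z : ℂ, |z.im| ≤ b / 2 → ‖f z‖ ≤ C * Real.exp (κ * |z.re|)) :
    ∀ z : ℂ, |z.im| ≤ b / 2 → f z = f 0 := by
  set H := sinhSlope b f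
  set U : Set ℂ := {z : ℂ | |z.im| < b} with hUdef
  have hU : IsOpen U := isOpen_lt (by fun_prop) continuous_const
  have hH : DifferentiableOn ℂ H U := differentiableOn_sinhSlope hb hf
  have hpb : 0 < Real.pi / b := div_pos Real.pi_pos hb
  have hanti : ∀ z : ℂ, 0 < z.im → z.im < b → ‖H (z - Complex.I * b)‖ = ‖H z‖ := by
    intro z h1 h2
    have hz : z ≠ 0 := fun h => by simp [h] at h1
    have hz' : z - Complex.I * b ≠ 0 := fun h => by
      have := congrArg Complex.im h
      simp at this; linarith
    have e : (Real.pi : ℂ) / b * (z - Complex.I * b) = Real.pi / b * z - Real.pi * Complex.I := by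
      have : (b : ℂ) ≠ 0 := by exact_mod_cast hb.ne'
      field_simp
    simp only [H]
    rw [sinhSlope_of_ne b f hz, sinhSlope_of_ne b f hz', hp z h1 h2, e, Complex.sinh_sub,
      Complex.cosh_mul_I, Complex.sinh_mul_I]
    simp
  have hsmall : ∀ ε : ℝ, 0 < ε → ∃ T, ∀ z : ℂ, |z.im| ≤ b / 2 → T ≤ |z.re| → ‖H z‖ ≤ ε := by
    intro ε hε
    set A := 4 * (|C| + ‖f 0‖)
    have ht : Tendsto (fun x : ℝ => A * Real.exp (-((Real.pi / b - κ) * x))) atTop (𝓝 (A * 0)) :=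
      (Real.tendsto_exp_neg_atTop_nhds_zero.comp
        (tendsto_id.const_mul_atTop (by linarith : 0 < Real.pi / b - κ))).const_mul A
    rw [mul_zero] at ht
    obtain ⟨T, hT⟩ := ((ht.eventually_lt_const hε).and (eventually_ge_atTop (b + 1))).exists_forall_of_atTop
    refine ⟨T, fun z hz hzT => ?_⟩
    obtain ⟨h1, h2⟩ := hT |z.re| hzT
    refine le_trans ?_ h1.le
    have hz0 : z ≠ 0 := fun h => by simp [h] at h2; linarith
    simp only [H]
    rw [sinhSlope_of_ne b f hz0, norm_div]
    have hs : Real.exp (Real.pi / b * |z.re|) / 4 ≤ ‖Complex.sinh (Real.pi / b * z)‖ := by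
      refine le_trans ?_ (sinh_abs_re_le _)
      have e : |((Real.pi : ℂ) / b * z).re| = Real.pi / b * |z.re| := by
        rw [← Complex.ofReal_div, Complex.re_ofReal_mul, abs_mul, abs_of_pos hpb]
      rw [e, Real.sinh_eq]
      have h3 : 1 ≤ Real.pi / b * |z.re| := by
        rw [div_mul_eq_mul_div, le_div_iff₀ hb]
        nlinarith [Real.pi_gt_three]
      have h4 := Real.add_one_le_exp (Real.pi / b * |z.re|)
      have h5 : Real.exp (-(Real.pi / b * |z.re|)) ≤ 1 := Real.exp_le_one_iff.2 (by linarith)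
      linarith
    have hn : ‖f z - f 0‖ ≤ (|C| + ‖f 0‖) * Real.exp (κ * |z.re|) := by
      refine (norm_sub_le _ _).trans ?_
      have h6 : 1 ≤ Real.exp (κ * |z.re|) := Real.one_le_exp (by positivity)
      have h7 := hg z hz
      nlinarith [le_abs_self C, norm_nonneg (f 0), abs_nonneg C]
    calc _ ≤ (|C| + ‖f 0‖) * Real.exp (κ * |z.re|) / (Real.exp (Real.pi / b * |z.re|) / 4) := by
          gcongr
      _ = A * (Real.exp (κ * |z.re|) * Real.exp (-(Real.pi / b * |z.re|))) := by
          rw [Real.exp_neg]; simp only [A]; field_simp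
      _ = _ := by rw [← Real.exp_add]; ring_nf
  have hzero : ∀ z : ℂ, |z.im| ≤ b / 2 → H z = 0 := by
    by_contra! hcon
    obtain ⟨x₀, hx₀, hne⟩ := hcon
    have hpos : 0 < ‖H x₀‖ := norm_pos_iff.2 hne
    set S : Set ℂ := {z : ℂ | |z.im| ≤ b / 2}
    have hSU : S ⊆ U := fun z (hz : |z.im| ≤ b / 2) => hz.trans_lt (by linarith : b / 2 < b)
    have hS : IsClosed S := isClosed_le (by fun_prop) continuous_const
    obtain ⟨c, hcS, hc⟩ := ContinuousOn.exists_isMaxOn' (f := fun z => ‖H z‖)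
      (hH.continuousOn.mono hSU).norm hS hx₀ (by
        obtain ⟨T, hT⟩ := hsmall _ hpos
        rw [eventually_inf_principal]
        filter_upwards [(isCompact_closedBall (0 : ℂ) (T + b)).compl_mem_cocompact] with z hz hzS
        refine hT z hzS ?_
        simp only [mem_compl_iff, Metric.mem_closedBall, dist_zero_right, not_le] at hz
        have := Complex.norm_le_abs_re_add_abs_im z
        have : |z.im| ≤ b / 2 := hzS
        linarith)
    -- A point outside the closed middle strip is moved into it by ±ib without changing |H|.
    have hmax : IsMaxOn (norm ∘ H) U c := by
      intro z hz
      have hz' : |z.im| < b := hz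
      simp only [mem_ofPred_eq, Function.comp]
      by_cases h1 : |z.im| ≤ b / 2
      · exact hc h1
      · push Not at h1
        rcases le_total 0 z.im with h2 | h2
        · rw [abs_of_nonneg h2] at h1 hz'
          rw [← hanti z (by linarith) hz']
          apply hc
          change |(z - Complex.I * b).im| ≤ b / 2
          rw [abs_le]; constructor <;> simp <;> linarith
        · rw [abs_of_nonpos h2] at h1 hz'
          have h3 := hanti (z + Complex.I * b) (by simp; linarith) (by simp; linarith)
          rw [add_sub_cancel_right] at h3
          rw [h3]
          apply hc
          change |(z + Complex.I * b).im| ≤ b / 2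
          rw [abs_le]; constructor <;> simp <;> linarith
    have hconv : IsPreconnected U := by
      have e : U = {z : ℂ | 2 * |z.im| < 2 * b} := by
        ext z; simp only [hUdef, mem_ofPred_eq]; constructor <;> intro h <;> linarith
      rw [e]; exact (convex_strip _).isPreconnected
    have hconst := Complex.eqOn_of_isPreconnected_of_isMaxOn_norm hconv hU hH (hSU hcS) hmax
    have hcpos : 0 < ‖H c‖ := hpos.trans_le (hc hx₀)
    obtain ⟨T, hT⟩ := hsmall (‖H c‖ / 2) (by positivity)
    have h4 := hT ((|T| : ℝ) : ℂ) (by simp; linarith) (by simpa using le_abs_self T)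
    rw [hconst (show (((|T| : ℝ) : ℂ)) ∈ U by simpa [hUdef] using hb)] at h4
    simp only [Function.const] at h4
    linarith
  intro z hz
  by_cases h0 : z = 0
  · rw [h0]
  have h1 := hzero z hz
  simp only [H] at h1
  rw [sinhSlope_of_ne b f h0, div_eq_zero_iff] at h1
  rcases h1 with h1 | h1
  · exact sub_eq_zero.1 h1
  · exfalso
    refine sinh_ne_zero_of_im ?_ (mul_ne_zero ?_ h0) h1
    · rw [im_pi_div_mul, abs_mul, abs_of_pos hpb]
      calc Real.pi / b * |z.im| ≤ Real.pi / b * (b / 2) := by gcongr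
        _ = Real.pi / 2 := by field_simp
        _ < _ := by linarith [Real.pi_pos]
    · rw [← Complex.ofReal_div]; exact_mod_cast hpb.ne'

/-! ### The pole of `s_b` at `-i Q / 2` -/

/-- `sb_add` carries −iQ/2 + iε by ib to the point i(b − b⁻¹)/2 + iε, near which s_b is continuous.
The factor 2 cosh becomes 2 sin(πbε), which behaves like 2πbε and accounts for the pole. -/
lemma tendsto_sb_pole_aux {b : ℝ} (hb : 0 < b) :
    Tendsto (fun ε : ℝ => 2 * Real.pi * ε * sb b (-(Complex.I * Q b / 2) + Complex.I * ε)) (𝓝[>] 0)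
      (𝓝 ((b : ℂ)⁻¹ * sb b (((b - b⁻¹) / 2 : ℝ) * Complex.I))) := by
  have hb' : (b : ℂ) ≠ 0 := by exact_mod_cast hb.ne'
  have hFE : ∀ ε : ℝ, 0 < ε → ε < b⁻¹ →
      sb b (((b - b⁻¹) / 2 : ℝ) * Complex.I + Complex.I * ε) =
        2 * (Real.sin (Real.pi * b * ε) : ℂ) * sb b (-(Complex.I * Q b / 2) + Complex.I * ε) := by
    intro ε h1 h2
    set z : ℂ := ((-(b⁻¹ / 2) + ε : ℝ) : ℂ) * Complex.I
    have hbe : b * ε < 1 := by rwa [← lt_inv_mul_iff₀ hb, mul_one]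
    have hz : 2 * |(b * z : ℂ).im| < 1 := by
      have : (b * z : ℂ).im = -(1 / 2) + b * ε := by
        simp only [z]; rw [Complex.im_ofReal_mul]; simp; field_simp
      rw [this]
      have : |-(1 / 2) + b * ε| < 1 / 2 := by
        rw [abs_lt]; constructor <;> nlinarith
      linarith
    have h := sb_add hb hz
    have e1 : z + Complex.I * b / 2 = ((b - b⁻¹) / 2 : ℝ) * Complex.I + Complex.I * ε := by
      simp only [z]; push_cast; ring
    have e2 : z - Complex.I * b / 2 = -(Complex.I * Q b / 2) + Complex.I * ε := by
      simp only [z, Q]; push_cast; ring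
    have e3 : (Real.pi : ℂ) * (b * z) = ((Real.pi * b * ε - Real.pi / 2 : ℝ) : ℂ) * Complex.I := by
      simp only [z]; push_cast; field_simp; ring
    rw [e1, e2, e3, Complex.cosh_mul_I, ← Complex.ofReal_cos, Real.cos_sub_pi_div_two] at h
    exact h
  have hc : Tendsto (fun ε : ℝ => sb b (((b - b⁻¹) / 2 : ℝ) * Complex.I + Complex.I * ε)) (𝓝[>] 0)
      (𝓝 (sb b (((b - b⁻¹) / 2 : ℝ) * Complex.I))) := by
    have hcont : ContinuousAt (sb b) (((b - b⁻¹) / 2 : ℝ) * Complex.I) := by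
      refine (hasDerivAt_sb hb ?_).continuousAt
      have : |(b - b⁻¹) / 2| < Q b / 2 := by
        have := inv_pos.2 hb
        rw [abs_lt, Q]; constructor <;> linarith
      have e : ((((b - b⁻¹) / 2 : ℝ) : ℂ) * Complex.I).im = (b - b⁻¹) / 2 := by simp
      rw [e]; linarith
    have h2 : ContinuousAt (fun ε : ℝ => sb b (((b - b⁻¹) / 2 : ℝ) * Complex.I + Complex.I * ε)) 0 := by
      refine ContinuousAt.comp (g := sb b) ?_ (by fun_prop)
      simpa using hcont
    have h3 := h2.tendsto
    simp only [Complex.ofReal_zero, mul_zero, add_zero] at h3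
    exact h3.mono_left nhdsWithin_le_nhds
  have hsin : Tendsto (fun ε : ℝ => ((Real.pi * ε / Real.sin (Real.pi * b * ε) : ℝ) : ℂ)) (𝓝[>] 0)
      (𝓝 ((b : ℂ)⁻¹)) := by
    have h1 : HasDerivAt (fun ε : ℝ => Real.sin (Real.pi * b * ε)) (Real.pi * b) 0 := by
      have h0 : HasDerivAt (fun ε : ℝ => Real.pi * b * ε) (Real.pi * b) 0 := by
        simpa using (hasDerivAt_id (0 : ℝ)).const_mul (Real.pi * b)
      simpa using h0.sin
    have h2 := (hasDerivAt_iff_tendsto_slope.1 h1).mono_left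
      (nhdsWithin_mono (0 : ℝ) (fun x (hx : 0 < x) => hx.ne'))
    have hpb : Real.pi * b ≠ 0 := (mul_pos Real.pi_pos hb).ne'
    have h3 := (h2.inv₀ hpb).const_mul Real.pi
    have h4 : Real.pi * (Real.pi * b)⁻¹ = b⁻¹ := by field_simp
    rw [h4] at h3
    have h5 := (Complex.continuous_ofReal.tendsto _).comp h3
    rw [Complex.ofReal_inv] at h5
    refine h5.congr fun ε => ?_
    simp only [Function.comp, slope_def_field, mul_zero, Real.sin_zero, sub_zero, inv_div,
      mul_div_assoc]
  refine (hsin.mul hc).congr' ?_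
  filter_upwards [Ioo_mem_nhdsGT (inv_pos.2 hb)] with ε hε
  have hs : Real.sin (Real.pi * b * ε) ≠ 0 := by
    refine (Real.sin_pos_of_pos_of_lt_pi ?_ ?_).ne'
    · have := hε.1; have := Real.pi_pos; positivity
    · have hbe : b * ε < 1 := by rw [← lt_inv_mul_iff₀ hb, mul_one]; exact hε.2
      nlinarith [Real.pi_pos]
  have hs' : ((Real.sin (Real.pi * b * ε) : ℝ) : ℂ) ≠ 0 := by exact_mod_cast hs
  rw [hFE ε hε.1 hε.2, Complex.ofReal_div, Complex.ofReal_mul]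
  field_simp

/-- With r = s_b(i(b − b⁻¹)/2), the limit is r/b; computed with b⁻¹ in place of b it is b/r. Hence
r² = b², and r > 0 forces r = b. -/
lemma tendsto_sb_pole {b : ℝ} (hb : 0 < b) :
    Tendsto (fun ε : ℝ => 2 * Real.pi * ε * sb b (-(Complex.I * Q b / 2) + Complex.I * ε)) (𝓝[>] 0)
      (𝓝 1) := by
  have h1 := tendsto_sb_pole_aux hb
  have h2 := tendsto_sb_pole_aux (inv_pos.2 hb)
  simp only [sb_inv, Q_inv, inv_inv] at h2
  have h3 := tendsto_nhds_unique h1 h2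
  obtain ⟨r, hr, hrs⟩ := sb_pos_of_imaginary b ((b - b⁻¹) / 2)
  have e : (((b⁻¹ - b) / 2 : ℝ) : ℂ) * Complex.I = -((((b - b⁻¹) / 2 : ℝ) : ℂ) * Complex.I) := by
    push_cast; ring
  rw [e, sb_neg, hrs] at h3
  rw [hrs] at h1
  have h4 : b⁻¹ * r = b * r⁻¹ := by
    simp only [Complex.ofReal_inv, inv_inv] at h3
    exact_mod_cast h3
  have h5 : r = b := by
    field_simp at h4
    nlinarith
  rw [h5] at h1
  have hb' : (b : ℂ) ≠ 0 := by exact_mod_cast hb.ne'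
  rwa [inv_mul_cancel₀ hb'] at h1

/-! ### Evaluation of the Fourier integral -/

/-- The closed form of the Fourier integral, up to a constant. -/
noncomputable def GM (b ζ : ℝ) (ω : ℂ) : ℂ :=
  Complex.exp (Real.pi * ω * (Complex.I * ζ + Q b / 2)) *
    (sb b (ω + ζ - Complex.I * Q b / 2) / sb b ω)

lemma GM_ne_zero (b ζ : ℝ) (ω : ℂ) : GM b ζ ω ≠ 0 :=
  mul_ne_zero (Complex.exp_ne_zero _) (div_ne_zero (sb_ne_zero _ _) (sb_ne_zero _ _))

lemma exp_mul_exp_neg (w : ℂ) : Complex.exp w * Complex.exp (-w) = 1 := by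
  rw [← Complex.exp_add]; simp

/-- Since bQ = b² + 1, the extra 1 contributes the factor e^{iπ/2} = i. -/
lemma exp_quarter (b : ℝ) (hb : 0 < b) :
    Complex.exp (Complex.I * Real.pi * b * Q b / 2) =
      Complex.I * Complex.exp (Complex.I * Real.pi * b ^ 2 / 2) := by
  have hb' : (b : ℂ) ≠ 0 := by exact_mod_cast hb.ne'
  have e : Complex.I * Real.pi * b * Q b / 2 =
      Real.pi / 2 * Complex.I + Complex.I * Real.pi * b ^ 2 / 2 := by
    simp only [Q]; push_cast; field_simp; ring
  rw [e, Complex.exp_add, Complex.exp_pi_div_two_mul_I]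

/-- `sb_add` is applied to numerator and denominator; the range of Im x is what both applications
allow. Only the exponential e^{2πbx} appears as coefficient, and under the Fourier integral it
becomes a shift of `ω` by ib. -/
lemma gM_add {b : ℝ} (hb : 0 < b) (ζ : ℝ) {x : ℂ} (h1 : -(b⁻¹ / 2) < x.im) (h2 : x.im < -(b / 2)) :
    gM b ζ (x + Complex.I * b / 2) *
        (Complex.exp (2 * Real.pi * b * x) - Complex.exp (-(Complex.I * Real.pi * b ^ 2))) =
      gM b ζ (x - Complex.I * b / 2) *
        (Complex.exp (2 * Real.pi * b * x) * Complex.exp (-(2 * Real.pi * b * ζ)) + 1) := by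
  have hbinv : b * b⁻¹ = 1 := mul_inv_cancel₀ hb.ne'
  have hz1 : 2 * |(b * (x - ζ) : ℂ).im| < 1 := by
    have e : (b * (x - ζ) : ℂ).im = b * x.im := by rw [Complex.im_ofReal_mul]; simp
    have : |b * x.im| < 1 / 2 := by rw [abs_lt]; constructor <;> nlinarith
    rw [e]; linarith
  have hz2 : 2 * |(b * (x + Complex.I * (Q b : ℂ) / 2) : ℂ).im| < 1 := by
    have e : (b * (x + Complex.I * (Q b : ℂ) / 2) : ℂ).im = b * (x.im + Q b / 2) := by
      rw [Complex.im_ofReal_mul]; simp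
    have : |b * (x.im + Q b / 2)| < 1 / 2 := by
      rw [abs_lt, Q]; constructor <;> nlinarith
    rw [e]; linarith
  have f1 := sb_add hb hz1
  have f2 := sb_add hb hz2
  set S1 := sb b (x - ζ - Complex.I * b / 2) with hS1
  set S2 := sb b (x + Complex.I * (Q b : ℂ) / 2 - Complex.I * b / 2) with hS2
  have hS20 : S2 ≠ 0 := sb_ne_zero _ _
  set u := Complex.exp (Real.pi * b * x) with hu
  set z := Complex.exp (Real.pi * b * ζ) with hz
  set q := Complex.exp (Complex.I * Real.pi * b ^ 2 / 2) with hq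
  have u0 : u ≠ 0 := Complex.exp_ne_zero _
  have z0 : z ≠ 0 := Complex.exp_ne_zero _
  have q0 : q ≠ 0 := Complex.exp_ne_zero _
  have c1 : 2 * Complex.cosh (Real.pi * (b * (x - ζ))) = u / z + z / u := by
    rw [Complex.cosh, hu, hz, ← Complex.exp_sub, ← Complex.exp_sub]; ring_nf
  have c2 : 2 * Complex.cosh (Real.pi * (b * (x + Complex.I * (Q b : ℂ) / 2))) =
      u * (Complex.I * q) + (u * (Complex.I * q))⁻¹ := by
    rw [Complex.cosh, hq, ← exp_quarter b hb, hu, ← Complex.exp_add, ← Complex.exp_neg]; ring_nf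
  have X1 : Complex.exp (2 * Real.pi * b * x) = u ^ 2 := by
    rw [hu, ← Complex.exp_nat_mul]; congr 1; push_cast; ring
  have X2 : Complex.exp (-(Complex.I * Real.pi * b ^ 2)) = (q ^ 2)⁻¹ := by
    rw [hq, ← Complex.exp_nat_mul, ← Complex.exp_neg]; congr 1; push_cast; ring
  have X3 : Complex.exp (-(2 * Real.pi * b * ζ)) = (z ^ 2)⁻¹ := by
    rw [hz, ← Complex.exp_nat_mul, ← Complex.exp_neg]; congr 1; push_cast; ring
  have P : Complex.exp (Complex.I * Real.pi * (x + Complex.I * b / 2) *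
      (ζ - Complex.I * (Q b : ℂ) / 2)) = Complex.exp (Complex.I * Real.pi * (x - Complex.I * b / 2) *
      (ζ - Complex.I * (Q b : ℂ) / 2)) * (z⁻¹ * (Complex.I * q)) := by
    rw [hq, ← exp_quarter b hb, hz, ← Complex.exp_neg, ← Complex.exp_add, ← Complex.exp_add]
    congr 1
    linear_combination (Real.pi * b * (ζ - Complex.I * (Q b : ℂ) / 2)) * Complex.I_sq
  have a1 : x + Complex.I * b / 2 - ζ = x - ζ + Complex.I * b / 2 := by ring
  have a2 : x - Complex.I * b / 2 - ζ = x - ζ - Complex.I * b / 2 := by ring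
  have a3 : x + Complex.I * b / 2 + Complex.I * (Q b : ℂ) / 2 =
      x + Complex.I * (Q b : ℂ) / 2 + Complex.I * b / 2 := by ring
  have a4 : x - Complex.I * b / 2 + Complex.I * (Q b : ℂ) / 2 =
      x + Complex.I * (Q b : ℂ) / 2 - Complex.I * b / 2 := by ring
  have hc2 : u * (Complex.I * q) + (u * (Complex.I * q))⁻¹ ≠ 0 := by
    intro h
    rw [c2, h, zero_mul] at f2
    exact sb_ne_zero _ _ f2
  rw [gM, gM, a1, a2, a3, a4, f1, f2, c1, c2, X1, X2, X3, P]
  simp only [← hS1, ← hS2]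
  clear_value S1 S2
  generalize Complex.exp (Complex.I * Real.pi * (x - Complex.I * b / 2) *
      (ζ - Complex.I * (Q b : ℂ) / 2)) = E
  -- The cosh factor of the denominator is a multiple of the bracket on the left-hand side, so the
  -- two cancel. The bracket is nonzero because s_b has no zeros.
  have hfac : u * (Complex.I * q) + (u * (Complex.I * q))⁻¹ =
      Complex.I * q / u * (u ^ 2 - (q ^ 2)⁻¹) := by
    have : (u * (Complex.I * q))⁻¹ = -(Complex.I * (u * q)⁻¹) := by
      rw [mul_inv, mul_inv, mul_inv, Complex.inv_I]; ring
    rw [this]; field_simp; ring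
  rw [hfac] at hc2 ⊢
  have hd : u ^ 2 - (q ^ 2)⁻¹ ≠ 0 := right_ne_zero_of_mul hc2
  generalize u ^ 2 - (q ^ 2)⁻¹ = d at hd
  field_simp

/-- Integrate `gM_add` against e^{2πiyω} over Im y = −c. The factor e^{2πby} is absorbed by passing
to ω − ib, and the arguments y ± ib/2 by moving the contour to heights −c ± b/2. For c = Q/4 these
stay in the strip because b < 1. -/
lemma FM_difference {b : ℝ} (hb : 0 < b) (hb1 : b < 1) (ζ : ℝ) {c : ℝ} (hc : c = Q b / 4)
    {ω : ℂ} (h0 : b < ω.im) (h1 : ω.im < Q b / 2) :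
    FM b ζ c (ω - Complex.I * b) * (Complex.exp (Real.pi * b * ω - Complex.I * Real.pi * b ^ 2) -
      Complex.exp (-(Real.pi * b * ω) - 2 * Real.pi * b * ζ + Complex.I * Real.pi * b ^ 2)) =
    FM b ζ c ω * (Complex.exp (-(Real.pi * b * ω)) +
      Complex.exp (Real.pi * b * ω - Complex.I * Real.pi * b ^ 2)) := by
  have hQ := Q_pos hb
  have hbinv : b * b⁻¹ = 1 := mul_inv_cancel₀ hb.ne'
  have hbi : 1 < b⁻¹ := (one_lt_inv₀ hb).2 hb1
  have hQb : Q b = b + b⁻¹ := rfl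
  have i1 : (ω - Complex.I * b).im = ω.im - b := by simp
  have c1 : 0 < c - b / 2 := by rw [hc, hQb]; linarith
  have c1' : c - b / 2 < Q b / 2 := by rw [hc]; linarith
  have c2 : 0 < c + b / 2 := by rw [hc]; positivity
  have c2' : c + b / 2 < Q b / 2 := by rw [hc, hQb]; linarith
  have cc : 0 < c := by rw [hc]; positivity
  have cc' : c < Q b / 2 := by rw [hc]; linarith
  set ω' := ω - Complex.I * b with hω'
  have w0 : 0 < ω'.im := by rw [i1]; linarith
  have w1 : ω'.im < Q b / 2 := by rw [i1]; linarith
  have w2 : 0 < ω.im := hb.trans h0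
  rw [FM_eq hb ζ w0 w1 cc cc' c1 c1', mul_sub, FM_eq hb ζ w2 h1 cc cc' c1 c1', mul_add]
  have key : ∀ x : ℝ, Complex.exp (Real.pi * b * ω - Complex.I * Real.pi * b ^ 2) *
      hM b ζ ω' (x - Complex.I * ((c - b / 2 : ℝ) : ℂ)) -
      Complex.exp (Real.pi * b * ω - Complex.I * Real.pi * b ^ 2) *
      hM b ζ ω (x - Complex.I * ((c - b / 2 : ℝ) : ℂ)) =
      Complex.exp (-(Real.pi * b * ω) - 2 * Real.pi * b * ζ + Complex.I * Real.pi * b ^ 2) *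
      hM b ζ ω' (x - Complex.I * ((c + b / 2 : ℝ) : ℂ)) +
      Complex.exp (-(Real.pi * b * ω)) *
      hM b ζ ω (x - Complex.I * ((c + b / 2 : ℝ) : ℂ)) := by
    intro x
    set y : ℂ := x - Complex.I * c with hy
    have hyim : y.im = -c := by simp [hy]
    have hg := gM_add hb ζ (x := y) (by rw [hyim, hc, hQb]; linarith) (by rw [hyim]; linarith)
    have e1 : (x : ℂ) - Complex.I * ((c - b / 2 : ℝ) : ℂ) = y + Complex.I * b / 2 := by
      rw [hy]; push_cast; ring
    have e2 : (x : ℂ) - Complex.I * ((c + b / 2 : ℝ) : ℂ) = y - Complex.I * b / 2 := by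
      rw [hy]; push_cast; ring
    rw [e1, e2]
    simp only [hM]
    set G1 := gM b ζ (y + Complex.I * b / 2)
    set G2 := gM b ζ (y - Complex.I * b / 2)
    set E := Complex.exp (2 * Real.pi * Complex.I * y * ω) with hE
    set X := Complex.exp (2 * Real.pi * b * y) with hX
    have k1 : Complex.exp (Real.pi * b * ω - Complex.I * Real.pi * b ^ 2) *
        Complex.exp (2 * Real.pi * Complex.I * (y + Complex.I * b / 2) * ω') = E * X := by
      rw [hE, hX, hω', ← Complex.exp_add, ← Complex.exp_add]
      congr 1
      linear_combination (Real.pi * b * ω - 2 * Real.pi * y * b - Complex.I * Real.pi * b ^ 2) * Complex.I_sq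
    have k2 : Complex.exp (Real.pi * b * ω - Complex.I * Real.pi * b ^ 2) *
        Complex.exp (2 * Real.pi * Complex.I * (y + Complex.I * b / 2) * ω) =
        E * Complex.exp (-(Complex.I * Real.pi * b ^ 2)) := by
      rw [hE, ← Complex.exp_add, ← Complex.exp_add]
      congr 1
      linear_combination (Real.pi * b * ω) * Complex.I_sq
    have k3 : Complex.exp (-(Real.pi * b * ω) - 2 * Real.pi * b * ζ + Complex.I * Real.pi * b ^ 2) *
        Complex.exp (2 * Real.pi * Complex.I * (y - Complex.I * b / 2) * ω') =
        E * X * Complex.exp (-(2 * Real.pi * b * ζ)) := by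
      rw [hE, hX, hω', ← Complex.exp_add, ← Complex.exp_add, ← Complex.exp_add]
      congr 1
      linear_combination (-(Real.pi * b * ω) - 2 * Real.pi * y * b + Complex.I * Real.pi * b ^ 2) * Complex.I_sq
    have k4 : Complex.exp (-(Real.pi * b * ω)) *
        Complex.exp (2 * Real.pi * Complex.I * (y - Complex.I * b / 2) * ω) = E := by
      rw [hE, ← Complex.exp_add]
      congr 1
      linear_combination (-(Real.pi * b * ω)) * Complex.I_sq
    linear_combination G1 * k1 - G1 * k2 - G2 * k3 - G2 * k4 + E * hg
  have int1 := (integrable_hM hb ζ w0 w1 c1 c1').const_mul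
    (Complex.exp (Real.pi * b * ω - Complex.I * Real.pi * b ^ 2))
  have int2 := (integrable_hM hb ζ w2 h1 c1 c1').const_mul
    (Complex.exp (Real.pi * b * ω - Complex.I * Real.pi * b ^ 2))
  have int3 := (integrable_hM hb ζ w0 w1 c2 c2').const_mul
    (Complex.exp (-(Real.pi * b * ω) - 2 * Real.pi * b * ζ + Complex.I * Real.pi * b ^ 2))
  have int4 := (integrable_hM hb ζ w2 h1 c2 c2').const_mul (Complex.exp (-(Real.pi * b * ω)))
  have h := integral_congr_ae (μ := volume) (Eventually.of_forall key)
  rw [integral_sub int1 int2, integral_add int3 int4, integral_const_mul, integral_const_mul,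
    integral_const_mul, integral_const_mul] at h
  have hFM : ∀ c w, ∫ x : ℝ, hM b ζ w (x - Complex.I * (c : ℝ)) = FM b ζ c w := fun _ _ => rfl
  simp only [hFM] at h
  rw [FM_eq hb ζ w0 w1 c2 c2' c1 c1', FM_eq hb ζ w2 h1 c2 c2' c1 c1'] at h
  linear_combination h

/-- Both occurrences of s_b in `GM` are shifted with `sb_add`. The nonvanishing of the coefficient,
which would otherwise force a zero of s_b, is what allows the two relations to be divided in
`RM_periodic`. -/
lemma GM_difference {b : ℝ} (hb : 0 < b) (ζ : ℝ) {ω : ℂ} (h0 : b < ω.im) (h1 : ω.im < Q b / 2) :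
    GM b ζ (ω - Complex.I * b) * (Complex.exp (Real.pi * b * ω - Complex.I * Real.pi * b ^ 2) -
      Complex.exp (-(Real.pi * b * ω) - 2 * Real.pi * b * ζ + Complex.I * Real.pi * b ^ 2)) =
    GM b ζ ω * (Complex.exp (-(Real.pi * b * ω)) +
      Complex.exp (Real.pi * b * ω - Complex.I * Real.pi * b ^ 2)) ∧
    Complex.exp (-(Real.pi * b * ω)) +
      Complex.exp (Real.pi * b * ω - Complex.I * Real.pi * b ^ 2) ≠ 0 := by
  have hbinv : b * b⁻¹ = 1 := mul_inv_cancel₀ hb.ne'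
  have hQb : Q b = b + b⁻¹ := rfl
  rw [hQb] at h1
  have hz1 : 2 * |(b * (ω - Complex.I * b / 2) : ℂ).im| < 1 := by
    have e : (b * (ω - Complex.I * b / 2) : ℂ).im = b * (ω.im - b / 2) := by
      rw [Complex.im_ofReal_mul]; simp
    have : |b * (ω.im - b / 2)| < 1 / 2 := by rw [abs_lt]; constructor <;> nlinarith
    rw [e]; linarith
  have hz2 : 2 * |(b * (ω + ζ - Complex.I * (Q b : ℂ) / 2 - Complex.I * b / 2) : ℂ).im| < 1 := by
    have e : (b * (ω + ζ - Complex.I * (Q b : ℂ) / 2 - Complex.I * b / 2) : ℂ).im =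
        b * (ω.im - Q b / 2 - b / 2) := by
      rw [Complex.im_ofReal_mul]; simp
    have : |b * (ω.im - Q b / 2 - b / 2)| < 1 / 2 := by
      rw [abs_lt, Q]; constructor <;> nlinarith
    rw [e]; linarith
  have f1 := sb_add hb hz1
  have f2 := sb_add hb hz2
  rw [sub_add_cancel] at f1 f2
  have a1 : ω - Complex.I * b / 2 - Complex.I * b / 2 = ω - Complex.I * b := by ring
  have a2 : ω + ζ - Complex.I * (Q b : ℂ) / 2 - Complex.I * b / 2 - Complex.I * b / 2 =
      ω - Complex.I * b + ζ - Complex.I * Q b / 2 := by ring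
  rw [a1] at f1
  rw [a2] at f2
  set u := Complex.exp (Real.pi * b * ω) with hu
  set z := Complex.exp (Real.pi * b * ζ) with hz
  set q := Complex.exp (Complex.I * Real.pi * b ^ 2 / 2) with hq
  have u0 : u ≠ 0 := Complex.exp_ne_zero _
  have z0 : z ≠ 0 := Complex.exp_ne_zero _
  have q0 : q ≠ 0 := Complex.exp_ne_zero _
  have c1 : 2 * Complex.cosh (Real.pi * (b * (ω - Complex.I * b / 2))) = u / q + q / u := by
    rw [Complex.cosh, hu, hq, ← Complex.exp_sub, ← Complex.exp_sub]; ring_nf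
  have c2 : 2 * Complex.cosh (Real.pi * (b * (ω + ζ - Complex.I * (Q b : ℂ) / 2 -
      Complex.I * b / 2))) =
      u * z / ((Complex.I * q) * q) + ((Complex.I * q) * q) / (u * z) := by
    have hq' := exp_quarter b hb
    rw [← hq] at hq'
    rw [← hq', Complex.cosh, hu, hz, hq, ← Complex.exp_add, ← Complex.exp_add, ← Complex.exp_sub,
      ← Complex.exp_sub]
    ring_nf
  have X1 : Complex.exp (Real.pi * b * ω - Complex.I * Real.pi * b ^ 2) = u / q ^ 2 := by
    rw [hu, hq, ← Complex.exp_nat_mul, ← Complex.exp_sub]; congr 1; push_cast; ring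
  have X2 : Complex.exp (-(Real.pi * b * ω) - 2 * Real.pi * b * ζ + Complex.I * Real.pi * b ^ 2) =
      q ^ 2 / (u * z ^ 2) := by
    rw [hu, hq, hz, ← Complex.exp_nat_mul, ← Complex.exp_nat_mul, ← Complex.exp_add,
      ← Complex.exp_sub]; congr 1; push_cast; ring
  have X3 : Complex.exp (-(Real.pi * b * ω)) = u⁻¹ := by rw [hu, ← Complex.exp_neg]
  have P : Complex.exp (Real.pi * ω * (Complex.I * ζ + Q b / 2)) =
      Complex.exp (Real.pi * (ω - Complex.I * b) * (Complex.I * ζ + Q b / 2)) *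
      ((Complex.I * q) / z) := by
    rw [hq, ← exp_quarter b hb, hz, ← Complex.exp_sub, ← Complex.exp_add]
    congr 1
    linear_combination (Real.pi * b * ζ) * Complex.I_sq
  rw [c1] at f1
  rw [c2] at f2
  have hc1 : u / q + q / u ≠ 0 := by
    intro h
    rw [h, zero_mul] at f1
    exact sb_ne_zero _ _ f1
  have hkb : u⁻¹ + u / q ^ 2 = (u / q + q / u) / q := by field_simp; ring
  rw [GM, GM, f1, f2, X1, X2, X3, P, hkb]
  refine ⟨?_, div_ne_zero hc1 q0⟩
  set S0 := sb b (ω - Complex.I * b)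
  have hS0 : S0 ≠ 0 := sb_ne_zero _ _
  generalize sb b (ω - Complex.I * b + ζ - Complex.I * Q b / 2) = S1
  generalize Complex.exp (Real.pi * (ω - Complex.I * b) * (Complex.I * ζ + Q b / 2)) = E
  have hc2 : u * z / ((Complex.I * q) * q) + ((Complex.I * q) * q) / (u * z) =
      -(Complex.I * z) * (u / q ^ 2 - q ^ 2 / (u * z ^ 2)) := by
    have : u * z / ((Complex.I * q) * q) = -(Complex.I * (u * z / (q * q))) := by
      rw [mul_assoc, div_mul_eq_div_div, div_eq_mul_inv, div_eq_mul_inv, mul_inv, Complex.inv_I]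
      ring
    rw [this]; field_simp; ring
  rw [hc2]
  generalize u / q ^ 2 - q ^ 2 / (u * z ^ 2) = D
  generalize u / q + q / u = D' at hc1
  field_simp
  linear_combination (E * S1 * D) * Complex.I_sq

/-- The quotient of the Fourier integral and its closed form. -/
noncomputable def RM (b ζ : ℝ) (ω : ℂ) : ℂ := FM b ζ (Q b / 4) ω / GM b ζ ω

lemma RM_periodic {b : ℝ} (hb : 0 < b) (hb1 : b < 1) (ζ : ℝ) {ω : ℂ} (h0 : b < ω.im)
    (h1 : ω.im < Q b / 2) : RM b ζ (ω - Complex.I * b) = RM b ζ ω := by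
  have hF := FM_difference hb hb1 ζ rfl h0 h1
  obtain ⟨hG, hk⟩ := GM_difference hb ζ h0 h1
  have n1 := GM_ne_zero b ζ ω
  have n2 := GM_ne_zero b ζ (ω - Complex.I * b)
  rw [RM, RM, div_eq_div_iff n2 n1]
  generalize Complex.exp (Real.pi * b * ω - Complex.I * Real.pi * b ^ 2) -
      Complex.exp (-(Real.pi * b * ω) - 2 * Real.pi * b * ζ + Complex.I * Real.pi * b ^ 2) = ka at *
  generalize Complex.exp (-(Real.pi * b * ω)) +
      Complex.exp (Real.pi * b * ω - Complex.I * Real.pi * b ^ 2) = kb at *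
  apply mul_right_cancel₀ hk
  have hka : ka ≠ 0 := by
    intro h
    rw [h, mul_zero] at hG
    exact mul_ne_zero n1 hk hG.symm
  apply mul_right_cancel₀ hka
  linear_combination GM b ζ ω * kb * hF - FM b ζ (Q b / 4) ω * kb * hG

lemma norm_inv_GM_le {b : ℝ} (hb : 0 < b) (ζ : ℝ) {y₁ y₂ : ℝ} (hy1 : 0 < y₁) (hy12 : y₁ ≤ y₂)
    (hy2 : y₂ < Q b / 2) :
    ∃ C, 0 < C ∧ ∀ ω : ℂ, y₁ ≤ ω.im → ω.im ≤ y₂ →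
      ‖GM b ζ ω‖⁻¹ ≤ C * Real.exp (Real.pi * (Q b / 2) * (|ω.re| - ω.re)) := by
  have hQ := Q_pos hb
  obtain ⟨A, hA0, hA⟩ := exists_norm_sb_bounds hb (η := y₂) (by linarith) (by linarith)
  obtain ⟨B, hB0, hB⟩ := exists_norm_sb_bounds hb (η := Q b / 2 - y₁) (by linarith) (by linarith)
  refine ⟨A * B * Real.exp (Real.pi * (Q b / 2) * (2 * |ζ|)), by positivity, fun ω h1 h2 => ?_⟩
  have a1 := (hA ω (by rw [abs_of_nonneg (by linarith)]; exact h2)).1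
  set w : ℂ := ω + ζ - Complex.I * Q b / 2 with hw
  have wim : w.im = ω.im - Q b / 2 := by simp [hw]
  have wre : w.re = ω.re + ζ := by simp [hw]
  have a2 := (hB w (by rw [wim, abs_of_nonpos (by linarith)]; linarith)).2
  rw [wim, wre] at a2
  have e : (Real.pi * ω * (Complex.I * ζ + Q b / 2)).re = Real.pi * (Q b / 2 * ω.re - ζ * ω.im) := by
    rw [mul_assoc, Complex.re_ofReal_mul]; simp; ring
  rw [GM, ← hw, norm_mul, norm_div, mul_inv, inv_div, Complex.norm_exp, e, ← Real.exp_neg,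
    div_eq_mul_inv ‖sb b ω‖]
  have k1 : ‖sb b ω‖ * ‖sb b w‖⁻¹ ≤ A * Real.exp (Real.pi * ω.im * |ω.re|) *
      (B * Real.exp (-(Real.pi * (ω.im - Q b / 2) * |ω.re + ζ|))) := by
    gcongr
  refine (mul_le_mul_of_nonneg_left k1 (Real.exp_pos _).le).trans ?_
  have k2 : Real.exp (-(Real.pi * (Q b / 2 * ω.re - ζ * ω.im))) *
      (A * Real.exp (Real.pi * ω.im * |ω.re|) *
      (B * Real.exp (-(Real.pi * (ω.im - Q b / 2) * |ω.re + ζ|)))) = A * B *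
      Real.exp (Real.pi * (-(Q b / 2 * ω.re - ζ * ω.im) + ω.im * |ω.re| +
        (Q b / 2 - ω.im) * |ω.re + ζ|)) := by
    rw [mul_add, mul_add, Real.exp_add, Real.exp_add]; ring_nf
  rw [k2, mul_assoc (A * B), ← Real.exp_add]
  gcongr
  rw [mul_assoc, mul_assoc, ← mul_add]
  refine mul_le_mul_of_nonneg_left ?_ Real.pi_pos.le
  have h3 : |ω.re + ζ| ≤ |ω.re| + |ζ| := abs_add_le _ _
  have h4 : ζ ≤ |ζ| := le_abs_self _
  have h5 := abs_nonneg ζ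
  have h6 : (Q b / 2 - ω.im) * |ω.re + ζ| ≤ (Q b / 2 - ω.im) * (|ω.re| + |ζ|) :=
    mul_le_mul_of_nonneg_left h3 (by linarith)
  have h7 : ζ * ω.im ≤ |ζ| * ω.im := mul_le_mul_of_nonneg_right h4 (by linarith)
  nlinarith

lemma differentiableAt_GM {b : ℝ} (hb : 0 < b) (ζ : ℝ) {ω : ℂ} (h0 : 0 < ω.im)
    (h1 : ω.im < Q b / 2) : DifferentiableAt ℂ (GM b ζ) ω := by
  have s1 : DifferentiableAt ℂ (sb b) ω :=
    (hasDerivAt_sb hb (by rw [abs_of_pos h0]; linarith)).differentiableAt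
  have s2 : DifferentiableAt ℂ (sb b) (ω + ζ - Complex.I * Q b / 2) := by
    refine (hasDerivAt_sb hb ?_).differentiableAt
    have : (ω + ζ - Complex.I * Q b / 2).im = ω.im - Q b / 2 := by simp
    rw [this, abs_of_nonpos (by linarith)]; linarith
  have s3 : DifferentiableAt ℂ (fun w : ℂ => sb b (w + ζ - Complex.I * Q b / 2)) ω :=
    DifferentiableAt.comp (f := fun w : ℂ => w + ζ - Complex.I * Q b / 2) ω s2 (by fun_prop)
  have s4 : DifferentiableAt ℂ (fun w : ℂ => Complex.exp (Real.pi * w * (Complex.I * ζ + Q b / 2))) ω := by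
    fun_prop
  exact s4.mul (s3.div s1 (sb_ne_zero _ _))

lemma differentiableAt_RM {b : ℝ} (hb : 0 < b) (ζ : ℝ) {ω : ℂ} (h0 : 0 < ω.im)
    (h1 : ω.im < Q b / 2) : DifferentiableAt ℂ (RM b ζ) ω :=
  have hQ := Q_pos hb
  (differentiableAt_FM hb ζ h0 h1 (by positivity) (by linarith)).div
    (differentiableAt_GM hb ζ h0 h1) (GM_ne_zero _ _ _)

lemma isOpen_halfstrip (b : ℝ) : IsOpen {z : ℂ | 0 < z.im ∧ z.im < b} :=
  (isOpen_lt continuous_const Complex.continuous_im).inter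
    (isOpen_lt Complex.continuous_im continuous_const)

lemma convex_halfstrip (b : ℝ) : Convex ℝ {z : ℂ | 0 < z.im ∧ z.im < b} :=
  (convex_halfSpace_im_gt 0).inter (convex_halfSpace_im_lt b)

/-- The strip is recentred at iQ/4. For b ≤ 1/2, half-height b fits inside 0 < Im ω < Q/2, and the
upper half lies above height b, where periodicity is known. The bounds for `FM` and for 1/`GM`
multiply to e^{πQ|Re ω|/2}, an admissible rate since bQ < 2. Constancy near iQ/4 then spreads by the
identity theorem. -/
lemma RM_const {b : ℝ} (hb : 0 < b) (hb1 : b ≤ 1 / 2) (ζ : ℝ) {ω : ℂ} (h0 : 0 < ω.im)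
    (h1 : ω.im < Q b / 2) : RM b ζ ω = RM b ζ (Complex.I * Q b / 4) := by
  have hQ := Q_pos hb
  have hbi : 2 ≤ b⁻¹ := by rw [le_inv_comm₀ (by norm_num) hb]; linarith
  have hQb : Q b = b + b⁻¹ := rfl
  have hbinv : b * b⁻¹ = 1 := mul_inv_cancel₀ hb.ne'
  have him : ∀ z : ℂ, (Complex.I * Q b / 4 + z).im = Q b / 4 + z.im := fun z => by
    simp
  have hre : ∀ z : ℂ, (Complex.I * Q b / 4 + z).re = z.re := fun z => by simp
  obtain ⟨C₁, hC₁⟩ := exists_norm_FM_le hb ζ (c := Q b / 4) (y₁ := Q b / 4 - b / 2)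
    (y₂ := Q b / 4 + b / 2) (by positivity) (by linarith) (by linarith) (by linarith)
  obtain ⟨C₂, hC₂0, hC₂⟩ := norm_inv_GM_le hb ζ (y₁ := Q b / 4 - b / 2)
    (y₂ := Q b / 4 + b / 2) (by linarith) (by linarith) (by linarith)
  have key := eq_zero_of_periodic_strip hb (f := fun z => RM b ζ (Complex.I * Q b / 4 + z))
    (C := C₁ * C₂) (κ := Real.pi * (Q b / 2)) ?_ ?_ (by positivity) ?_ ?_
  · have hd : AnalyticOnNhd ℂ (RM b ζ) {z : ℂ | 0 < z.im ∧ z.im < Q b / 2} :=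
      DifferentiableOn.analyticOnNhd (fun z hz =>
        (differentiableAt_RM hb ζ hz.1 hz.2).differentiableWithinAt) (isOpen_halfstrip _)
    have hz0 : Complex.I * Q b / 4 ∈ {z : ℂ | 0 < z.im ∧ z.im < Q b / 2} := by
      have := him 0
      simp only [add_zero, Complex.zero_im] at this
      refine ⟨?_, ?_⟩ <;> rw [this] <;> linarith
    refine AnalyticOnNhd.eqOn_of_preconnected_of_eventuallyEq hd analyticOnNhd_const
      (convex_halfstrip (Q b / 2)).isPreconnected hz0 ?_ ⟨h0, h1⟩
    have hev : ∀ᶠ z : ℂ in 𝓝 (Complex.I * Q b / 4), 2 * |(z - Complex.I * Q b / 4).im| < b := by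
      have hc : Continuous fun z : ℂ => 2 * |(z - Complex.I * Q b / 4).im| := by fun_prop
      refine hc.continuousAt.eventually_lt continuousAt_const ?_
      simpa using hb
    filter_upwards [hev] with z hz
    have := key (z - Complex.I * Q b / 4) (by linarith)
    simpa using this
  · intro z hz
    rw [abs_lt] at hz
    refine DifferentiableAt.comp (f := fun z => Complex.I * Q b / 4 + z) z
      (differentiableAt_RM hb ζ ?_ ?_) (by fun_prop) <;> rw [him] <;> linarith
  · intro z hz0 hz1
    have := RM_periodic hb (by linarith) ζ (ω := Complex.I * Q b / 4 + z)
      (by rw [him]; linarith) (by rw [him]; linarith)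
    rw [add_sub_assoc] at this
    exact this
  · rw [lt_div_iff₀ hb, mul_assoc]
    have : Q b / 2 * b < 1 := by rw [hQb]; nlinarith
    nlinarith [Real.pi_pos]
  · intro z hz
    rw [abs_le] at hz
    have b1 := hC₁ (Complex.I * Q b / 4 + z) (by rw [him]; linarith) (by rw [him]; linarith)
    have b2 := hC₂ (Complex.I * Q b / 4 + z) (by rw [him]; linarith) (by rw [him]; linarith)
    rw [hre] at b1 b2
    simp only [RM]
    rw [norm_div, div_eq_mul_inv]
    refine (mul_le_mul b1 b2 (by positivity) ((norm_nonneg _).trans b1)).trans (le_of_eq ?_)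
    rw [mul_mul_mul_comm, ← Real.exp_add]
    ring_nf

/-- The Gaussian behaviour of the two s_b cancels the exponential in `gM` up to e^{2πixζ} and a
constant. This oscillation is the source of the pole of `FM` at ω = −ζ. -/
lemma tendsto_gM_mul_exp {b : ℝ} (hb : 0 < b) (ζ : ℝ) {c : ℝ} (hc0 : 0 < c) (hc1 : c < Q b / 2) :
    Tendsto (fun x : ℝ => gM b ζ (x - Complex.I * c) *
      Complex.exp (-(2 * Real.pi * Complex.I * (x - Complex.I * c) * ζ))) atTop
      (𝓝 (Complex.exp (-(Complex.I * Real.pi / 2 * (ζ ^ 2 + Q b ^ 2 / 4))))) := by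
  have h := tendsto_Lam_sub hb (u := -(Complex.I * c) - ζ)
    (v := -(Complex.I * c) + Complex.I * Q b / 2)
    (by simp only [Complex.sub_im, Complex.neg_im, Complex.mul_im, Complex.I_re, Complex.I_im,
          Complex.ofReal_re, Complex.ofReal_im]
        rw [show -(0 * 0 + 1 * c) - 0 = -c by ring, abs_neg, abs_of_pos hc0]; linarith)
    (by have : (-(Complex.I * c) + Complex.I * Q b / 2 : ℂ).im = Q b / 2 - c := by simp; ring
        rw [this, abs_of_pos (by linarith)]; linarith)
  have h2 := ((h.const_mul Complex.I).cexp).const_mul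
    (Complex.exp (-(Complex.I * Real.pi / 2 * (ζ ^ 2 + Q b ^ 2 / 4))))
  rw [mul_zero, Complex.exp_zero, mul_one] at h2
  refine h2.congr fun x => ?_
  have e1 : (x : ℂ) + (-(Complex.I * c) - ζ) = x - Complex.I * c - ζ := by ring
  have e2 : (x : ℂ) + (-(Complex.I * c) + Complex.I * Q b / 2) =
    x - Complex.I * c + Complex.I * Q b / 2 := by ring
  rw [gM, sb_eq, sb_eq, e1, e2, ← Complex.exp_sub, ← Complex.exp_add, ← Complex.exp_add,
    ← Complex.exp_add]
  congr 1
  generalize Lam (kerS b) (x - Complex.I * c - ζ) = L₁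
  generalize Lam (kerS b) (x - Complex.I * c + Complex.I * Q b / 2) = L₂
  linear_combination (-(Complex.I * Real.pi * Q b ^ 2 / 8)) * Complex.I_sq

lemma norm_exp_line (x c ζ : ℝ) :
    ‖Complex.exp (-(2 * Real.pi * Complex.I * (x - Complex.I * c) * ζ))‖ =
      Real.exp (-(2 * Real.pi * c * ζ)) := by
  rw [Complex.norm_exp]
  congr 1
  have : -(2 * Real.pi * Complex.I * (x - Complex.I * c) * ζ) =
      ((-(2 * Real.pi * c * ζ) : ℝ) : ℂ) + ((-(2 * Real.pi * x * ζ) : ℝ) : ℂ) * Complex.I := by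
    push_cast
    linear_combination (2 * Real.pi * c * ζ) * Complex.I_sq
  rw [this]; simp

lemma mul_FM_eq (b ζ c : ℝ) {ε : ℝ} (hε : 0 < ε) :
    ε * FM b ζ c (-ζ + Complex.I * ε) = Complex.exp (2 * Real.pi * Complex.I * ε * c) *
      ∫ u : ℝ, gM b ζ ((u / ε : ℝ) - Complex.I * c) *
        Complex.exp (-(2 * Real.pi * Complex.I * ((u / ε : ℝ) - Complex.I * c) * ζ)) *
        Real.exp (-(2 * Real.pi * u)) := by
  have hsub := Measure.integral_comp_div (fun x : ℝ => gM b ζ (x - Complex.I * c) *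
        Complex.exp (-(2 * Real.pi * Complex.I * (x - Complex.I * c) * ζ)) *
        Real.exp (-(2 * Real.pi * (ε * x)))) ε
  have hcan : ∀ u : ℝ, ε * (u / ε) = u := fun u => by field_simp
  simp only [hcan] at hsub
  rw [hsub, abs_of_pos hε, Complex.real_smul, FM, ← integral_const_mul, ← integral_const_mul,
    ← integral_const_mul]
  refine integral_congr_ae (Eventually.of_forall fun x => ?_)
  simp only [hM]
  have : Complex.exp (2 * Real.pi * Complex.I * (x - Complex.I * c) * (-ζ + Complex.I * ε)) =
      Complex.exp (2 * Real.pi * Complex.I * ε * c) *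
      (Complex.exp (-(2 * Real.pi * Complex.I * (x - Complex.I * c) * ζ)) *
        Real.exp (-(2 * Real.pi * (ε * x)))) := by
    rw [Complex.ofReal_exp, ← Complex.exp_add, ← Complex.exp_add]
    congr 1
    push_cast
    linear_combination (2 * Real.pi * ε * (x - Complex.I * c)) * Complex.I_sq
  rw [this]; ring

/-- After the substitution u = εx the slowly varying factor tends to K for u > 0 and to 0 for u < 0,
which leaves K times the integral of e^{−2πu} over u > 0, that is K/(2π). -/
lemma tendsto_mul_FM {b : ℝ} (hb : 0 < b) (ζ : ℝ) {c : ℝ} (hc0 : 0 < c) (hc1 : c < Q b / 2) :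
    Tendsto (fun ε : ℝ => ε * FM b ζ c (-ζ + Complex.I * ε)) (𝓝[>] 0)
      (𝓝 (Complex.exp (-(Complex.I * Real.pi / 2 * (ζ ^ 2 + Q b ^ 2 / 4))) * (2 * (Real.pi : ℂ))⁻¹)) := by
  have hQ := Q_pos hb
  set K := Complex.exp (-(Complex.I * Real.pi / 2 * (ζ ^ 2 + Q b ^ 2 / 4)))
  set m : ℝ → ℂ := fun x => gM b ζ (x - Complex.I * c) *
      Complex.exp (-(2 * Real.pi * Complex.I * (x - Complex.I * c) * ζ)) with hm
  obtain ⟨C, hC0, hC⟩ := exists_norm_gM_le hb ζ hc0 le_rfl hc1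
  set C' := C * Real.exp (-(2 * Real.pi * c * ζ)) with hC'
  have hC'0 : 0 < C' := by positivity
  have him : ∀ x : ℝ, ((x : ℂ) - Complex.I * c).im = -c := fun x => by simp
  have hre : ∀ x : ℝ, ((x : ℂ) - Complex.I * c).re = x := fun x => by simp
  have hmb : ∀ x : ℝ, ‖m x‖ ≤ C' * Real.exp (Real.pi * (Q b / 2) * (x - |x|)) := by
    intro x
    have := hC (x - Complex.I * c) (by rw [him]) (by rw [him])
    rw [hre] at this
    rw [hm, norm_mul, norm_exp_line, hC', mul_right_comm C]
    exact mul_le_mul_of_nonneg_right this (Real.exp_pos _).le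
  have hmc : Continuous m := by
    have h1 : Continuous fun x : ℝ => gM b ζ (x - Complex.I * c) := by
      simp only [line_eq]
      exact continuous_line fun z hz => differentiableAt_gM hb ζ (by rw [hz]; linarith)
        (by rw [hz]; linarith)
    exact h1.mul (by fun_prop)
  have hint : ∫ u : ℝ, (Ioi (0 : ℝ)).indicator (fun u : ℝ => K * (Real.exp (-(2 * Real.pi * u)) : ℂ)) u =
      K * (2 * (Real.pi : ℂ))⁻¹ := by
    rw [integral_indicator measurableSet_Ioi, integral_const_mul, integral_complex_ofReal]
    have h := integral_exp_mul_Ioi (a := -(2 * Real.pi)) (by linarith [Real.pi_pos]) 0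
    simp only [neg_mul] at h
    rw [h]
    push_cast
    simp
  rw [← hint]
  have hD : Tendsto (fun ε : ℝ => ∫ u : ℝ, m (u / ε) * Real.exp (-(2 * Real.pi * u))) (𝓝[>] 0)
      (𝓝 (∫ u : ℝ, (Ioi (0 : ℝ)).indicator (fun u : ℝ => K * (Real.exp (-(2 * Real.pi * u)) : ℂ)) u)) := by
    refine tendsto_integral_filter_of_dominated_convergence
      (fun u => C' * Real.exp (-(2 * Real.pi * |u|))) ?_ ?_
      ((integrable_exp_neg_mul_abs (by positivity)).const_mul _) ?_
    · refine Eventually.of_forall fun ε => Continuous.aestronglyMeasurable ?_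
      exact (hmc.comp (by fun_prop)).mul (by fun_prop)
    · have h1 : ∀ᶠ ε : ℝ in 𝓝[>] 0, ε < Q b / 4 :=
        nhdsWithin_le_nhds (eventually_lt_nhds (by positivity))
      filter_upwards [h1, self_mem_nhdsWithin] with ε h1 h0
      have h0 : 0 < ε := h0
      refine Eventually.of_forall fun u => ?_
      rw [norm_mul, Complex.norm_real, Real.norm_eq_abs, Real.abs_exp]
      refine (mul_le_mul_of_nonneg_right (hmb _) (Real.exp_pos _).le).trans ?_
      rw [mul_assoc, ← Real.exp_add]
      gcongr
      rcases le_total 0 u with hu | hu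
      · rw [abs_of_nonneg hu, abs_of_nonneg (by positivity)]; simp
      · rw [abs_of_nonpos hu, abs_of_nonpos (div_nonpos_of_nonpos_of_nonneg hu h0.le)]
        have h2 : u / ε * Q b ≤ 4 * u := by
          rw [div_mul_eq_mul_div, div_le_iff₀ h0]
          nlinarith
        nlinarith [Real.pi_pos]
    · have hne : ∀ᵐ u : ℝ, u ≠ 0 := by
        simp [ae_iff, measure_singleton]
      filter_upwards [hne] with u hu
      rcases lt_or_gt_of_ne hu with hu | hu
      · rw [indicator_of_notMem (by simpa using hu.le)]
        have ht : Tendsto (fun ε : ℝ => u / ε) (𝓝[>] 0) atBot := by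
          simp only [div_eq_mul_inv]
          exact tendsto_inv_nhdsGT_zero.const_mul_atTop_of_neg hu
        have hm0 : Tendsto m atBot (𝓝 0) := by
          refine squeeze_zero_norm' (a := fun x : ℝ => C' * Real.exp (Real.pi * (Q b / 2) * (x - |x|)))
            (Eventually.of_forall hmb) ?_
          have h3 : Tendsto (fun x : ℝ => C' * Real.exp (Real.pi * Q b * x)) atBot (𝓝 0) := by
            have := (Real.tendsto_exp_atBot.comp (tendsto_id.const_mul_atBot
              (show 0 < Real.pi * Q b by positivity))).const_mul C'
            simpa using this
          refine h3.congr' ?_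
          filter_upwards [eventually_le_atBot 0] with x hx
          rw [abs_of_nonpos hx]; ring_nf
        simpa using (hm0.comp ht).mul_const ((Real.exp (-(2 * Real.pi * u)) : ℝ) : ℂ)
      · rw [indicator_of_mem (by exact hu)]
        have ht : Tendsto (fun ε : ℝ => u / ε) (𝓝[>] 0) atTop := by
          simp only [div_eq_mul_inv]
          exact tendsto_inv_nhdsGT_zero.const_mul_atTop hu
        exact ((tendsto_gM_mul_exp hb ζ hc0 hc1).comp ht).mul_const _
  have hE : Tendsto (fun ε : ℝ => Complex.exp (2 * Real.pi * Complex.I * ε * c)) (𝓝[>] 0) (𝓝 1) := by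
    have : Continuous fun ε : ℝ => Complex.exp (2 * Real.pi * Complex.I * ε * c) := by fun_prop
    have h := this.tendsto 0
    simp only [Complex.ofReal_zero, mul_zero, zero_mul, Complex.exp_zero] at h
    exact h.mono_left nhdsWithin_le_nhds
  have := hE.mul hD
  rw [one_mul] at this
  refine this.congr' ?_
  filter_upwards [self_mem_nhdsWithin] with ε hε
  rw [mul_FM_eq b ζ c hε]

/-- At ω = −ζ + iε the numerator of `GM` is s_b(−iQ/2 + iε), evaluated by `tendsto_sb_pole`; the
other factors are continuous there. -/
lemma tendsto_mul_GM {b : ℝ} (hb : 0 < b) (ζ : ℝ) :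
    Tendsto (fun ε : ℝ => ε * GM b ζ (-ζ + Complex.I * ε)) (𝓝[>] 0)
      (𝓝 (Complex.exp (-(Real.pi * ζ * (Complex.I * ζ + Q b / 2))) * sb b ζ * (2 * (Real.pi : ℂ))⁻¹)) := by
  have hQ := Q_pos hb
  have h1 := tendsto_sb_pole hb
  have c1 : ContinuousAt (fun ε : ℝ => Complex.exp (Real.pi * (-ζ + Complex.I * ε) *
      (Complex.I * ζ + Q b / 2))) 0 := by fun_prop
  have c2 : ContinuousAt (fun ε : ℝ => sb b (-ζ + Complex.I * ε)) 0 := by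
    have : ContinuousAt (sb b) (-ζ + Complex.I * (0 : ℝ)) :=
      (hasDerivAt_sb hb (by simpa using hQ)).continuousAt
    exact ContinuousAt.comp (f := fun ε : ℝ => (-ζ + Complex.I * ε : ℂ)) this (by fun_prop)
  have c3 := ((c1.div c2 (sb_ne_zero _ _)).tendsto.mono_left
    (nhdsWithin_le_nhds (s := Ioi 0))).mul (h1.mul_const (2 * (Real.pi : ℂ))⁻¹)
  have hs : (sb b (-ζ : ℂ))⁻¹ = sb b ζ := by rw [sb_neg, inv_inv]
  have hlim : (Complex.exp (Real.pi * (-ζ + Complex.I * (0 : ℝ)) * (Complex.I * ζ + Q b / 2)) /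
      sb b (-ζ + Complex.I * (0 : ℝ))) * (1 * (2 * (Real.pi : ℂ))⁻¹) =
      Complex.exp (-(Real.pi * ζ * (Complex.I * ζ + Q b / 2))) * sb b ζ * (2 * (Real.pi : ℂ))⁻¹ := by
    rw [Complex.ofReal_zero, mul_zero, add_zero, div_eq_mul_inv, hs, one_mul]
    congr 3; ring
  rw [← hlim]
  refine c3.congr fun ε => ?_
  have e1 : -(ζ : ℂ) + Complex.I * ε + ζ - Complex.I * Q b / 2 =
      -(Complex.I * Q b / 2) + Complex.I * ε := by ring
  simp only [GM, Pi.div_apply]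
  rw [e1]
  have hpi : (Real.pi : ℂ) ≠ 0 := by exact_mod_cast Real.pi_ne_zero
  generalize Complex.exp _ = E
  generalize sb b _ = S₁
  generalize sb b _ = S₂
  field_simp

/-- The Fourier integral in closed form. -/
lemma sb_mul_FM {b : ℝ} (hb : 0 < b) (hb1 : b ≤ 1 / 2) (ζ : ℝ) {ω : ℂ} (h0 : 0 < ω.im)
    (h1 : ω.im < Q b / 2) :
    sb b ζ * FM b ζ (Q b / 4) ω =
      Complex.exp (-(Complex.I * Real.pi / 2 * (ζ ^ 2 + Q b ^ 2 / 4)) +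
        Real.pi * ζ * (Complex.I * ζ + Q b / 2)) * GM b ζ ω := by
  have hQ := Q_pos hb
  set R := RM b ζ (Complex.I * Q b / 4) with hR
  have hFG : ∀ w : ℂ, 0 < w.im → w.im < Q b / 2 → FM b ζ (Q b / 4) w = R * GM b ζ w := by
    intro w hw0 hw1
    rw [hR, ← RM_const hb hb1 ζ hw0 hw1, RM, div_mul_cancel₀ _ (GM_ne_zero _ _ _)]
  -- The constant R is found by comparing the two simple poles at −ζ, approached from above.
  have t1 := tendsto_mul_FM hb ζ (c := Q b / 4) (by positivity) (by linarith)
  have t2 := (tendsto_mul_GM hb ζ).const_mul R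
  have hev : (fun ε : ℝ => R * (ε * GM b ζ (-ζ + Complex.I * ε))) =ᶠ[𝓝[>] 0]
      fun ε : ℝ => ε * FM b ζ (Q b / 4) (-ζ + Complex.I * ε) := by
    have h1 : ∀ᶠ ε : ℝ in 𝓝[>] 0, ε < Q b / 4 :=
      nhdsWithin_le_nhds (eventually_lt_nhds (by positivity))
    filter_upwards [h1, self_mem_nhdsWithin] with ε h1 h0
    have h0 : 0 < ε := h0
    have e : (-ζ + Complex.I * ε : ℂ).im = ε := by simp
    rw [hFG _ (by rw [e]; exact h0) (by rw [e]; linarith)]; ring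
  have heq := tendsto_nhds_unique t1 (t2.congr' hev)
  rw [hFG ω h0 h1, Complex.exp_add, ← mul_assoc]
  congr 1
  have hpi : (2 * (Real.pi : ℂ))⁻¹ ≠ 0 :=
    inv_ne_zero (mul_ne_zero two_ne_zero (by exact_mod_cast Real.pi_ne_zero))
  have h3 := mul_right_cancel₀ hpi (heq.trans (mul_assoc _ _ _).symm)
  rw [h3]
  linear_combination (-(R * sb b ζ)) *
    exp_mul_exp_neg (Real.pi * ζ * (Complex.I * ζ + Q b / 2))

/-! ### Semiclassical expansion of `s_b` -/

lemma div_sinh_le {t : ℝ} (ht : 0 < t) : t / Real.sinh t ≤ (1 + 2 * t) * Real.exp (-t) := by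
  rw [div_le_iff₀ (Real.sinh_pos_iff.2 ht), Real.sinh_eq]
  have h1 := Real.add_one_le_exp (2 * t)
  have h2 : Real.exp (-t) * Real.exp t = 1 := by rw [← Real.exp_add]; simp
  have h3 : Real.exp (2 * t) * Real.exp (-t) ^ 2 = 1 := by
    rw [← Real.exp_nat_mul, ← Real.exp_add]; norm_num
  have h4 : (1 + 2 * t) * Real.exp (-t) ^ 2 ≤ 1 := by
    rw [← h3]
    exact mul_le_mul_of_nonneg_right (by linarith) (by positivity)
  have : (1 + 2 * t) * Real.exp (-t) * ((Real.exp t - Real.exp (-t)) / 2) =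
    ((1 + 2 * t) * (Real.exp (-t) * Real.exp t) - (1 + 2 * t) * Real.exp (-t) ^ 2) / 2 := by ring
  rw [this, h2]
  linarith

lemma exists_norm_sin_div_sinh_le {z : ℂ} (hz : 2 * |z.im| < 1) :
    ∃ C δ : ℝ, 0 < δ ∧ ∀ t : ℝ, 0 < t →
      ‖Complex.sin (2 * t * z)‖ / (2 * Real.sinh t) ≤ C * Real.exp (-(δ * t)) := by
  set a := 1 - 2 * |z.im| with ha
  have ha0 : 0 < a := by rw [ha]; linarith
  refine ⟨‖z‖ * (1 + 4 / a), a / 2, by positivity, fun t ht => ?_⟩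
  have hs : 0 < Real.sinh t := Real.sinh_pos_iff.2 ht
  have h1 := norm_sin_le_mul_exp (2 * t * z)
  have h2 : |(2 * t * z : ℂ).im| = 2 * t * |z.im| := by
    rw [im_two_mul_ofReal, abs_mul, abs_of_pos (by positivity : 0 < 2 * t)]
  have h3 : ‖(2 * t * z : ℂ)‖ = 2 * t * ‖z‖ := by simp [abs_of_pos ht]
  rw [h2, h3] at h1
  have h4 : 1 + 2 * t ≤ (1 + 4 / a) * Real.exp (a / 2 * t) := by
    have h5 := Real.add_one_le_exp (a / 2 * t)
    have h6 : (1 + 4 / a) * (a / 2 * t + 1) = 1 + 2 * t + (4 / a + a / 2 * t) := by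
      field_simp; ring
    have h7 : 0 ≤ 4 / a + a / 2 * t := by positivity
    calc 1 + 2 * t ≤ (1 + 4 / a) * (a / 2 * t + 1) := by rw [h6]; linarith
      _ ≤ _ := mul_le_mul_of_nonneg_left h5 (by positivity)
  calc ‖Complex.sin (2 * t * z)‖ / (2 * Real.sinh t)
      ≤ 2 * t * ‖z‖ * Real.exp (2 * t * |z.im|) / (2 * Real.sinh t) := by gcongr
    _ = ‖z‖ * Real.exp (2 * t * |z.im|) * (t / Real.sinh t) := by field_simp
    _ ≤ ‖z‖ * Real.exp (2 * t * |z.im|) * ((1 + 4 / a) * Real.exp (a / 2 * t) * Real.exp (-t)) := by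
        refine mul_le_mul_of_nonneg_left ((div_sinh_le ht).trans ?_) (by positivity)
        gcongr
    _ = ‖z‖ * (1 + 4 / a) * Real.exp (-(a / 2 * t)) := by
        rw [mul_assoc (1 + 4 / a), mul_mul_mul_comm, ← Real.exp_add, ← Real.exp_add]
        congr 2
        rw [ha]; ring

lemma Lam_kerS_scale {b : ℝ} (hb : 0 < b) (w : ℂ) :
    Lam (kerS b) w = ∫ t in Ioi (0 : ℝ), (b : ℂ) * lam (kerS b) w (b * t) := by
  have h := integral_comp_mul_left_Ioi (fun t => lam (kerS b) w t) 0 hb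
  rw [mul_zero] at h
  rw [integral_const_mul, h, Complex.real_smul, Lam, ← mul_assoc, ← Complex.ofReal_mul,
    mul_inv_cancel₀ hb.ne', Complex.ofReal_one, one_mul]

/-- After rescaling t to bt the kernel is 1/(sinh t sinh b²t). In the first estimate 1/sinh(b²t) is
compared with its pole. In the second, sin(2tz − ib²t) splits into a sine term, where coth(b²t) is
compared with its pole, and a cosine term in which sinh(b²t) cancels, giving exactly the `Psi` term.
-/
lemma exists_norm_Lam_sub_le {z : ℂ} (hz : 2 * |z.im| < 1) :
    ∃ C : ℝ, ∀ b : ℝ, 0 < b →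
      ‖Lam (kerS b) (z / b) - Lam (kerOne 1) z / b ^ 2‖ ≤ C * b ^ 2 ∧
      ‖Lam (kerS b) (z / b - Complex.I * b / 2) -
        (Lam (kerOne 1) z / b ^ 2 - Complex.I / 2 * Psi (kerOne 1) z)‖ ≤ C * b ^ 2 := by
  obtain ⟨C, δ, hδ, hC⟩ := exists_norm_sin_div_sinh_le hz
  have hk := isKernel_kerOne one_pos
  refine ⟨∫ t in Ioi (0 : ℝ), C * Real.exp (-(δ * t)), fun b hb => ?_⟩
  have hb0 : (b : ℂ) ≠ 0 := by exact_mod_cast hb.ne'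
  have hint : IntegrableOn (fun t : ℝ => C * Real.exp (-(δ * t)) * b ^ 2) (Ioi 0) := by
    have := integrableOn_exp_neg hδ 0
    exact (this.const_mul C).mul_const _
  have hlam := (hk.integrableOn_lam hz).div_const ((b : ℂ) ^ 2)
  have hpsi := (hk.integrableOn_psi hz).const_mul (Complex.I / 2)
  have hscale : ∀ w : ℂ, 2 * |w.im| < Q b →
      IntegrableOn (fun t : ℝ => (b : ℂ) * lam (kerS b) w (b * t)) (Ioi 0) := by
    intro w hw
    have h := (isKernel_kerS hb).integrableOn_lam hw
    refine Integrable.const_mul ?_ _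
    have := (integrableOn_Ioi_comp_mul_left_iff (fun t => lam (kerS b) w t) 0 hb).2
    rw [mul_zero] at this
    exact this h
  have hQ : Q b = b + b⁻¹ := rfl
  have hzb : (z / b).im = z.im * b⁻¹ := by rw [Complex.div_ofReal_im]; rfl
  have hbi : 0 < b⁻¹ := inv_pos.2 hb
  have habs : 2 * |(z / b).im| < b⁻¹ := by
    rw [hzb, abs_mul, abs_of_pos hbi]; nlinarith
  have hI1 := hscale (z / b) (by rw [hQ]; linarith)
  have hI2 := hscale (z / b - Complex.I * b / 2) (by
    have e : (z / b - Complex.I * b / 2).im = (z / b).im - b / 2 := by simp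
    have h2 := abs_sub (z / b).im (b / 2)
    rw [abs_of_pos (show 0 < b / 2 by positivity)] at h2
    rw [e, hQ]; linarith)
  -- Both differences of integrands have this shape, with r the error of 1/sinh or coth at b²t
  -- against 1/(b²t).
  have hfac : ∀ t : ℝ, 0 < t → ∀ r : ℝ, |r| ≤ b ^ 2 * t →
      ‖Complex.sin (2 * t * z) / (2 * t * Real.sinh t) * (r : ℂ)‖ ≤ C * Real.exp (-(δ * t)) * b ^ 2 := by
    intro t ht r hr
    have hs : 0 < Real.sinh t := Real.sinh_pos_iff.2 ht
    rw [norm_mul, norm_div, Complex.norm_real, Real.norm_eq_abs]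
    have e : ‖(2 * t * Real.sinh t : ℂ)‖ = 2 * t * Real.sinh t := by
      simp [abs_of_pos ht, abs_of_pos hs, -Complex.ofReal_sinh]
    rw [e]
    calc _ ≤ ‖Complex.sin (2 * t * z)‖ / (2 * t * Real.sinh t) * (b ^ 2 * t) := by gcongr
      _ = ‖Complex.sin (2 * t * z)‖ / (2 * Real.sinh t) * b ^ 2 := by field_simp
      _ ≤ _ := by gcongr; exact hC t ht
  rw [← integral_mul_const]
  constructor
  · rw [Lam_kerS_scale hb, Lam, ← integral_div, ← integral_sub hI1 hlam]
    refine norm_integral_le_of_norm_le hint ?_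
    refine (ae_restrict_iff' measurableSet_Ioi).2 (ae_of_all _ fun t ht => ?_)
    have ht : 0 < t := ht
    have hbt : 0 < b ^ 2 * t := by positivity
    have hs : 0 < Real.sinh t := Real.sinh_pos_iff.2 ht
    have hs2 : 0 < Real.sinh (b ^ 2 * t) := Real.sinh_pos_iff.2 hbt
    obtain ⟨k1, k2⟩ := inv_sinh_bounds hbt
    refine le_trans (le_of_eq ?_) (hfac t ht (1 / Real.sinh (b ^ 2 * t) - 1 / (b ^ 2 * t)) ?_)
    · congr 1
      have a1 : b⁻¹ * (b * t) = t := by field_simp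
      have a2 : b * (b * t) = b ^ 2 * t := by ring
      have a3 : 2 * ((b * t : ℝ) : ℂ) * (z / b) = 2 * t * z := by push_cast; field_simp
      simp only [lam, kerS, kerOne, a1, a2, one_mul]
      rw [a3]
      have ht0 : (t : ℂ) ≠ 0 := by exact_mod_cast ht.ne'
      have hs0 : ((Real.sinh t : ℝ) : ℂ) ≠ 0 := by exact_mod_cast hs.ne'
      have hs20 : ((Real.sinh (b ^ 2 * t) : ℝ) : ℂ) ≠ 0 := by exact_mod_cast hs2.ne'
      push_cast [-Complex.ofReal_sinh]
      generalize ((Real.sinh t : ℝ) : ℂ) = s at *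
      generalize ((Real.sinh (b ^ 2 * t) : ℝ) : ℂ) = s' at *
      generalize Complex.sin (2 * t * z) = S
      field_simp
      ring
    · rw [abs_le]; constructor <;> linarith
  · have hd : IntegrableOn (fun t => lam (kerOne 1) z t / (b : ℂ) ^ 2 -
        Complex.I / 2 * psi (kerOne 1) z t) (Ioi 0) := hlam.sub hpsi
    rw [Lam_kerS_scale hb, Lam, Psi, ← integral_div, ← integral_const_mul,
      ← integral_sub hlam hpsi, ← integral_sub hI2 hd]
    refine norm_integral_le_of_norm_le hint ?_
    refine (ae_restrict_iff' measurableSet_Ioi).2 (ae_of_all _ fun t ht => ?_)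
    have ht : 0 < t := ht
    have hbt : 0 < b ^ 2 * t := by positivity
    have hs : 0 < Real.sinh t := Real.sinh_pos_iff.2 ht
    have hs2 : 0 < Real.sinh (b ^ 2 * t) := Real.sinh_pos_iff.2 hbt
    refine le_trans (le_of_eq ?_) (hfac t ht
      (Real.cosh (b ^ 2 * t) / Real.sinh (b ^ 2 * t) - 1 / (b ^ 2 * t)) (abs_coth_sub_le hbt))
    congr 1
    have a1 : b⁻¹ * (b * t) = t := by field_simp
    have a2 : b * (b * t) = b ^ 2 * t := by ring
    have a3 : 2 * ((b * t : ℝ) : ℂ) * (z / b - Complex.I * b / 2) =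
        2 * t * z - ((b ^ 2 * t : ℝ) : ℂ) * Complex.I := by push_cast; field_simp
    simp only [lam, psi, kerS, kerOne, a1, a2, one_mul]
    rw [a3, Complex.sin_sub, Complex.sin_mul_I, Complex.cos_mul_I, ← Complex.ofReal_cosh,
      ← Complex.ofReal_sinh]
    have ht0 : (t : ℂ) ≠ 0 := by exact_mod_cast ht.ne'
    have hs0 : ((Real.sinh t : ℝ) : ℂ) ≠ 0 := by exact_mod_cast hs.ne'
    have hs20 : ((Real.sinh (b ^ 2 * t) : ℝ) : ℂ) ≠ 0 := by exact_mod_cast hs2.ne'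
    push_cast [-Complex.ofReal_sinh, -Complex.ofReal_cosh]
    generalize ((Real.sinh t : ℝ) : ℂ) = s at *
    generalize ((Real.sinh (b ^ 2 * t) : ℝ) : ℂ) = s' at *
    generalize ((Real.cosh (b ^ 2 * t) : ℝ) : ℂ) = c'
    generalize Complex.sin (2 * t * z) = S
    generalize Complex.cos (2 * t * z) = c
    field_simp
    ring

/-- The leading exponent in the semiclassical expansion. -/
noncomputable def expB (ζ ω : ℂ) : ℂ :=
  Complex.I * Real.pi * ζ ^ 2 / 2 + Complex.I * Real.pi * ω * ζ - Complex.I * Real.pi / 8 +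
    Real.pi * (ζ + ω) / 2 + Complex.I * Lam (kerOne 1) (ζ + ω - Complex.I / 2) -
    Complex.I * Lam (kerOne 1) ω

/-- The subleading exponent in the semiclassical expansion. -/
noncomputable def expP (ζ ω : ℂ) : ℂ :=
  Real.pi * (ζ + ω) / 2 - Complex.I * Real.pi / 4 - logCosh (ζ + ω - Complex.I / 2) / 2

/-! ### Contour independence and the small-`b` expansion of `M` -/

lemma M_eq_FM (b ζ : ℝ) (ω : ℂ) : M b ζ ω = sb b ζ * FM b ζ (Q b / 4) ω := by
  rw [M, FM]
  simp only [integrandM_eq]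
  congr 2
  ext x
  congr 1
  push_cast; ring

lemma M_integral {ζ : ℝ} {ω : ℂ} (h0 : 0 < ω.im) (h1 : ω.im < 1 / 2) {b : ℝ} (hb : 0 < b) {c : ℝ}
    (hc0 : 0 < c) (hc1 : c < Q b / 2) :
    Integrable (fun x : ℝ => integrandM b ((ζ : ℂ) / b) (ω / b) ((x : ℂ) - Complex.I * c)) ∧
    M b ((ζ : ℂ) / b) (ω / b) = sb b ((ζ : ℂ) / b) * ∫ x : ℝ,
      integrandM b ((ζ : ℂ) / b) (ω / b) ((x : ℂ) - Complex.I * c) := by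
  have hQ := Q_pos hb
  have hbi : 0 < b⁻¹ := inv_pos.2 hb
  have him : (ω / b).im = ω.im * b⁻¹ := by rw [Complex.div_ofReal_im]; rfl
  have w0 : 0 < (ω / b).im := by rw [him]; positivity
  have w1 : (ω / b).im < Q b / 2 := by rw [him, Q]; nlinarith
  have e : (ζ : ℂ) / b = ((ζ / b : ℝ) : ℂ) := by push_cast; rfl
  rw [e]
  constructor
  · simp only [integrandM_eq]
    exact integrable_hM hb _ w0 w1 hc0 hc1
  · rw [M_eq_FM, FM_eq hb _ w0 w1 (by positivity) (by linarith) hc0 hc1, FM]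
    simp only [integrandM_eq]

lemma im_lt_of_strip {ζ : ℝ} {ω : ℂ} (h0 : 0 < ω.im) (h1 : ω.im < 1 / 2) :
    2 * |(ζ + ω - Complex.I / 2 : ℂ).im| < 1 := by
  have : (ζ + ω - Complex.I / 2 : ℂ).im = ω.im - 1 / 2 := by simp
  rw [this, abs_of_neg (by linarith)]; linarith

/-- Semiclassical expansion of `𝓜`, with the exponents `expB` and `expP`. -/
lemma exists_M_eq_exp {ζ : ℝ} {ω : ℂ} (h0 : 0 < ω.im) (h1 : ω.im < 1 / 2) :
    ∃ (C : ℝ) (R : ℝ → ℂ), ∀ b : ℝ, 0 < b → b ≤ 1 / 2 → ‖R b‖ ≤ C * b ^ 2 ∧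
      M b ((ζ : ℂ) / b) (ω / b) =
        Complex.exp (expB ζ ω / b ^ 2) * Complex.exp (expP ζ ω) * Complex.exp (R b) := by
  have hz := im_lt_of_strip (ζ := ζ) h0 h1
  have hω : 2 * |ω.im| < 1 := by rw [abs_of_pos h0]; linarith
  obtain ⟨C₁, hC₁⟩ := exists_norm_Lam_sub_le hz
  obtain ⟨C₂, hC₂⟩ := exists_norm_Lam_sub_le hω
  set z : ℂ := ζ + ω - Complex.I / 2 with hzdef
  -- Since Q² = b² + 2 + b⁻², the constant −iπQ²/8 of the closed form splits over three orders:
  -- −iπ/8 in `expB`, −iπ/4 in `expP`, and −iπb²/8 in this remainder.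
  refine ⟨Real.pi / 8 + C₁ + C₂, fun b => -(Complex.I * Real.pi * b ^ 2 / 8) +
    Complex.I * (Lam (kerS b) (z / b - Complex.I * b / 2) -
        (Lam (kerOne 1) z / b ^ 2 - Complex.I / 2 * Psi (kerOne 1) z)) -
    Complex.I * (Lam (kerS b) (ω / b) - Lam (kerOne 1) ω / b ^ 2), fun b hb hb1 => ⟨?_, ?_⟩⟩
  · have n1 : ‖(-(Complex.I * Real.pi * b ^ 2 / 8) : ℂ)‖ = Real.pi / 8 * b ^ 2 := by
      simp [abs_of_pos Real.pi_pos]; ring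
    have n2 := (hC₁ b hb).2
    have n3 := (hC₂ b hb).1
    refine (norm_sub_le _ _).trans ?_
    refine (add_le_add (norm_add_le _ _) le_rfl).trans ?_
    rw [n1, norm_mul, norm_mul, Complex.norm_I, one_mul, one_mul]
    linarith
  · have hbi : 0 < b⁻¹ := inv_pos.2 hb
    have hb0 : (b : ℂ) ≠ 0 := by exact_mod_cast hb.ne'
    have him : (ω / b).im = ω.im * b⁻¹ := by rw [Complex.div_ofReal_im]; rfl
    have w0 : 0 < (ω / b).im := by rw [him]; positivity
    have w1 : (ω / b).im < Q b / 2 := by rw [him, Q]; nlinarith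
    have e : (ζ : ℂ) / b = ((ζ / b : ℝ) : ℂ) := by push_cast; rfl
    -- iQ/2 = i/(2b) + ib/2: the first part enters z/b as the −i/2 in z, the second remains as the
    -- small shift.
    have e2 : ω / b + (ζ / b : ℝ) - Complex.I * Q b / 2 = z / b - Complex.I * b / 2 := by
      rw [hzdef, Q]; push_cast; field_simp; ring
    rw [e, M_eq_FM, sb_mul_FM hb hb1 _ w0 w1, GM, e2, sb_eq, sb_eq, ← Complex.exp_sub,
      ← Complex.exp_add, ← Complex.exp_add, ← Complex.exp_add, ← Complex.exp_add]
    congr 1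
    beta_reduce
    rw [Psi_kerOne_one hz, expB, expP, ← hzdef, Q]
    generalize Lam (kerS b) (z / b - Complex.I * b / 2) = L₁
    generalize Lam (kerS b) (ω / b) = L₂
    generalize Lam (kerOne 1) z = I₁
    generalize Lam (kerOne 1) ω = I₂
    generalize logCosh z = A
    push_cast
    field_simp
    linear_combination (32 * A * b ^ 2) * Complex.I_sq

/-! ### The prefactor -/

/-- With w = π(ζ + ω), (coth w + 1)/2 is the inverse of 1 − e^{−2w}, and `logCosh_sub_eq` gives
log(1 − e^{−2w}) = −2 expP. The imaginary part of 1 − e^{−2w} is positive, so the inverse meets no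
cut and the square root is principal. -/
lemma exp_expP {ζ : ℝ} {ω : ℂ} (h0 : 0 < ω.im) (h1 : ω.im < 1 / 2) :
    ((coth (Real.pi * ((ζ : ℂ) + ω)) + 1) / 2) ^ (1 / 2 : ℂ) = Complex.exp (expP ζ ω) := by
  have hz := im_lt_of_strip (ζ := ζ) h0 h1
  have hl := logCosh_sub_eq hz
  set w : ℂ := Real.pi * ((ζ : ℂ) + ω) with hw
  have hwim : w.im = Real.pi * ω.im := by rw [hw, Complex.im_ofReal_mul]; simp
  have e1 : Complex.exp (-(2 * Real.pi * (ζ + ω - Complex.I / 2))) = -Complex.exp (-(2 * w)) := by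
    rw [show -(2 * Real.pi * (ζ + ω - Complex.I / 2)) = -(2 * w) + Real.pi * Complex.I by
      rw [hw]; ring, Complex.exp_add, Complex.exp_pi_mul_I, mul_neg, mul_one]
  rw [e1, ← sub_eq_add_neg] at hl
  have him : 0 < (1 - Complex.exp (-(2 * w))).im := by
    have : (-(2 * w)).im = -(2 * Real.pi * ω.im) := by
      rw [Complex.neg_im, ← Complex.ofReal_ofNat 2, Complex.im_ofReal_mul, hwim]; ring
    rw [Complex.sub_im, Complex.exp_im, this, Real.sin_neg, Complex.one_im]
    have : 0 < Real.sin (2 * Real.pi * ω.im) :=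
      Real.sin_pos_of_pos_of_lt_pi (by positivity) (by nlinarith [Real.pi_pos])
    have h3 := mul_pos (Real.exp_pos (-(2 * w)).re) this
    linarith
  have hY : 1 - Complex.exp (-(2 * w)) ≠ 0 := fun h => by rw [h] at him; simp at him
  have harg : (1 - Complex.exp (-(2 * w))).arg ≠ Real.pi := fun h => by
    have := (Complex.arg_eq_pi_iff.1 h).2
    linarith
  have hX : (coth w + 1) / 2 = (1 - Complex.exp (-(2 * w)))⁻¹ := by
    have h4 : Complex.exp (-(2 * w)) = (Complex.exp w ^ 2)⁻¹ := by
      rw [← Complex.exp_nat_mul, ← Complex.exp_neg]; congr 1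
    rw [h4] at hY ⊢
    rw [coth, Complex.cosh, Complex.sinh, Complex.exp_neg]
    have h5 := Complex.exp_ne_zero w
    generalize Complex.exp w = u at *
    have h6 : u ^ 2 - 1 ≠ 0 := by
      intro h
      apply hY
      rw [sub_eq_zero.1 h]; simp
    have h7 : u - u⁻¹ ≠ 0 := by
      intro h
      apply h6
      field_simp at h
      linear_combination h
    field_simp
    ring
  have hXlog : Complex.log ((coth w + 1) / 2) = 2 * expP ζ ω := by
    rw [hX, Complex.log_inv _ harg, ← hl, expP]
    ring
  rw [Complex.cpow_def_of_ne_zero (by rw [hX]; exact inv_ne_zero hY), hXlog]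
  congr 1; ring

/-- E is defined as quotient minus 1 for every b > 0, so the identity is automatic and the
expansion, available for b ≤ 1/2, is needed only near 0. There E = e^R − 1 with R = O(b²). -/
lemma M_asymptotics {ζ : ℝ} {ω : ℂ} (h0 : 0 < ω.im) (h1 : ω.im < 1 / 2) :
    ∃ E : ℝ → ℂ, E =O[𝓝[>] 0] (fun b : ℝ => b) ∧ ∀ b : ℝ, 0 < b →
      M b ((ζ : ℂ) / b) (ω / b) = ((coth (Real.pi * ((ζ : ℂ) + ω)) + 1) / 2) ^ (1 / 2 : ℂ) *
        Complex.exp (expB ζ ω / (b : ℂ) ^ 2) * (1 + E b) := by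
  obtain ⟨C, R, hR⟩ := exists_M_eq_exp (ζ := ζ) h0 h1
  rw [exp_expP h0 h1]
  refine ⟨fun b => M b ((ζ : ℂ) / b) (ω / b) /
    (Complex.exp (expP ζ ω) * Complex.exp (expB ζ ω / (b : ℂ) ^ 2)) - 1, ?_, fun b _ => ?_⟩
  · have hC0 : 0 ≤ C := by
      have := (norm_nonneg _).trans (hR (1 / 2) (by norm_num) le_rfl).1
      linarith
    refine Asymptotics.IsBigO.of_bound (2 * C) ?_
    have hs : ∀ᶠ b : ℝ in 𝓝[>] 0, b < min (1 / 2) (1 / (C + 1)) :=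
      nhdsWithin_le_nhds (eventually_lt_nhds (by positivity))
    filter_upwards [hs, self_mem_nhdsWithin] with b hb1 hb
    have hb : 0 < b := hb
    have hb2 : b ≤ 1 / 2 := (hb1.trans_le (min_le_left _ _)).le
    have hb3 : b * (C + 1) ≤ 1 := by
      rw [← le_div_iff₀ (by positivity)]; exact (hb1.trans_le (min_le_right _ _)).le
    obtain ⟨n1, n2⟩ := hR b hb hb2
    have e : M b ((ζ : ℂ) / b) (ω / b) /
        (Complex.exp (expP ζ ω) * Complex.exp (expB ζ ω / (b : ℂ) ^ 2)) = Complex.exp (R b) := by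
      rw [n2, mul_comm (Complex.exp (expP ζ ω)), mul_div_assoc, mul_div_cancel₀]
      exact mul_ne_zero (Complex.exp_ne_zero _) (Complex.exp_ne_zero _)
    have n3 : C * b ^ 2 ≤ C * b := by nlinarith [mul_nonneg hC0 hb.le]
    have n4 := Complex.norm_exp_sub_one_le (x := R b) (by nlinarith)
    rw [e, Real.norm_eq_abs, abs_of_pos hb]
    linarith
  · rw [add_sub_cancel, mul_div_cancel₀]
    exact mul_ne_zero (Complex.exp_ne_zero _) (Complex.exp_ne_zero _)

/-! ### Radial primitives -/

/-- The primitive of a holomorphic function along rays from the origin. -/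
noncomputable def radialPrim (f : ℂ → ℂ) (z : ℂ) : ℂ := ∫ t in (0 : ℝ)..1, z * f (t * z)

lemma radialPrim_zero (f : ℂ → ℂ) : radialPrim f 0 = 0 := by simp [radialPrim]

/-- The `z`-derivative of z f(tz) is the `t`-derivative of t f(tz), whose integral over [0, 1] is
f(z). Star-shapedness about 0 keeps the rays inside U. -/
lemma hasDerivAt_radialPrim {f : ℂ → ℂ} {U : Set ℂ} (hU : IsOpen U)
    (hs : ∀ z ∈ U, ∀ t : ℝ, 0 ≤ t → t ≤ 1 → (t : ℂ) * z ∈ U) (hf : DifferentiableOn ℂ f U) {z : ℂ}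
    (hz : z ∈ U) : HasDerivAt (radialPrim f) (f z) z := by
  obtain ⟨r, hr, hrU⟩ := Metric.nhds_basis_closedBall.mem_iff.1 (hU.mem_nhds hz)
  have hdf : DifferentiableOn ℂ (deriv f) U := hf.deriv hU
  have hfd : ∀ w ∈ U, HasDerivAt f (deriv f w) w := fun w hw =>
    (hf.differentiableAt (hU.mem_nhds hw)).hasDerivAt
  set F' : ℂ → ℝ → ℂ := fun w t => f (t * w) + w * (t * deriv f (t * w)) with hF'
  have hmaps : MapsTo (fun p : ℂ × ℝ => (p.2 : ℂ) * p.1) (Metric.closedBall z r ×ˢ Icc 0 1) U :=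
    fun p hp => hs _ (hrU hp.1) _ hp.2.1 hp.2.2
  have hc0 : ContinuousOn (fun p : ℂ × ℝ => (p.2 : ℂ) * p.1) (Metric.closedBall z r ×ˢ Icc 0 1) := by
    fun_prop
  have hcf : ContinuousOn (fun p : ℂ × ℝ => f (p.2 * p.1)) (Metric.closedBall z r ×ˢ Icc 0 1) :=
    hf.continuousOn.comp hc0 hmaps
  have hcd : ContinuousOn (fun p : ℂ × ℝ => deriv f (p.2 * p.1))
      (Metric.closedBall z r ×ˢ Icc 0 1) := hdf.continuousOn.comp hc0 hmaps
  have hcF' : ContinuousOn (fun p : ℂ × ℝ => F' p.1 p.2) (Metric.closedBall z r ×ˢ Icc 0 1) := by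
    exact hcf.add (continuousOn_fst.mul
      ((Complex.continuous_ofReal.comp_continuousOn continuousOn_snd).mul hcd))
  obtain ⟨C, hC⟩ := ((isCompact_closedBall z r).prod isCompact_Icc).exists_bound_of_continuousOn hcF'
  have hslice : ∀ w ∈ Metric.closedBall z r, ContinuousOn (fun t : ℝ => ((w, t) : ℂ × ℝ)) (Icc 0 1) ∧
      MapsTo (fun t : ℝ => ((w, t) : ℂ × ℝ)) (Icc 0 1) (Metric.closedBall z r ×ˢ Icc 0 1) :=
    fun w hw => ⟨by fun_prop, fun t ht => ⟨hw, ht⟩⟩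
  have hcF : ∀ w ∈ Metric.closedBall z r, ContinuousOn (fun t : ℝ => w * f (t * w)) (Icc 0 1) :=
    fun w hw => continuousOn_const.mul (hcf.comp (hslice w hw).1 (hslice w hw).2)
  have hzb : z ∈ Metric.closedBall z r := Metric.mem_closedBall_self hr.le
  have hcF'z : ContinuousOn (F' z) (Icc 0 1) := hcF'.comp (hslice z hzb).1 (hslice z hzb).2
  have huI : Set.uIoc (0 : ℝ) 1 = Ioc 0 1 := uIoc_of_le zero_le_one
  have hmeas : ∀ g : ℝ → ℂ, ContinuousOn g (Icc 0 1) →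
      AEStronglyMeasurable g (volume.restrict (Set.uIoc (0 : ℝ) 1)) := fun g hg => by
    rw [huI]; exact (hg.mono Ioc_subset_Icc_self).aestronglyMeasurable measurableSet_Ioc
  have hmem : ∀ w ∈ Metric.closedBall z r, ∀ t ∈ Icc (0 : ℝ) 1, (t : ℂ) * w ∈ U :=
    fun w hw t ht => hs _ (hrU hw) _ ht.1 ht.2
  have hint : ∫ t in (0 : ℝ)..1, F' z t = f z := by
    have h := intervalIntegral.integral_eq_sub_of_hasDerivAt (a := 0) (b := 1)
      (f := fun t : ℝ => (t : ℂ) * f (t * z)) (f' := F' z) ?_ ?_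
    · rw [h]; simp
    · intro t ht
      rw [uIcc_of_le zero_le_one] at ht
      have h1 : HasDerivAt (fun t : ℝ => (t : ℂ) * z) (1 * z) t :=
        (Complex.ofRealCLM.hasDerivAt (x := t)).mul_const z
      have h2 := (hfd _ (hmem z hzb t ht)).comp t h1
      have h3 := (Complex.ofRealCLM.hasDerivAt (x := t)).mul h2
      refine h3.congr_deriv ?_
      simp [hF']; ring
    · refine ContinuousOn.intervalIntegrable ?_
      rwa [uIcc_of_le zero_le_one]
  rw [← hint]
  refine (intervalIntegral.hasDerivAt_integral_of_dominated_loc_of_deriv_le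
    (F := fun w t => w * f (t * w)) (bound := fun _ => C)
    (Metric.closedBall_mem_nhds z hr) ?_ ?_ (hmeas _ hcF'z) ?_ ?_ ?_).2
  · filter_upwards [Metric.closedBall_mem_nhds z hr] with w hw using hmeas _ (hcF w hw)
  · refine ContinuousOn.intervalIntegrable ?_
    rw [uIcc_of_le zero_le_one]; exact hcF z hzb
  · refine Eventually.of_forall fun t ht w hw => ?_
    rw [huI] at ht
    exact hC (w, t) ⟨hw, Ioc_subset_Icc_self ht⟩
  · exact intervalIntegrable_const
  · refine Eventually.of_forall fun t ht w hw => ?_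
    rw [huI] at ht
    have h1 : HasDerivAt (fun w : ℂ => (t : ℂ) * w) (t * 1) w := (hasDerivAt_id w).const_mul _
    have h2 := (hfd _ (hmem w hw t (Ioc_subset_Icc_self ht))).comp w h1
    refine ((hasDerivAt_id w).mul h2).congr_deriv ?_
    simp only [hF', Function.comp_apply, id_eq]; ring

/-! ### The dilogarithm -/

lemma isOpen_dilog_domain : IsOpen {z : ℂ | 1 - z ∈ Complex.slitPlane} :=
  Complex.isOpen_slitPlane.preimage (by fun_prop : Continuous fun z : ℂ => 1 - z)

lemma star_slitPlane {z : ℂ} (hz : z ∈ Complex.slitPlane) {t : ℝ} (h0 : 0 ≤ t) (h1 : t ≤ 1) :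
    (1 - t : ℂ) + t * z ∈ Complex.slitPlane := by
  have h := Complex.starConvex_one_slitPlane hz (a := 1 - t) (b := t) (by linarith) h0 (by ring)
  simpa using h

/-- The slope of log(1 − u) at 0 fills in the removable singularity of log(1 − u)/u, so that radial
primitives apply. -/
lemma dilog_eq (z : ℂ) :
    dilog z = radialPrim (fun w => -dslope (fun u => Complex.log (1 - u)) 0 w) z := by
  rw [dilog, radialPrim, ← intervalIntegral.integral_neg]
  refine intervalIntegral.integral_congr_ae (Eventually.of_forall fun t ht => ?_)
  rw [uIoc_of_le zero_le_one] at ht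
  have ht0 : (t : ℂ) ≠ 0 := by exact_mod_cast ht.1.ne'
  by_cases hz : z = 0
  · simp [hz]
  · rw [dslope_of_ne _ (mul_ne_zero ht0 hz), slope_def_field]
    simp
    field_simp

lemma hasDerivAt_dilog_dslope {z : ℂ} (hz : 1 - z ∈ Complex.slitPlane) :
    HasDerivAt dilog (-dslope (fun u => Complex.log (1 - u)) 0 z) z := by
  have hd : DifferentiableOn ℂ (fun w => -dslope (fun u : ℂ => Complex.log (1 - u)) 0 w)
      {z : ℂ | 1 - z ∈ Complex.slitPlane} := by
    refine DifferentiableOn.neg ?_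
    rw [Complex.differentiableOn_dslope (isOpen_dilog_domain.mem_nhds (by simp))]
    intro w hw
    exact ((DifferentiableAt.clog (by fun_prop) hw)).differentiableWithinAt
  have h := hasDerivAt_radialPrim isOpen_dilog_domain (fun z hz t h0 h1 => by
    have := star_slitPlane hz h0 h1
    change 1 - (t : ℂ) * z ∈ Complex.slitPlane
    convert this using 1; ring) hd hz
  rwa [← funext dilog_eq] at h

lemma hasDerivAt_dilog {z : ℂ} (hz : 1 - z ∈ Complex.slitPlane) (h0 : z ≠ 0) :
    HasDerivAt dilog (-(Complex.log (1 - z) / z)) z := by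
  refine (hasDerivAt_dilog_dslope hz).congr_deriv ?_
  rw [dslope_of_ne _ h0, slope_def_field]
  simp

lemma dilog_zero : dilog 0 = 0 := by rw [dilog_eq, radialPrim_zero]

lemma continuousAt_dilog {z : ℂ} (hz : 1 - z ∈ Complex.slitPlane) : ContinuousAt dilog z :=
  (hasDerivAt_dilog_dslope hz).continuousAt

/-- Fourier series of the second Bernoulli polynomial at 1/2, where its value is −1/12. -/
lemma hasSum_alternating_inv_sq :
    HasSum (fun n : ℕ => (-1 : ℝ) ^ n / (n : ℝ) ^ 2) (-(Real.pi ^ 2 / 12)) := by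
  have h := hasSum_one_div_nat_pow_mul_cos one_ne_zero (x := 1 / 2) (by norm_num)
  have hb : (Polynomial.map (algebraMap ℚ ℝ) (Polynomial.bernoulli (2 * 1))).eval (1 / 2) = -(1 / 12) := by
    simp [Polynomial.bernoulli, Finset.sum_range_succ, Polynomial.eval_add, bernoulli_one,
      bernoulli_two]
    norm_num
  rw [hb] at h
  convert h using 1
  · ext n
    rw [show 2 * Real.pi * n * (1 / 2) = n * Real.pi by ring, Real.cos_nat_mul_pi]
    simp; ring
  · norm_num; ring

lemma dilog_neg_one : dilog (-1) = -(Real.pi ^ 2 / 12) := by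
  -- The term n = 0 is zero because of the division by 0; the truncated n − 1 is then harmless and
  -- the series effectively starts at n = 1.
  set F : ℕ → ℝ → ℝ := fun n t => (-1) ^ n / n * t ^ (n - 1) with hF
  have hint : ∀ n, ∀ g : ℝ, ∫ t in Ioc (0 : ℝ) 1, g * t ^ (n - 1) = g / ((n - 1 : ℕ) + 1) := by
    intro n g
    rw [← intervalIntegral.integral_of_le zero_le_one, intervalIntegral.integral_const_mul,
      integral_pow]
    simp; ring
  have hval : ∀ n : ℕ, (-1 : ℝ) ^ n / n / ((n - 1 : ℕ) + 1) = (-1) ^ n / (n : ℝ) ^ 2 := by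
    intro n
    rcases n with _ | n
    · simp
    · rw [Nat.add_sub_cancel]; push_cast; field_simp
  have hsum := hasSum_integral_of_summable_integral_norm (μ := volume.restrict (Ioc (0 : ℝ) 1))
    (F := F) (fun n => ?_) ?_
  · simp only [hF, hint, hval] at hsum
    have h1 := hsum.unique hasSum_alternating_inv_sq
    have h2 : ∫ t in Ioc (0 : ℝ) 1, ∑' n, F n t = ∫ t in Ioc (0 : ℝ) 1, -(Real.log (1 + t) / t) := by
      refine integral_congr_ae ?_
      have hne : ∀ᵐ t : ℝ ∂(volume.restrict (Ioc (0 : ℝ) 1)), t ≠ 1 :=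
        ae_restrict_of_ae (by simp [ae_iff, measure_singleton])
      filter_upwards [hne, ae_restrict_mem measurableSet_Ioc] with t h1 ht
      have ht0 : t ≠ 0 := ht.1.ne'
      have hlt : |-t| < 1 := by
        rw [abs_neg, abs_of_pos ht.1]; exact lt_of_le_of_ne ht.2 h1
      have h3 := Real.hasSum_pow_div_log_of_abs_lt_one hlt
      have h4 : HasSum (fun n => F n t) (-(Real.log (1 + t) / t)) := by
        rw [← hasSum_nat_add_iff' 1]
        have h5 := h3.div_const t
        rw [sub_neg_eq_add] at h5
        have e1 : (fun n => F (n + 1) t) = fun i : ℕ => (-t) ^ (i + 1) / ((i : ℝ) + 1) / t := by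
          funext n
          simp only [hF, Nat.add_sub_cancel]
          rw [neg_pow t, pow_succ t]
          push_cast
          field_simp
        have e2 : -(Real.log (1 + t) / t) - ∑ i ∈ Finset.range 1, F i t =
            -Real.log (1 + t) / t := by
          simp [hF, neg_div]
        rw [e1, e2]
        exact h5
      exact h4.tsum_eq
    rw [dilog, intervalIntegral.integral_of_le zero_le_one]
    have h6 : ∫ t in Ioc (0 : ℝ) 1, Complex.log (1 - (t : ℂ) * (-1)) / (t : ℂ) =
        ((∫ t in Ioc (0 : ℝ) 1, Real.log (1 + t) / t : ℝ) : ℂ) := by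
      rw [← integral_complex_ofReal]
      refine setIntegral_congr_fun measurableSet_Ioc fun t ht => ?_
      push_cast
      rw [Complex.ofReal_log (by linarith [ht.1])]
      push_cast
      congr 2; ring
    rw [h6, ← Complex.ofReal_neg, ← integral_neg]
    simp only [hF] at h2
    rw [← h2, h1]
    push_cast; ring
  · exact (Continuous.integrableOn_Icc (by fun_prop)).mono_set Ioc_subset_Icc_self
  · have hn : ∀ n, ∫ t in Ioc (0 : ℝ) 1, ‖F n t‖ = 1 / (n : ℝ) ^ 2 := by
      intro n
      have : ∫ t in Ioc (0 : ℝ) 1, ‖F n t‖ = ∫ t in Ioc (0 : ℝ) 1, 1 / (n : ℝ) * t ^ (n - 1) := by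
        refine setIntegral_congr_fun measurableSet_Ioc fun t ht => ?_
        simp [hF, abs_of_pos ht.1]
      rw [this, hint]
      rcases n with _ | n
      · simp
      · push_cast; simp; field_simp
    simp only [hn]
    exact Real.summable_one_div_nat_pow.2 one_lt_two

/-! ### A primitive of `ℓ e^ℓ / (1 - e^ℓ)` -/

/-- The function `ℓ e^ℓ / (1 - e^ℓ)`, with its singularity at the origin removed. -/
noncomputable def kap (l : ℂ) : ℂ := -(Complex.exp l / dslope Complex.exp 0 l)

/-- The primitive of `kap` vanishing at the origin; `Kap (log (1 - z))` is the dilogarithm. -/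
noncomputable def Kap : ℂ → ℂ := radialPrim kap

lemma kap_of_ne {l : ℂ} (hl : Complex.exp l ≠ 1) :
    kap l = l * Complex.exp l / (1 - Complex.exp l) := by
  have h0 : l ≠ 0 := by rintro rfl; simp at hl
  have h1 : Complex.exp l - 1 ≠ 0 := sub_ne_zero.2 hl
  have h2 : 1 - Complex.exp l ≠ 0 := sub_ne_zero.2 hl.symm
  rw [kap, dslope_of_ne _ h0, slope_def_field, Complex.exp_zero, sub_zero]
  rw [← neg_sub, neg_ne_zero] at h2
  rw [show 1 - Complex.exp l = -(Complex.exp l - 1) by ring]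
  field_simp

lemma isOpen_abs_im_lt (c : ℝ) : IsOpen {l : ℂ | |l.im| < c} :=
  isOpen_lt (by fun_prop) continuous_const

/-- The zeros of e^l − 1 are the multiples of 2πi, and in this strip only the simple zero at 0
remains. -/
lemma dslope_exp_ne_zero {l : ℂ} (hl : |l.im| < 2 * Real.pi) : dslope Complex.exp 0 l ≠ 0 := by
  by_cases h0 : l = 0
  · rw [h0, dslope_same, Complex.deriv_exp]; exact Complex.exp_ne_zero _
  · rw [dslope_of_ne _ h0, slope_def_field, Complex.exp_zero, sub_zero]
    refine div_ne_zero (sub_ne_zero.2 fun h => ?_) h0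
    obtain ⟨n, hn⟩ := Complex.exp_eq_one_iff.1 h
    have him : l.im = n * (2 * Real.pi) := by rw [hn]; simp
    rw [him, abs_mul, abs_of_pos (by positivity : (0 : ℝ) < 2 * Real.pi)] at hl
    have h1 : |(n : ℝ)| < 1 := by
      by_contra h; push Not at h
      nlinarith [Real.pi_pos]
    have h2 : n = 0 := by
      rw [← Int.cast_abs] at h1
      exact Int.abs_lt_one_iff.1 (by exact_mod_cast h1)
    rw [hn, h2] at h0
    simp at h0

/-- The strip is twice as high as the range of the principal logarithm; this extra room lets `genY`
apply `Kap` to a difference of two logarithms. -/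
lemma hasDerivAt_Kap {l : ℂ} (hl : |l.im| < 2 * Real.pi) : HasDerivAt Kap (kap l) l := by
  refine hasDerivAt_radialPrim (isOpen_abs_im_lt (2 * Real.pi)) (fun z hz t h0 h1 => ?_) ?_ hl
  · change |(t * z : ℂ).im| < _
    rw [Complex.im_ofReal_mul, abs_mul, abs_of_nonneg h0]
    exact (mul_le_of_le_one_left (abs_nonneg _) h1).trans_lt hz
  · have hd : DifferentiableOn ℂ (dslope Complex.exp 0) {l : ℂ | |l.im| < 2 * Real.pi} := by
      rw [Complex.differentiableOn_dslope ((isOpen_abs_im_lt _).mem_nhds (by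
        change |(0 : ℂ).im| < _
        simp [Real.pi_pos]))]
      exact Complex.differentiable_exp.differentiableOn
    exact (Complex.differentiable_exp.differentiableOn.div hd fun w hw => dslope_exp_ne_zero hw).neg

lemma analyticAt_Kap {l : ℂ} (hl : |l.im| < 2 * Real.pi) : AnalyticAt ℂ Kap l := by
  have : DifferentiableOn ℂ Kap {l : ℂ | |l.im| < 2 * Real.pi} := fun w hw =>
    (hasDerivAt_Kap hw).differentiableAt.differentiableWithinAt
  exact this.analyticOnNhd (isOpen_abs_im_lt _) l hl

/-! ### The function `Lam (kerOne 1)` as a dilogarithm -/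

lemma exp_mem_slitPlane_of_abs_im_lt {w : ℂ} (hw : |w.im| < Real.pi) :
    Complex.exp w ∈ Complex.slitPlane := by
  rw [abs_lt] at hw
  rw [Complex.mem_slitPlane_iff_arg]
  have h := congrArg Complex.im (Complex.log_exp hw.1 hw.2.le)
  rw [Complex.log_im] at h
  exact ⟨by rw [h]; exact hw.2.ne, Complex.exp_ne_zero _⟩

lemma one_add_mem_slitPlane {w : ℂ} (hw : w ∈ Complex.slitPlane) : 1 + w ∈ Complex.slitPlane := by
  rcases hw with h | h
  · left; simp; linarith
  · right; simpa using h

lemma one_add_exp_mem_slitPlane {z : ℂ} (hz : 2 * |z.im| < 1) :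
    1 + Complex.exp (2 * Real.pi * z) ∈ Complex.slitPlane := by
  refine one_add_mem_slitPlane (exp_mem_slitPlane_of_abs_im_lt ?_)
  have : (2 * Real.pi * z : ℂ).im = Real.pi * (2 * z.im) := by
    rw [show (2 * Real.pi * z : ℂ) = ((2 * Real.pi : ℝ) : ℂ) * z by push_cast; ring,
      Complex.im_ofReal_mul]; ring
  rw [this, abs_mul, abs_mul, abs_of_pos Real.pi_pos, abs_two]
  nlinarith [Real.pi_pos]

/-- Both sides have derivative −i logCosh, by `logCosh_sub_eq` at −w. The constant iπ/24 is the
value at 0, from Li₂(−1) = −π²/12. -/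
lemma Lam_kerOne_eq {z : ℂ} (hz : 2 * |z.im| < 1) :
    Complex.I * Lam (kerOne 1) z = -(dilog (-Complex.exp (2 * Real.pi * z)) / (2 * Real.pi * Complex.I)) +
      Complex.I * Real.pi * z ^ 2 / 2 + Complex.I * Real.pi / 24 := by
  have hpi : (Real.pi : ℂ) ≠ 0 := by exact_mod_cast Real.pi_ne_zero
  set f : ℂ → ℂ := fun z => Complex.I * Lam (kerOne 1) z -
    (-(dilog (-Complex.exp (2 * Real.pi * z)) / (2 * Real.pi * Complex.I)) +
      Complex.I * Real.pi * z ^ 2 / 2) with hf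
  have hd : ∀ w : ℂ, 2 * |w.im| < 1 → HasDerivAt f 0 w := by
    intro w hw
    have h1 := ((isKernel_kerOne one_pos).hasDerivAt_Lam hw).const_mul Complex.I
    have h2 : HasDerivAt (fun w : ℂ => -Complex.exp (2 * Real.pi * w))
        (-(Complex.exp (2 * Real.pi * w) * (2 * Real.pi * 1))) w :=
      (((hasDerivAt_id w).const_mul (2 * (Real.pi : ℂ))).cexp).neg
    have hs := one_add_exp_mem_slitPlane hw
    have h3 := (hasDerivAt_dilog (z := -Complex.exp (2 * Real.pi * w)) (by simpa using hs)
      (neg_ne_zero.2 (Complex.exp_ne_zero _))).comp w h2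
    have h4 : HasDerivAt (fun w : ℂ => Complex.I * Real.pi * w ^ 2 / 2)
        (Complex.I * Real.pi * (2 * w) / 2) w := by
      have := (((hasDerivAt_id w).pow 2).const_mul (Complex.I * Real.pi)).div_const 2
      simpa using this
    refine (h1.sub (((h3.div_const (2 * Real.pi * Complex.I)).neg).add h4)).congr_deriv ?_
    have h5 := logCosh_sub_eq (z := -w) (by simpa using hw)
    have h6 : logCosh (-w) = logCosh w := by simp [logCosh]
    rw [h6] at h5
    rw [show -(2 * Real.pi * -w) = 2 * Real.pi * w by ring] at h5
    rw [Psi_kerOne_one hw, sub_neg_eq_add, ← h5]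
    have := Complex.exp_ne_zero (2 * Real.pi * w)
    field_simp
    linear_combination (-(logCosh w + Real.pi * w)) * Complex.I_sq
  have h := eq_of_hasDerivAt_zero (convex_strip 1) (fun w hw => hd w hw) (x := z) (y := 0) hz
    (by simp)
  simp only [hf, Lam_zero, mul_zero, Complex.exp_zero, dilog_neg_one] at h
  have e : Complex.I * (Real.pi : ℂ) / 24 =
      0 - (-(-((Real.pi : ℂ) ^ 2 / 12) / (2 * Real.pi * Complex.I)) + Complex.I * Real.pi * 0 ^ 2 / 2) := by
    field_simp
    linear_combination (24 * Real.pi : ℂ) * Complex.I_sq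
  rw [e]
  linear_combination h

/-- `Lam (kerOne 1)` tends to zero at the boundary point `i / 2`. -/
lemma tendsto_Lam_kerOne_boundary :
    Tendsto (fun τ : ℝ => Lam (kerOne 1) (Complex.I * τ)) (𝓝[<] (1 / 2)) (𝓝 0) := by
  set D : ℝ → ℝ → ℝ := fun τ t => (Real.sinh (2 * t * τ) / (2 * (t * Real.sinh t)) - τ / t) / t with hD
  have hlam : ∀ τ t : ℝ, lam (kerOne 1) (Complex.I * τ) t = Complex.I * D τ t := by
    intro τ t
    have e : 2 * (t : ℂ) * (Complex.I * τ) = ((2 * t * τ : ℝ) : ℂ) * Complex.I := by push_cast; ring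
    simp only [lam, kerOne, hD, e, Complex.sin_mul_I, one_mul]
    push_cast
    ring
  have hz : (0 : ℂ) = ∫ t in Ioi (0 : ℝ), (0 : ℂ) := by simp
  rw [hz]
  -- The majorant is uniform in τ < 1/2, up to the edge of the strip: the decay of the sinh quotient
  -- is lost there, but the extra factor 1/t leaves 1/t² at infinity.
  set B : ℝ → ℝ := fun t => if t ≤ 1 then 1 else 1 / t ^ 2 with hB
  refine tendsto_integral_filter_of_dominated_convergence B ?_ ?_ ?_ ?_
  · exact Eventually.of_forall fun τ => (isKernel_kerOne one_pos).aestronglyMeasurable_lam _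
  · have h0 : ∀ᶠ τ : ℝ in 𝓝[<] (1 / 2), 0 < τ :=
      nhdsWithin_le_nhds (eventually_gt_nhds (by norm_num))
    filter_upwards [h0, self_mem_nhdsWithin] with τ h0 h1
    have h1 : τ < 1 / 2 := h1
    refine (ae_restrict_iff' measurableSet_Ioi).2 (ae_of_all _ fun t ht => ?_)
    have ht : 0 < t := ht
    have hs : 0 < Real.sinh t := Real.sinh_pos_iff.2 ht
    rw [hlam, norm_mul, Complex.norm_I, one_mul, Complex.norm_real, Real.norm_eq_abs]
    have hlow : -(τ * (1 / t - 1 / Real.sinh t)) ≤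
        Real.sinh (2 * t * τ) / (2 * (t * Real.sinh t)) - τ / t := by
      have : 2 * t * τ ≤ Real.sinh (2 * t * τ) := Real.self_le_sinh_iff.2 (by positivity)
      have h2 : 2 * t * τ / (2 * (t * Real.sinh t)) ≤ Real.sinh (2 * t * τ) / (2 * (t * Real.sinh t)) := by
        gcongr
      have h3 : 2 * t * τ / (2 * (t * Real.sinh t)) = τ * (1 / Real.sinh t) := by field_simp
      have h4 : τ / t = τ * (1 / t) := by ring
      rw [h3] at h2
      linarith
    simp only [hD, hB]
    rw [abs_div, abs_of_pos ht]
    split_ifs with h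
    · rw [div_le_iff₀ ht, one_mul]
      have h5 := (inv_sinh_bounds ht).2
      have h6 := (abs_le.1 (abs_coth_sub_le ht)).2
      have h7 := sinh_le_mul_cosh (x := 2 * t * τ) (by positivity)
      have h8 : Real.cosh (2 * t * τ) ≤ Real.cosh t := by
        rw [Real.cosh_le_cosh, abs_of_pos (by positivity), abs_of_pos ht]; nlinarith
      have h9 : Real.sinh (2 * t * τ) / (2 * (t * Real.sinh t)) ≤ τ * (Real.cosh t / Real.sinh t) := by
        rw [div_le_iff₀ (by positivity)]
        calc _ ≤ 2 * t * τ * Real.cosh t := h7.trans (by gcongr)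
          _ = _ := by field_simp
      have h10 : τ / t = τ * (1 / t) := by ring
      rw [abs_le]
      constructor <;> nlinarith
    · push Not at h
      rw [div_le_div_iff₀ ht (by positivity), one_mul]
      have h5 : Real.sinh (2 * t * τ) ≤ Real.sinh t := Real.sinh_le_sinh.2 (by nlinarith)
      have h6 : Real.sinh (2 * t * τ) / (2 * (t * Real.sinh t)) ≤ 1 / (2 * t) := by
        rw [div_le_div_iff₀ (by positivity) (by positivity)]; nlinarith
      have h7 : 0 ≤ Real.sinh (2 * t * τ) / (2 * (t * Real.sinh t)) :=
        div_nonneg (Real.sinh_nonneg_iff.2 (by positivity)) (by positivity)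
      have h8 : 0 ≤ τ / t := by positivity
      have h9 : τ / t ≤ 1 / t := by gcongr; linarith
      have h10 : 1 / (2 * t) ≤ 1 / t := by
        gcongr; linarith
      have h11 : |Real.sinh (2 * t * τ) / (2 * (t * Real.sinh t)) - τ / t| ≤ 1 / t := by
        rw [abs_le]; constructor <;> linarith
      calc _ ≤ 1 / t * t ^ 2 := by gcongr
        _ = t := by field_simp
  · exact integrableOn_piecewise (by simp) integrableOn_inv_sq
  · refine (ae_restrict_iff' measurableSet_Ioi).2 (ae_of_all _ fun t ht => ?_)
    have ht : 0 < t := ht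
    have hs : 0 < Real.sinh t := Real.sinh_pos_iff.2 ht
    simp only [hlam]
    have hc : Continuous fun τ : ℝ => Complex.I * (D τ t : ℂ) := by
      simp only [hD]; fun_prop
    have h := (hc.tendsto (1 / 2)).mono_left (nhdsWithin_le_nhds (s := Iio (1 / 2)))
    -- At τ = 1/2 the two sinh cancel and the integrand vanishes identically, which explains the
    -- limit 0.
    have hv : D (1 / 2) t = 0 := by
      simp only [hD]
      rw [show 2 * t * (1 / 2) = t by ring]
      field_simp
      ring
    rwa [hv, Complex.ofReal_zero, mul_zero] at h

/-! ### The exponent `f_𝓜` -/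

/-- This settles the branch questions below: once the exponentials agree, it is enough to locate the
arguments to within less than a full turn. -/
lemma eq_of_exp_eq {a b : ℂ} (h : Complex.exp a = Complex.exp b) (him : |a.im - b.im| < 2 * Real.pi) :
    a = b := by
  obtain ⟨n, hn⟩ := Complex.exp_eq_exp_iff_exists_int.1 h
  have h1 : a.im - b.im = n * (2 * Real.pi) := by rw [hn]; simp
  rw [h1, abs_mul, abs_of_pos (by positivity : (0 : ℝ) < 2 * Real.pi)] at him
  have h2 : |(n : ℝ)| < 1 := by
    by_contra h; push Not at h
    nlinarith [Real.pi_pos]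
  have h3 : n = 0 := by
    rw [← Int.cast_abs] at h2
    exact Int.abs_lt_one_iff.1 (by exact_mod_cast h2)
  rw [hn, h3]; simp

lemma im_cosh (w : ℂ) : (Complex.cosh w).im = Real.sinh w.re * Real.sin w.im := by
  conv_lhs => rw [← Complex.re_add_im w, Complex.cosh_add, Complex.cosh_mul_I, Complex.sinh_mul_I]
  simp [← Complex.ofReal_cosh, ← Complex.ofReal_sinh, ← Complex.ofReal_cos, ← Complex.ofReal_sin]

lemma re_sinh (w : ℂ) : (Complex.sinh w).re = Real.sinh w.re * Real.cos w.im := by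
  conv_lhs => rw [← Complex.re_add_im w, Complex.sinh_add, Complex.cosh_mul_I, Complex.sinh_mul_I]
  simp [← Complex.ofReal_cosh, ← Complex.ofReal_sinh, ← Complex.ofReal_cos, ← Complex.ofReal_sin]

lemma im_sinh (w : ℂ) : (Complex.sinh w).im = Real.cosh w.re * Real.sin w.im := by
  conv_lhs => rw [← Complex.re_add_im w, Complex.sinh_add, Complex.cosh_mul_I, Complex.sinh_mul_I]
  simp [← Complex.ofReal_cosh, ← Complex.ofReal_sinh, ← Complex.ofReal_cos, ← Complex.ofReal_sin]

/-- The ratio `cosh (π ω) / sinh (π (ζ + ω))`. -/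
noncomputable def ratio (ζ ω : ℂ) : ℂ :=
  Complex.cosh (Real.pi * ω) / Complex.sinh (Real.pi * (ζ + ω))

lemma fM_eq (ζ ω : ℂ) : fM ζ ω = -((dilog (-Complex.exp (2 * Real.pi * ζ)) +
    dilog (-Complex.exp (-(Real.pi * ζ)) * ratio ζ ω) -
    dilog (Complex.exp (Real.pi * ζ) * ratio ζ ω)) / (2 * Real.pi * Complex.I)) +
    Complex.I * Real.pi * ζ ^ 2 + Complex.I * (ω - Complex.I / 2) *
      Complex.log (Complex.exp (Real.pi * ζ) * ratio ζ ω) + Complex.I * Real.pi / 6 := rfl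

section

variable {ζ : ℝ} {ω : ℂ}

lemma sin_pos_of_strip (h0 : 0 < ω.im) (h1 : ω.im < 1 / 2) :
    0 < Real.sin (Real.pi * ω.im) ∧ 0 < Real.cos (Real.pi * ω.im) := by
  have := Real.pi_pos
  exact ⟨Real.sin_pos_of_pos_of_lt_pi (by positivity) (by nlinarith),
    Real.cos_pos_of_mem_Ioo ⟨by nlinarith, by nlinarith⟩⟩

lemma im_pi_mul (ω : ℂ) : (Real.pi * ω : ℂ).im = Real.pi * ω.im := Complex.im_ofReal_mul _ _

lemma im_pi_mul_add (ζ : ℝ) (ω : ℂ) : (Real.pi * (ζ + ω) : ℂ).im = Real.pi * ω.im := by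
  rw [Complex.im_ofReal_mul]; simp

lemma sinh_ne_zero_of_strip (h0 : 0 < ω.im) (h1 : ω.im < 1 / 2) :
    Complex.sinh (Real.pi * (ζ + ω)) ≠ 0 := by
  intro h
  have h2 := congrArg Complex.im h
  rw [im_sinh, im_pi_mul_add, Complex.zero_im] at h2
  have := mul_pos (Real.cosh_pos (Real.pi * (ζ + ω) : ℂ).re) (sin_pos_of_strip h0 h1).1
  linarith

/-- By the addition formula the numerator of the imaginary part is −sin(π Im ω) cos(π Im ω)
cosh(πζ). This sign keeps every `ω`-dependent logarithm in f_M off its cut. -/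
lemma im_ratio_neg (h0 : 0 < ω.im) (h1 : ω.im < 1 / 2) : (ratio ζ ω).im < 0 := by
  obtain ⟨hs, hc⟩ := sin_pos_of_strip h0 h1
  have hne := sinh_ne_zero_of_strip (ζ := ζ) h0 h1
  have hN := Complex.normSq_pos.2 hne
  have hre : (Real.pi * (ζ + ω) : ℂ).re = Real.pi * ζ + (Real.pi * ω : ℂ).re := by
    rw [Complex.re_ofReal_mul, Complex.re_ofReal_mul]; simp; ring
  rw [ratio, Complex.div_im, ← sub_div]
  refine div_neg_of_neg_of_pos ?_ hN
  rw [im_cosh, re_cosh, re_sinh, im_sinh, im_pi_mul_add, im_pi_mul, hre]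
  generalize (Real.pi * ω : ℂ).re = x
  have h3 : Real.cosh (Real.pi * ζ) = Real.cosh (Real.pi * ζ + x) * Real.cosh x -
      Real.sinh (Real.pi * ζ + x) * Real.sinh x := by
    rw [← Real.cosh_sub]; congr 1; ring
  have h4 := mul_pos (mul_pos hs hc) (Real.cosh_pos (Real.pi * ζ))
  rw [h3] at h4
  linarith

lemma hasDerivAt_ratio (h0 : 0 < ω.im) (h1 : ω.im < 1 / 2) :
    HasDerivAt (fun w => ratio ζ w) (ratio ζ ω * (Real.pi *
      (Complex.sinh (Real.pi * ω) / Complex.cosh (Real.pi * ω) -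
        Complex.cosh (Real.pi * (ζ + ω)) / Complex.sinh (Real.pi * (ζ + ω))))) ω := by
  have hs := sinh_ne_zero_of_strip (ζ := ζ) h0 h1
  have hc : Complex.cosh (Real.pi * ω) ≠ 0 := by
    intro h
    have := im_ratio_neg (ζ := ζ) h0 h1
    rw [ratio, h, zero_div] at this
    simp at this
  have d1 : HasDerivAt (fun w : ℂ => Complex.cosh (Real.pi * w))
      (Complex.sinh (Real.pi * ω) * (Real.pi * 1)) ω :=
    ((hasDerivAt_id ω).const_mul (Real.pi : ℂ)).ccosh
  have d2 : HasDerivAt (fun w : ℂ => Complex.sinh (Real.pi * (ζ + w)))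
      (Complex.cosh (Real.pi * (ζ + ω)) * (Real.pi * 1)) ω :=
    (((hasDerivAt_id ω).const_add (ζ : ℂ)).const_mul (Real.pi : ℂ)).csinh
  refine (d1.div d2 hs).congr_deriv ?_
  rw [ratio]
  field_simp

lemma one_sub_ratio (h0 : 0 < ω.im) (h1 : ω.im < 1 / 2) :
    1 - Complex.exp (Real.pi * ζ) * ratio ζ ω = -Complex.exp (-(Real.pi * ω)) *
      (Complex.cosh (Real.pi * ζ) / Complex.sinh (Real.pi * (ζ + ω))) ∧
    1 - (-Complex.exp (-(Real.pi * ζ)) * ratio ζ ω) = Complex.exp (Real.pi * ω) *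
      (Complex.cosh (Real.pi * ζ) / Complex.sinh (Real.pi * (ζ + ω))) := by
  have hs := sinh_ne_zero_of_strip (ζ := ζ) h0 h1
  have e : Complex.sinh (Real.pi * (ζ + ω)) = (Complex.exp (Real.pi * ζ) * Complex.exp (Real.pi * ω) -
      (Complex.exp (Real.pi * ζ))⁻¹ * (Complex.exp (Real.pi * ω))⁻¹) / 2 := by
    rw [← Complex.exp_neg, ← Complex.exp_neg, ← Complex.exp_add, ← Complex.exp_add, Complex.sinh]
    ring_nf
  have e2 : Complex.cosh (Real.pi * ω) =
      (Complex.exp (Real.pi * ω) + (Complex.exp (Real.pi * ω))⁻¹) / 2 := by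
    rw [← Complex.exp_neg, Complex.cosh]
  have e3 : Complex.cosh (Real.pi * ζ) =
      (Complex.exp (Real.pi * ζ) + (Complex.exp (Real.pi * ζ))⁻¹) / 2 := by
    rw [← Complex.exp_neg, Complex.cosh]
  have z0 := Complex.exp_ne_zero (Real.pi * ζ)
  have w0 := Complex.exp_ne_zero (Real.pi * ω)
  rw [ratio]
  constructor
  · rw [mul_div_assoc', mul_div_assoc', ← sub_eq_zero, one_sub_div hs, ← sub_div,
      div_eq_zero_iff]
    left
    rw [e, e2, e3, Complex.exp_neg]
    field_simp
    ring
  · rw [mul_div_assoc', mul_div_assoc', ← sub_eq_zero, one_sub_div hs, ← sub_div,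
      div_eq_zero_iff]
    left
    rw [e, e2, e3, Complex.exp_neg]
    field_simp
    ring

lemma im_exp_mul (ζ : ℝ) (w : ℂ) :
    (Complex.exp (Real.pi * ζ) * w).im = Real.exp (Real.pi * ζ) * w.im := by
  rw [← Complex.ofReal_mul, ← Complex.ofReal_exp, Complex.im_ofReal_mul]

lemma im_neg_exp_mul (ζ : ℝ) (w : ℂ) :
    (-Complex.exp (-(Real.pi * ζ)) * w).im = -(Real.exp (-(Real.pi * ζ)) * w.im) := by
  rw [← Complex.ofReal_mul, ← Complex.ofReal_neg, ← Complex.ofReal_exp, neg_mul, Complex.neg_im,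
    Complex.im_ofReal_mul]

lemma arg_mem_of_im_pos {w : ℂ} (h : 0 < w.im) : 0 < w.arg ∧ w.arg < Real.pi := by
  have h1 := Complex.arg_nonneg_iff.2 h.le
  have h2 := Complex.arg_le_pi w
  refine ⟨lt_of_le_of_ne h1 fun h3 => ?_, lt_of_le_of_ne h2 fun h3 => ?_⟩
  · exact h.ne (Complex.arg_eq_zero_iff.1 h3.symm).2.symm
  · exact h.ne (Complex.arg_eq_pi_iff.1 h3).2.symm

lemma arg_mem_of_im_neg {w : ℂ} (h : w.im < 0) : -Real.pi < w.arg ∧ w.arg < 0 :=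
  ⟨Complex.neg_pi_lt_arg w, Complex.arg_neg_iff.2 h⟩

lemma im_facts (h0 : 0 < ω.im) (h1 : ω.im < 1 / 2) :
    (Complex.exp (Real.pi * ζ) * ratio ζ ω).im < 0 ∧
    0 < (1 - Complex.exp (Real.pi * ζ) * ratio ζ ω).im ∧
    (1 - -Complex.exp (-(Real.pi * ζ)) * ratio ζ ω).im < 0 := by
  have h := im_ratio_neg (ζ := ζ) h0 h1
  have a1 := mul_pos (Real.exp_pos (Real.pi * ζ)) (neg_pos.2 h)
  have a2 := mul_pos (Real.exp_pos (-(Real.pi * ζ))) (neg_pos.2 h)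
  refine ⟨?_, ?_, ?_⟩
  · rw [im_exp_mul]; linarith
  · rw [Complex.sub_im, Complex.one_im, im_exp_mul]; linarith
  · rw [Complex.sub_im, Complex.one_im, im_neg_exp_mul]; linarith

lemma ne_zero_of_im_ne_zero {w : ℂ} (h : w.im ≠ 0) : w ≠ 0 := by
  rintro rfl; simp at h

/-- By `one_sub_ratio` the two numbers have quotient −e^{2πω}. Their imaginary parts have opposite
signs, which selects the branch. -/
lemma log_sub_log_one_sub (h0 : 0 < ω.im) (h1 : ω.im < 1 / 2) :
    Complex.log (1 - -Complex.exp (-(Real.pi * ζ)) * ratio ζ ω) -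
      Complex.log (1 - Complex.exp (Real.pi * ζ) * ratio ζ ω) =
    2 * Real.pi * ω - Complex.I * Real.pi := by
  obtain ⟨-, b1, b2⟩ := im_facts (ζ := ζ) h0 h1
  obtain ⟨e1, e2⟩ := one_sub_ratio (ζ := ζ) h0 h1
  have n1 := ne_zero_of_im_ne_zero b1.ne'
  have n2 := ne_zero_of_im_ne_zero b2.ne
  refine eq_of_exp_eq ?_ ?_
  · rw [Complex.exp_sub, Complex.exp_log n1, Complex.exp_log n2, Complex.exp_sub,
      mul_comm Complex.I, Complex.exp_pi_mul_I]
    rw [div_eq_div_iff n1 (by norm_num), e1, e2]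
    have : Complex.exp (2 * Real.pi * ω) = Complex.exp (Real.pi * ω) ^ 2 := by
      rw [← Complex.exp_nat_mul]; congr 1; push_cast; ring
    rw [this, Complex.exp_neg]
    have := Complex.exp_ne_zero (Real.pi * ω)
    field_simp
  · have a1 := arg_mem_of_im_pos b1
    have a2 := arg_mem_of_im_neg b2
    have e3 : (2 * Real.pi * ω - Complex.I * Real.pi : ℂ).im = Real.pi * (2 * ω.im - 1) := by
      rw [show (2 * Real.pi * ω - Complex.I * Real.pi : ℂ) =
        ((2 * Real.pi : ℝ) : ℂ) * ω - Complex.I * Real.pi by push_cast; ring, Complex.sub_im,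
        Complex.im_ofReal_mul]
      simp; ring
    rw [e3, Complex.sub_im, Complex.log_im, Complex.log_im, abs_lt]
    have := Real.pi_pos
    constructor <;> nlinarith

lemma abs_im_logCosh_lt {z : ℂ} (hz : 2 * |z.im| < 1) : |(logCosh z).im| < Real.pi / 2 := by
  rw [logCosh, Complex.log_im]
  exact Complex.abs_arg_lt_pi_div_two_iff.2 (Or.inl (re_two_cosh_pos (abs_im_pi_mul hz)))

lemma log_ratio (h0 : 0 < ω.im) (h1 : ω.im < 1 / 2) :
    Complex.log (Complex.exp (Real.pi * ζ) * ratio ζ ω) =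
      Real.pi * ζ - Complex.I * Real.pi / 2 - logCosh (ζ + ω - Complex.I / 2) + logCosh ω := by
  have hz := im_lt_of_strip (ζ := ζ) h0 h1
  have hω : 2 * |ω.im| < 1 := by rw [abs_of_pos h0]; linarith
  obtain ⟨b0, -, -⟩ := im_facts (ζ := ζ) h0 h1
  have n0 := ne_zero_of_im_ne_zero b0.ne
  refine eq_of_exp_eq ?_ ?_
  · rw [Complex.exp_log n0, Complex.exp_add, Complex.exp_sub, Complex.exp_sub, exp_logCosh hz,
      exp_logCosh hω, show Complex.I * Real.pi / 2 = Real.pi / 2 * Complex.I by ring,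
      Complex.exp_pi_div_two_mul_I,
      show Real.pi * (ζ + ω - Complex.I / 2) = Real.pi * (ζ + ω) - Real.pi / 2 * Complex.I by ring,
      Complex.cosh_sub, Complex.cosh_mul_I, Complex.sinh_mul_I, Complex.cos_pi_div_two,
      Complex.sin_pi_div_two, ratio]
    have hs := sinh_ne_zero_of_strip (ζ := ζ) h0 h1
    have : Complex.I ^ 2 = -1 := Complex.I_sq
    have hI := Complex.I_ne_zero
    rw [mul_zero, zero_sub, one_mul]
    field_simp
    rw [this]; ring
  · have a0 := arg_mem_of_im_neg b0
    have a1 := abs_lt.1 (abs_im_logCosh_lt hz)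
    have a2 := abs_lt.1 (abs_im_logCosh_lt hω)
    have e : (Real.pi * ζ - Complex.I * Real.pi / 2 - logCosh (ζ + ω - Complex.I / 2) +
        logCosh ω).im = -(Real.pi / 2) - (logCosh (ζ + ω - Complex.I / 2)).im + (logCosh ω).im := by
      have : (Complex.I * Real.pi / 2 : ℂ).im = Real.pi / 2 := by simp
      rw [Complex.add_im, Complex.sub_im, Complex.sub_im, this, Complex.im_ofReal_mul]
      simp
    rw [e, Complex.log_im, abs_lt]
    constructor <;> linarith

/-- With ρ the logarithmic derivative of `ratio`, the dilogarithms contribute ρ times a difference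
of logarithms over 2πi. By `log_sub_log_one_sub` this is −i(ω − i/2)ρ, and it cancels the derivative
of the logarithm in f_M, leaving only the derivative of its coefficient. -/
lemma hasDerivAt_fM (h0 : 0 < ω.im) (h1 : ω.im < 1 / 2) :
    HasDerivAt (fun w => fM ζ w)
      (Complex.I * Complex.log (Complex.exp (Real.pi * ζ) * ratio ζ ω)) ω := by
  obtain ⟨b0, b1, b2⟩ := im_facts (ζ := ζ) h0 h1
  have hr := hasDerivAt_ratio (ζ := ζ) h0 h1
  have hl := log_sub_log_one_sub (ζ := ζ) h0 h1
  have hr0 : ratio ζ ω ≠ 0 := ne_zero_of_im_ne_zero (im_ratio_neg h0 h1).ne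
  have hpi : (Real.pi : ℂ) ≠ 0 := by exact_mod_cast Real.pi_ne_zero
  generalize Real.pi * (Complex.sinh (Real.pi * ω) / Complex.cosh (Real.pi * ω) -
        Complex.cosh (Real.pi * (ζ + ω)) / Complex.sinh (Real.pi * (ζ + ω))) = ρ at hr
  have z0 := Complex.exp_ne_zero (Real.pi * ζ)
  have z0' := Complex.exp_ne_zero (-(Real.pi * ζ))
  have d1 := (hasDerivAt_dilog (Or.inr b2.ne) (mul_ne_zero (neg_ne_zero.2 z0') hr0)).comp ω
    (hr.const_mul (-Complex.exp (-(Real.pi * ζ))))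
  have d2 := (hasDerivAt_dilog (Or.inr b1.ne') (mul_ne_zero z0 hr0)).comp ω
    (hr.const_mul (Complex.exp (Real.pi * ζ)))
  have d3 := (hr.const_mul (Complex.exp (Real.pi * ζ))).clog (Or.inr b0.ne)
  have d4 : HasDerivAt (fun w : ℂ => Complex.I * (w - Complex.I / 2)) (Complex.I * 1) ω :=
    ((hasDerivAt_id ω).sub_const _).const_mul _
  have d := (((((d1.const_add (dilog (-Complex.exp (2 * Real.pi * ζ)))).sub d2).div_const
    (2 * Real.pi * Complex.I)).neg.add_const (Complex.I * Real.pi * (ζ : ℂ) ^ 2)).add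
    (d4.mul d3)).add_const (Complex.I * Real.pi / 6)
  refine d.congr_deriv ?_
  generalize Complex.log (1 - -Complex.exp (-(Real.pi * ζ)) * ratio ζ ω) = l₁ at *
  generalize Complex.log (1 - Complex.exp (Real.pi * ζ) * ratio ζ ω) = l₂ at *
  generalize Complex.log (Complex.exp (Real.pi * ζ) * ratio ζ ω) = l₃ at *
  have hl' : l₁ = 2 * Real.pi * ω - Complex.I * Real.pi + l₂ := by linear_combination hl
  rw [hl']
  have hI := Complex.I_ne_zero
  field_simp
  linear_combination (ρ * Real.pi * (2 * ω - Complex.I)) * Complex.I_sq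

/-- The derivatives of the two `Lam` terms are logarithms of 2 cosh, which `log_ratio` combines into
the logarithm occurring in f_M. -/
lemma hasDerivAt_expB (h0 : 0 < ω.im) (h1 : ω.im < 1 / 2) :
    HasDerivAt (fun w => expB ζ w)
      (Complex.I * Complex.log (Complex.exp (Real.pi * ζ) * ratio ζ ω)) ω := by
  have hz := im_lt_of_strip (ζ := ζ) h0 h1
  have hω : 2 * |ω.im| < 1 := by rw [abs_of_pos h0]; linarith
  have hk := isKernel_kerOne one_pos
  have d1 := (hk.hasDerivAt_Lam hω).const_mul Complex.I
  have d2 := ((hk.hasDerivAt_Lam hz).comp ω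
    (((hasDerivAt_id ω).const_add (ζ : ℂ)).sub_const (Complex.I / 2))).const_mul Complex.I
  have d3 : HasDerivAt (fun w : ℂ => Complex.I * Real.pi * (ζ : ℂ) ^ 2 / 2 +
      Complex.I * Real.pi * w * ζ - Complex.I * Real.pi / 8 + Real.pi * (ζ + w) / 2)
      (Complex.I * Real.pi * 1 * ζ + Real.pi * 1 / 2) ω :=
    (((((hasDerivAt_id ω).const_mul (Complex.I * Real.pi)).mul_const (ζ : ℂ)).const_add _).sub_const
      _).add ((((hasDerivAt_id ω).const_add (ζ : ℂ)).const_mul (Real.pi : ℂ)).div_const 2)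
  refine ((d3.add d2).sub d1).congr_deriv ?_
  rw [Psi_kerOne_one hz, Psi_kerOne_one hω, log_ratio h0 h1]
  linear_combination (Real.pi / 2 : ℂ) * Complex.I_sq

end

lemma norm_log_le (z : ℂ) : ‖Complex.log z‖ ≤ |Real.log ‖z‖| + Real.pi := by
  refine (Complex.norm_le_abs_re_add_abs_im _).trans ?_
  rw [Complex.log_re, Complex.log_im]
  gcongr
  exact Complex.abs_arg_le_pi z

lemma tendsto_ratio (ζ : ℝ) :
    Tendsto (fun τ : ℝ => ratio ζ (Complex.I * τ)) (𝓝[<] (1 / 2)) (𝓝 0) := by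
  have hs : Complex.sinh (Real.pi * (ζ + Complex.I * (1 / 2 : ℝ))) ≠ 0 := by
    rw [show (Real.pi * (ζ + Complex.I * (1 / 2 : ℝ)) : ℂ) =
      ((Real.pi * ζ : ℝ) : ℂ) + Real.pi / 2 * Complex.I by push_cast; ring, Complex.sinh_add,
      Complex.cosh_mul_I, Complex.sinh_mul_I, Complex.cos_pi_div_two, Complex.sin_pi_div_two,
      ← Complex.ofReal_cosh]
    have : ((Real.cosh (Real.pi * ζ) : ℝ) : ℂ) ≠ 0 := by exact_mod_cast (Real.cosh_pos _).ne'
    simpa using this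
  have hc : ContinuousAt (fun τ : ℝ => ratio ζ (Complex.I * τ)) (1 / 2) := by
    unfold ratio
    exact ContinuousAt.div (by fun_prop) (by fun_prop) hs
  have h := hc.tendsto.mono_left (nhdsWithin_le_nhds (s := Iio (1 / 2)))
  have hv : ratio ζ (Complex.I * (1 / 2 : ℝ)) = 0 := by
    rw [ratio, show (Real.pi * (Complex.I * (1 / 2 : ℝ)) : ℂ) = Real.pi / 2 * Complex.I by
      push_cast; ring, Complex.cosh_mul_I, Complex.cos_pi_div_two, zero_div]
  rwa [hv] at h

/-- A linear lower bound in 1/2 − τ, from Jordan's inequality for the sine. It bounds the vanishing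
coefficient of the logarithm by a multiple of n = |e^{πζ} ratio|, so that n log n → 0 disposes of
the product. -/
lemma le_norm_ratio (ζ : ℝ) {τ : ℝ} (h0 : 0 < τ) (h1 : τ < 1 / 2) :
    (1 / 2 - τ) * 2 / Real.cosh (Real.pi * ζ) ≤ ‖ratio ζ (Complex.I * τ)‖ := by
  have hpi := Real.pi_pos
  have e1 : Complex.cosh (Real.pi * (Complex.I * τ)) = (Real.sin (Real.pi * (1 / 2 - τ)) : ℝ) := by
    rw [show (Real.pi * (Complex.I * τ) : ℂ) = ((Real.pi * τ : ℝ) : ℂ) * Complex.I by push_cast; ring,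
      Complex.cosh_mul_I, ← Complex.ofReal_cos, ← Real.sin_pi_div_two_sub]
    congr 2; ring
  have hsin : 2 / Real.pi * (Real.pi * (1 / 2 - τ)) ≤ Real.sin (Real.pi * (1 / 2 - τ)) :=
    Real.mul_le_sin (by nlinarith) (by nlinarith)
  have hsin' : 2 / Real.pi * (Real.pi * (1 / 2 - τ)) = (1 / 2 - τ) * 2 := by field_simp
  rw [hsin'] at hsin
  have hI : (Complex.I * τ : ℂ).im = τ := by simp
  have hsh := sinh_ne_zero_of_strip (ζ := ζ) (ω := Complex.I * τ) (by rw [hI]; exact h0)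
    (by rw [hI]; exact h1)
  have hn : ‖Complex.sinh (Real.pi * (ζ + Complex.I * τ))‖ ≤ Real.cosh (Real.pi * ζ) := by
    refine abs_le_of_sq_le_sq' ?_ (Real.cosh_pos _).le |>.2
    rw [norm_sinh_sq, Real.cosh_sq, Complex.re_ofReal_mul]
    have := Real.sin_sq_le_one (Real.pi * (ζ + Complex.I * τ) : ℂ).im
    simp only [Complex.add_re, Complex.ofReal_re, Complex.mul_re, Complex.I_re, Complex.I_im,
      Complex.ofReal_im, zero_mul, mul_zero, sub_zero, add_zero]
    linarith
  rw [ratio, norm_div, e1, Complex.norm_real, Real.norm_eq_abs]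
  have hpos := norm_pos_iff.2 hsh
  exact div_le_div₀ (abs_nonneg _) (hsin.trans (le_abs_self _)) hpos hn

lemma tendsto_mul_log_ratio (ζ : ℝ) :
    Tendsto (fun τ : ℝ => Complex.I * (Complex.I * τ - Complex.I / 2) *
      Complex.log (Complex.exp (Real.pi * ζ) * ratio ζ (Complex.I * τ))) (𝓝[<] (1 / 2)) (𝓝 0) := by
  set K := Real.cosh (Real.pi * ζ) / 2 / Real.exp (Real.pi * ζ) with hK
  have hKp : 0 < K := by have := Real.cosh_pos (Real.pi * ζ); positivity
  set n : ℝ → ℝ := fun τ => ‖Complex.exp (Real.pi * ζ) * ratio ζ (Complex.I * τ)‖ with hn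
  have hn0 : Tendsto n (𝓝[<] (1 / 2)) (𝓝 0) := by
    have := ((tendsto_ratio ζ).const_mul (Complex.exp (Real.pi * ζ))).norm
    rwa [mul_zero, norm_zero] at this
  have hnlog : Tendsto (fun τ => n τ * Real.log (n τ)) (𝓝[<] (1 / 2)) (𝓝 0) := by
    have := (Real.continuous_mul_log.tendsto 0).comp hn0
    rwa [zero_mul] at this
  have hbd : Tendsto (fun τ => K * (|n τ * Real.log (n τ)| + n τ * Real.pi)) (𝓝[<] (1 / 2)) (𝓝 0) := by
    have := ((hnlog.abs).add (hn0.mul_const Real.pi)).const_mul K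
    simpa using this
  refine squeeze_zero_norm' ?_ hbd
  have h0 : ∀ᶠ τ : ℝ in 𝓝[<] (1 / 2), 0 < τ := nhdsWithin_le_nhds (eventually_gt_nhds (by norm_num))
  filter_upwards [h0, self_mem_nhdsWithin] with τ h0 h1
  have h1 : τ < 1 / 2 := h1
  have e : Complex.I * (Complex.I * τ - Complex.I / 2) = ((1 / 2 - τ : ℝ) : ℂ) := by
    push_cast
    linear_combination ((τ : ℂ) - 1 / 2) * Complex.I_sq
  have hle : 1 / 2 - τ ≤ K * n τ := by
    have h2 := le_norm_ratio ζ h0 h1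
    rw [div_le_iff₀ (Real.cosh_pos _)] at h2
    have h3 : n τ = Real.exp (Real.pi * ζ) * ‖ratio ζ (Complex.I * τ)‖ := by
      rw [hn]; simp only
      rw [norm_mul, ← Complex.ofReal_mul, ← Complex.ofReal_exp, Complex.norm_real, Real.norm_eq_abs,
        Real.abs_exp]
    rw [h3, hK]
    have := Real.exp_pos (Real.pi * ζ)
    field_simp
    linarith
  have hn' : 0 ≤ n τ := norm_nonneg _
  rw [e, norm_mul, Complex.norm_real, Real.norm_eq_abs, abs_of_pos (by linarith)]
  calc _ ≤ K * n τ * (|Real.log (n τ)| + Real.pi) :=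
        mul_le_mul hle (norm_log_le _) (norm_nonneg _) (by positivity)
    _ = _ := by rw [abs_mul, abs_of_nonneg hn']; ring

/-- The difference is constant in `ω` and is evaluated in the limit ω → i/2 along the imaginary
axis. There the `ω`-dependent dilogarithms, the logarithmic term and Lam(ω) all vanish, and
`Lam_kerOne_eq` at the real point ζ matches what is left. -/
lemma fM_eq_expB {ζ : ℝ} {ω : ℂ} (h0 : 0 < ω.im) (h1 : ω.im < 1 / 2) : fM ζ ω = expB ζ ω := by
  have hconst : ∀ w : ℂ, 0 < w.im → w.im < 1 / 2 → fM ζ w - expB ζ w = fM ζ ω - expB ζ ω := by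
    intro w hw0 hw1
    refine eq_of_hasDerivAt_zero (convex_halfstrip (1 / 2)) (f := fun w => fM ζ w - expB ζ w)
      (fun w hw => ?_) ⟨hw0, hw1⟩ ⟨h0, h1⟩
    have := (hasDerivAt_fM (ζ := ζ) hw.1 hw.2).sub (hasDerivAt_expB (ζ := ζ) hw.1 hw.2)
    rwa [sub_self] at this
  have hr := tendsto_ratio ζ
  have hk := isKernel_kerOne one_pos
  have hζ : 2 * |(ζ : ℂ).im| < 1 := by simp
  have hdil : ∀ c : ℂ, Tendsto (fun τ : ℝ => dilog (c * ratio ζ (Complex.I * τ))) (𝓝[<] (1 / 2))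
      (𝓝 0) := by
    intro c
    have h2 : ContinuousAt dilog (c * 0) := continuousAt_dilog (by simp)
    have h3 := h2.tendsto.comp (hr.const_mul c)
    rwa [mul_zero, dilog_zero] at h3
  have hf : Tendsto (fun τ : ℝ => fM ζ (Complex.I * τ)) (𝓝[<] (1 / 2))
      (𝓝 (-((dilog (-Complex.exp (2 * Real.pi * ζ)) + 0 - 0) / (2 * Real.pi * Complex.I)) +
        Complex.I * Real.pi * (ζ : ℂ) ^ 2 + 0 + Complex.I * Real.pi / 6)) := by
    simp only [fM_eq]
    exact (((((hdil _).const_add _).sub (hdil _)).div_const _).neg.add_const _).add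
      (tendsto_mul_log_ratio ζ) |>.add_const _
  have hzc : ContinuousAt (fun τ : ℝ => Complex.I * Real.pi * (ζ : ℂ) ^ 2 / 2 +
      Complex.I * Real.pi * (Complex.I * τ) * ζ - Complex.I * Real.pi / 8 +
      Real.pi * (ζ + Complex.I * τ) / 2 +
      Complex.I * Lam (kerOne 1) (ζ + Complex.I * τ - Complex.I / 2)) (1 / 2) := by
    have hL : ContinuousAt (Lam (kerOne 1)) (ζ + Complex.I * (1 / 2 : ℝ) - Complex.I / 2) := by
      refine (hk.hasDerivAt_Lam ?_).continuousAt
      rw [show (ζ + Complex.I * (1 / 2 : ℝ) - Complex.I / 2 : ℂ) = ζ by push_cast; ring]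
      exact hζ
    have hL2 : ContinuousAt (fun τ : ℝ => Lam (kerOne 1) (ζ + Complex.I * τ - Complex.I / 2)) (1 / 2) :=
      ContinuousAt.comp (f := fun τ : ℝ => (ζ + Complex.I * τ - Complex.I / 2 : ℂ)) hL (by fun_prop)
    fun_prop
  have he := (hzc.tendsto.mono_left (nhdsWithin_le_nhds (s := Iio (1 / 2)))).sub
    (tendsto_Lam_kerOne_boundary.const_mul Complex.I)
  have hfe := hf.sub he
  have hev : (fun τ : ℝ => fM ζ (Complex.I * τ) - (Complex.I * Real.pi * (ζ : ℂ) ^ 2 / 2 +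
      Complex.I * Real.pi * (Complex.I * τ) * ζ - Complex.I * Real.pi / 8 +
      Real.pi * (ζ + Complex.I * τ) / 2 +
      Complex.I * Lam (kerOne 1) (ζ + Complex.I * τ - Complex.I / 2) -
      Complex.I * Lam (kerOne 1) (Complex.I * τ))) =ᶠ[𝓝[<] (1 / 2)]
      fun _ => fM ζ ω - expB ζ ω := by
    have h0 : ∀ᶠ τ : ℝ in 𝓝[<] (1 / 2), 0 < τ :=
      nhdsWithin_le_nhds (eventually_gt_nhds (by norm_num))
    filter_upwards [h0, self_mem_nhdsWithin] with τ h0 h1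
    have h1 : τ < 1 / 2 := h1
    have hI : (Complex.I * τ : ℂ).im = τ := by simp
    rw [← hconst (Complex.I * τ) (by rw [hI]; exact h0) (by rw [hI]; exact h1), expB]
  have hlim := tendsto_nhds_unique (hfe.congr' hev) tendsto_const_nhds
  rw [show (ζ + Complex.I * (1 / 2 : ℝ) - Complex.I / 2 : ℂ) = ζ by push_cast; ring,
    Lam_kerOne_eq hζ] at hlim
  have h3 : fM ζ ω - expB ζ ω = 0 := by
    rw [← hlim]
    push_cast
    linear_combination (-(Real.pi * ζ / 2 : ℂ)) * Complex.I_sq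
  exact sub_eq_zero.1 h3

/-! ### The generating function -/

lemma abs_im_log_lt (z : ℂ) : |(Complex.log z).im| < 2 * Real.pi := by
  rw [Complex.log_im]
  have := Complex.abs_arg_le_pi z
  linarith [Real.pi_pos]

/-- By the chain rule with l = log(1 − z), both sides have the same derivative along the segment
from 0 to z, and both vanish at 0. -/
lemma dilog_eq_Kap {z : ℂ} (hz : 1 - z ∈ Complex.slitPlane) :
    dilog z = Kap (Complex.log (1 - z)) := by
  have hlog : ∀ w : ℂ, 1 - w ∈ Complex.slitPlane →
      HasDerivAt (fun w => Complex.log (1 - w)) (-1 / (1 - w)) w := fun w hw =>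
    ((hasDerivAt_id w).const_sub 1).clog hw
  have hd : ∀ w : ℂ, 1 - w ∈ Complex.slitPlane →
      HasDerivAt (fun w => dilog w - Kap (Complex.log (1 - w))) 0 w := by
    intro w hw
    have hw0 := Complex.slitPlane_ne_zero hw
    have h1 := (hasDerivAt_dilog_dslope hw).sub
      ((hasDerivAt_Kap (abs_im_log_lt (1 - w))).comp w (hlog w hw))
    refine h1.congr_deriv ?_
    by_cases h0 : w = 0
    · subst h0
      have h2 := (hlog 0 (by simp)).deriv
      rw [dslope_same, h2]
      simp [kap, Complex.deriv_exp]
    · rw [dslope_of_ne _ h0, slope_def_field, kap_of_ne, Complex.exp_log hw0]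
      · simp; field_simp; ring
      · rw [Complex.exp_log hw0]
        intro h
        exact h0 (by linear_combination -h)
  have hseg : ∀ t ∈ Icc (0 : ℝ) 1, HasDerivAt
      (fun t : ℝ => dilog (t * z) - Kap (Complex.log (1 - t * z))) 0 t := by
    intro t ht
    have hm : 1 - (t : ℂ) * z ∈ Complex.slitPlane := by
      convert star_slitPlane hz ht.1 ht.2 using 1; ring
    have h1 : HasDerivAt (fun t : ℝ => (t : ℂ) * z) (1 * z) t :=
      (Complex.ofRealCLM.hasDerivAt (x := t)).mul_const z
    exact ((hd _ hm).comp t h1).congr_deriv (zero_mul _)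
  have h := eq_of_hasDerivAt_zero (convex_Icc (0 : ℝ) 1) hseg (right_mem_Icc.2 zero_le_one)
    (left_mem_Icc.2 zero_le_one)
  simp only [Complex.ofReal_one, one_mul, Complex.ofReal_zero, zero_mul, sub_zero, Complex.log_one,
    dilog_zero] at h
  rw [Kap, radialPrim_zero, sub_zero] at h
  exact sub_eq_zero.1 h

/-- The analytic continuation of `YFormula`. -/
noncomputable def genY (p : ℂ × ℂ) : ℂ :=
  (Kap (Complex.log (argζ p.1 p.2) - Complex.log (argω p.1 p.2)) -
    Kap (Complex.log (argζ p.1 p.2))) / (2 * Real.pi * Complex.I)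

/-- `1 - e^{2 π i ω}`. -/
noncomputable def vden (ω : ℂ) : ℂ := 1 - Complex.exp (2 * Complex.I * Real.pi * ω)

lemma argω_eq (ζ ω : ℂ) : argω ζ ω = argζ ζ ω / vden ω := rfl

lemma argζ_eq (ζ ω : ℂ) : argζ ζ ω = vden (ζ + ω) := rfl

lemma vden_ne_zero {ζ ω : ℂ} (h : (ζ, ω) ∈ domainY) : vden ω ≠ 0 := by
  intro h0
  have h2 : argω ζ ω ∈ Complex.slitPlane := h.2
  rw [argω_eq, h0, div_zero] at h2
  exact Complex.slitPlane_ne_zero h2 rfl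

lemma hasDerivAt_vden (ω : ℂ) :
    HasDerivAt vden (-(2 * Complex.I * Real.pi * (1 - vden ω))) ω := by
  have := ((hasDerivAt_id ω).const_mul (2 * Complex.I * (Real.pi : ℂ))).cexp.const_sub 1
  refine this.congr_deriv ?_
  rw [vden]; simp; ring

lemma one_sub_vden_ne_zero (ω : ℂ) : 1 - vden ω ≠ 0 := by
  rw [vden, sub_sub_cancel]; exact Complex.exp_ne_zero _

/-- |arg w| ≤ π always, while |arg u| < π strictly off the cut; the strictness is what keeps the
difference inside the domain of `Kap`. -/
lemma abs_im_log_sub_log_lt {u w : ℂ} (hu : u ∈ Complex.slitPlane) :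
    |(Complex.log u - Complex.log w).im| < 2 * Real.pi := by
  rw [Complex.sub_im, Complex.log_im, Complex.log_im]
  have h1 := Complex.abs_arg_le_pi w
  have h2 : |u.arg| < Real.pi :=
    lt_of_le_of_ne (Complex.abs_arg_le_pi u) fun h => by
      rcases abs_eq Real.pi_pos.le |>.1 h with h | h
      · exact (Complex.mem_slitPlane_iff_arg.1 hu).1 h
      · exact (Complex.neg_pi_lt_arg u).ne' h
  have := abs_sub u.arg w.arg
  linarith

lemma exp_log_sub_log {ζ ω : ℂ} (h : (ζ, ω) ∈ domainY) :
    Complex.exp (Complex.log (argζ ζ ω) - Complex.log (argω ζ ω)) = vden ω := by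
  have h1 : argζ ζ ω ≠ 0 := Complex.slitPlane_ne_zero h.1
  have h2 : argω ζ ω ≠ 0 := Complex.slitPlane_ne_zero h.2
  rw [Complex.exp_sub, Complex.exp_log h1, Complex.exp_log h2, argω_eq, div_div_cancel₀ h1]

lemma kap_log_argζ {ζ ω : ℂ} (h : (ζ, ω) ∈ domainY) :
    kap (Complex.log (argζ ζ ω)) =
      Complex.log (argζ ζ ω) * argζ ζ ω / (1 - argζ ζ ω) := by
  have h1 : argζ ζ ω ≠ 0 := Complex.slitPlane_ne_zero h.1
  rw [kap_of_ne, Complex.exp_log h1]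
  rw [Complex.exp_log h1, argζ_eq]
  exact (sub_ne_zero.1 (one_sub_vden_ne_zero _)).symm

lemma kap_log_sub_log {ζ ω : ℂ} (h : (ζ, ω) ∈ domainY) :
    kap (Complex.log (argζ ζ ω) - Complex.log (argω ζ ω)) =
      (Complex.log (argζ ζ ω) - Complex.log (argω ζ ω)) * vden ω / (1 - vden ω) := by
  rw [kap_of_ne, exp_log_sub_log h]
  rw [exp_log_sub_log h]
  exact (sub_ne_zero.1 (one_sub_vden_ne_zero _)).symm

/-- Write L = log u, m = log(u/v). The factor 1 − u in u' = −2πi(1 − u) cancels the denominator of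
`kap`, so −Kap(L)/(2πi) contributes L to either derivative. As exp(L − m) = v, the other term
contributes nothing in ζ and −(L − m) in ω, which leaves L and m respectively. -/
lemma isPainleveIGeneratingFunctionOn_genY : IsPainleveIGeneratingFunctionOn genY domainY := by
  intro ζ ω h
  have hpi : (Real.pi : ℂ) ≠ 0 := by exact_mod_cast Real.pi_ne_zero
  have hI := Complex.I_ne_zero
  have hv := vden_ne_zero h
  have hu : argζ ζ ω ≠ 0 := Complex.slitPlane_ne_zero h.1
  have hu1 : 1 - argζ ζ ω ≠ 0 := one_sub_vden_ne_zero _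
  have hv1 := one_sub_vden_ne_zero ω
  have K1 := hasDerivAt_Kap (abs_im_log_lt (argζ ζ ω))
  have K2 := hasDerivAt_Kap (abs_im_log_sub_log_lt (w := argω ζ ω) h.1)
  rw [kap_log_argζ h] at K1
  rw [kap_log_sub_log h] at K2
  have hII : Complex.I ^ 2 = -1 := Complex.I_sq
  constructor
  · have d0 : HasDerivAt (fun z => argζ z ω) (-(2 * Complex.I * Real.pi * (1 - argζ ζ ω))) ζ :=
      (hasDerivAt_vden (ζ + ω)).comp_add_const ζ ω
    have d1 := d0.clog h.1
    have d2 := (d0.div_const (vden ω)).clog h.2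
    have d := ((K2.comp ζ (d1.sub d2)).sub (K1.comp ζ d1)).div_const (2 * Real.pi * Complex.I)
    refine d.congr_deriv ?_
    rw [← argω_eq]
    simp only [argω_eq]
    generalize Complex.log (argζ ζ ω / vden ω) = μ
    generalize Complex.log (argζ ζ ω) = l
    generalize argζ ζ ω = u at *
    generalize vden ω = v at *
    field_simp
    ring
  · have d0 : HasDerivAt (fun w => argζ ζ w) (-(2 * Complex.I * Real.pi * (1 - argζ ζ ω))) ω :=
      (hasDerivAt_vden (ζ + ω)).comp_const_add ζ ω
    have d1 := d0.clog h.1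
    have d2 := (d0.div (hasDerivAt_vden ω) hv).clog h.2
    have d := ((K2.comp ω (d1.sub d2)).sub (K1.comp ω d1)).div_const (2 * Real.pi * Complex.I)
    refine d.congr_deriv ?_
    rw [Pi.div_apply]
    simp only [argω_eq]
    generalize Complex.log (argζ ζ ω / vden ω) = μ
    generalize Complex.log (argζ ζ ω) = l
    generalize argζ ζ ω = u at *
    generalize vden ω = v at *
    field_simp
    ring

lemma analyticAt_argζ (p : ℂ × ℂ) : AnalyticAt ℂ (fun p : ℂ × ℂ => argζ p.1 p.2) p :=
  analyticAt_const.sub ((analyticAt_const.mul (analyticAt_fst.add analyticAt_snd)).cexp)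

lemma analyticAt_argω {p : ℂ × ℂ} (hp : p ∈ domainY) :
    AnalyticAt ℂ (fun p : ℂ × ℂ => argω p.1 p.2) p := by
  have h1 : AnalyticAt ℂ (fun p : ℂ × ℂ => vden p.2) p := 
    analyticAt_const.sub ((analyticAt_const.mul analyticAt_snd).cexp)
  exact (analyticAt_argζ p).div h1 (vden_ne_zero (ζ := p.1) hp)

lemma analyticOnNhd_genY : AnalyticOnNhd ℂ genY domainY := by
  intro p hp
  have h1 := (analyticAt_argζ p).clog hp.1
  have h2 := (analyticAt_argω hp).clog hp.2
  have h3 := (analyticAt_Kap (abs_im_log_lt (argζ p.1 p.2))).comp_of_eq h1 rfl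
  have h4 := (analyticAt_Kap (abs_im_log_sub_log_lt (w := argω p.1 p.2) hp.1)).comp_of_eq
    (h1.sub h2) rfl
  have h5 : AnalyticAt ℂ (fun _ : ℂ × ℂ => 2 * (Real.pi : ℂ) * Complex.I) p := analyticAt_const
  have hpi : (Real.pi : ℂ) ≠ 0 := by exact_mod_cast Real.pi_ne_zero
  exact (h4.sub h3).div h5 (by simp [hpi])

lemma isOpen_domainY : IsOpen domainY := by
  refine isOpen_iff_mem_nhds.2 fun p hp => ?_
  have h1 := (analyticAt_argζ p).continuousAt.preimage_mem_nhds
    (Complex.isOpen_slitPlane.mem_nhds hp.1)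
  have h2 := (analyticAt_argω hp).continuousAt.preimage_mem_nhds
    (Complex.isOpen_slitPlane.mem_nhds hp.2)
  filter_upwards [h1, h2] with q hq1 hq2 using ⟨hq1, hq2⟩

/-! ### Agreement on the initial set -/

/-- On the initial set e^{2πiζ} = −r with r > 0, and w = e^{2πiω} has negative imaginary part, so u
= 1 + rw and v = 1 − w. The imaginary part of u times the conjugate of v is (1 + r) Im w. -/
lemma initialSet_im {ζ ω : ℂ} (h : (ζ, ω) ∈ initialSet) :
    (argζ ζ ω).im < 0 ∧ 0 < (vden ω).im ∧ (argω ζ ω).im < 0 := by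
  obtain ⟨h1, h2, h3⟩ := h
  simp only at h1 h2 h3
  have hpi := Real.pi_pos
  have e1 : ∀ w : ℂ, Complex.exp (2 * Complex.I * Real.pi * w) =
      Complex.exp (((-(2 * Real.pi * w.im) : ℝ) : ℂ) + ((2 * Real.pi * w.re : ℝ) : ℂ) * Complex.I) := by
    intro w
    congr 1
    conv_lhs => rw [← Complex.re_add_im w]
    push_cast
    linear_combination (2 * Real.pi * w.im : ℂ) * Complex.I_sq
  set w := Complex.exp (2 * Complex.I * Real.pi * ω) with hw
  have hwim : w.im < 0 := by
    rw [hw, e1, Complex.exp_im]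
    simp only [Complex.add_im, Complex.ofReal_im, Complex.mul_im, Complex.ofReal_re, Complex.I_im,
      Complex.I_re, mul_one, mul_zero, add_zero, zero_add]
    refine mul_neg_of_pos_of_neg (Real.exp_pos _) ?_
    rw [← Real.sin_sub_two_pi]
    exact Real.sin_neg_of_neg_of_neg_pi_lt (by nlinarith) (by nlinarith)
  set r := Real.exp (-(2 * Real.pi * ζ.im)) with hr
  have hr0 : 0 < r := Real.exp_pos _
  have hu : argζ ζ ω = 1 + r * w := by
    rw [argζ, mul_add, Complex.exp_add, e1 ζ, h1, Complex.exp_add]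
    rw [show ((2 * Real.pi * -(1 / 2) : ℝ) : ℂ) * Complex.I = -(Real.pi * Complex.I) by
      push_cast; ring, Complex.exp_neg, Complex.exp_pi_mul_I, ← Complex.ofReal_exp, ← hr, ← hw]
    norm_num
  have hv : vden ω = 1 - w := rfl
  have hvim : 0 < (vden ω).im := by rw [hv]; simpa using hwim
  have hrw : (r * w : ℂ).im = r * w.im := Complex.im_ofReal_mul _ _
  have hrw' : (r * w : ℂ).re = r * w.re := Complex.re_ofReal_mul _ _
  refine ⟨?_, hvim, ?_⟩
  · rw [hu, Complex.add_im, hrw, Complex.one_im, zero_add]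
    exact mul_neg_of_pos_of_neg hr0 hwim
  · have hN := Complex.normSq_pos.2 (ne_zero_of_im_ne_zero hvim.ne')
    rw [argω_eq, Complex.div_im, ← sub_div]
    refine div_neg_of_neg_of_pos ?_ hN
    rw [hu, hv]
    simp only [Complex.add_im, Complex.add_re, Complex.sub_re, Complex.sub_im, Complex.one_re,
      Complex.one_im, hrw, hrw']
    nlinarith [mul_pos hr0 (neg_pos.2 hwim)]

lemma initialSet_subset : initialSet ⊆ domainY := fun p hp =>
  have h := initialSet_im (ζ := p.1) (ω := p.2) hp
  ⟨Or.inr h.1.ne, Or.inr h.2.2.ne⟩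

lemma log_sub_log_eq {ζ ω : ℂ} (h : (ζ, ω) ∈ initialSet) :
    Complex.log (argζ ζ ω) - Complex.log (argω ζ ω) = Complex.log (vden ω) := by
  obtain ⟨h1, h2, h3⟩ := initialSet_im h
  refine eq_of_exp_eq ?_ ?_
  · rw [exp_log_sub_log (initialSet_subset h), Complex.exp_log (ne_zero_of_im_ne_zero h2.ne')]
  · have a1 := arg_mem_of_im_neg h1
    have a2 := arg_mem_of_im_pos h2
    have a3 := arg_mem_of_im_neg h3
    rw [Complex.sub_im, Complex.log_im, Complex.log_im, Complex.log_im, abs_lt]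
    constructor <;> linarith

/-- On the initial set iζ + i/2 is real and iω − i/2 has imaginary part in (0, 1/2), so f_M is
`expB`. Its two `Lam` terms become dilogarithms by `Lam_kerOne_eq`, and the polynomial terms cancel
those added in the definition of Y. -/
lemma genY_eq {ζ ω : ℂ} (h : (ζ, ω) ∈ initialSet) : genY (ζ, ω) = YFormula ζ ω := by
  obtain ⟨h1, h2, h3⟩ := initialSet_im h
  obtain ⟨g1, g2, g3⟩ := h
  simp only at g1 g2 g3
  have hpi : (Real.pi : ℂ) ≠ 0 := by exact_mod_cast Real.pi_ne_zero
  have hζ : Complex.I * ζ + Complex.I / 2 = ((-ζ.im : ℝ) : ℂ) := by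
    apply Complex.ext <;> simp [g1]
  have him : (Complex.I * ω - Complex.I / 2).im = ω.re - 1 / 2 := by simp
  have hf := fM_eq_expB (ζ := -ζ.im) (ω := Complex.I * ω - Complex.I / 2) (by rw [him]; linarith)
    (by rw [him]; linarith)
  rw [← hζ] at hf
  rw [YFormula, hf, expB]
  have e1 : Complex.I * ζ + Complex.I / 2 + (Complex.I * ω - Complex.I / 2) - Complex.I / 2 =
      Complex.I * (ζ + ω - 1 / 2) := by ring
  have e2 : Complex.I * ω - Complex.I / 2 = Complex.I * (ω - 1 / 2) := by ring
  have i1 : (Complex.I * (ζ + ω - 1 / 2)).im = ω.re - 1 := by simp [g1]; ring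
  have i2 : (Complex.I * (ω - 1 / 2)).im = ω.re - 1 / 2 := by simp
  have E : ∀ s : ℂ, -Complex.exp (2 * Real.pi * (Complex.I * (s - 1 / 2))) = 1 - vden s := by
    intro s
    rw [vden, sub_sub_cancel, show 2 * Real.pi * (Complex.I * (s - 1 / 2)) =
      2 * Complex.I * Real.pi * s - Real.pi * Complex.I by ring, Complex.exp_sub,
      Complex.exp_pi_mul_I, div_neg, div_one, neg_neg]
  have L1 := Lam_kerOne_eq (z := Complex.I * (ζ + ω - 1 / 2))
    (by rw [i1, abs_of_neg (by linarith)]; linarith)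
  have L2 := Lam_kerOne_eq (z := Complex.I * (ω - 1 / 2))
    (by rw [i2, abs_of_pos (by linarith)]; linarith)
  rw [E] at L1 L2
  rw [dilog_eq_Kap (by rw [sub_sub_cancel]; exact Or.inr h1.ne), sub_sub_cancel] at L1
  rw [dilog_eq_Kap (by rw [sub_sub_cancel]; exact Or.inr h2.ne'), sub_sub_cancel] at L2
  rw [e1, e2, L1, L2, genY]
  simp only
  rw [log_sub_log_eq ⟨g1, g2, g3⟩, argζ_eq]
  generalize Kap (Complex.log (vden ω)) = k₁
  generalize Kap (Complex.log (vden (ζ + ω))) = k₂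
  have hI := Complex.I_ne_zero
  field_simp
  linear_combination (-(Real.pi ^ 2 * Complex.I ^ 2 * (-192 - 768 * ζ + 3072 * ζ * ω + 1536 * ζ ^ 2 + 768 * ω)) : ℂ) *
    Complex.I_sq

/-! ### Connectedness of the domain -/

lemma inv_mem_slitPlane {z : ℂ} (hz : z ∈ Complex.slitPlane) : z⁻¹ ∈ Complex.slitPlane := by
  have hN := Complex.normSq_pos.2 (Complex.slitPlane_ne_zero hz)
  rcases hz with h | h
  · left; rw [Complex.inv_re]; positivity
  · right; rw [Complex.inv_im]; exact div_ne_zero (neg_ne_zero.2 h) hN.ne'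

/-- The part of the domain where both variables are high in the upper half-plane. -/
def highSet : Set (ℂ × ℂ) := {p | 1 < (p.1 + p.2).im ∧ 1 < p.2.im}

lemma convex_highSet : Convex ℝ highSet := by
  intro p hp q hq a b ha hb hab
  obtain ⟨p1, p2⟩ := hp
  obtain ⟨q1, q2⟩ := hq
  simp only [Complex.add_im] at p1 q1
  have hcomb : ∀ x y : ℝ, 1 < x → 1 < y → 1 < a * x + b * y := by
    intro x y hx hy
    rcases ha.eq_or_lt with rfl | ha
    · have : b = 1 := by linarith
      rw [this]; linarith
    · nlinarith
  refine ⟨?_, ?_⟩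
  · have := hcomb _ _ p1 q1
    simp only [Prod.fst_add, Prod.snd_add, Prod.smul_fst, Prod.smul_snd, Complex.add_im,
      Complex.smul_im, smul_eq_mul]
    linarith
  · have := hcomb _ _ p2 q2
    simp only [Prod.snd_add, Prod.smul_snd, Complex.add_im, Complex.smul_im, smul_eq_mul]
    linarith

lemma norm_exp_two_pi (w : ℂ) :
    ‖Complex.exp (2 * Complex.I * Real.pi * w)‖ = Real.exp (-(2 * Real.pi * w.im)) := by
  rw [Complex.norm_exp]
  congr 1
  rw [show 2 * Complex.I * Real.pi * w = ((2 * Real.pi : ℝ) : ℂ) * (Complex.I * w) by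
    push_cast; ring, Complex.re_ofReal_mul]
  simp

lemma norm_exp_le_quarter {w : ℂ} (hw : 1 < w.im) :
    ‖Complex.exp (2 * Complex.I * Real.pi * w)‖ ≤ 1 / 4 := by
  rw [norm_exp_two_pi]
  have h1 : (4 : ℝ) ≤ Real.exp (2 * Real.pi * w.im) := by
    have := Real.add_one_le_exp (2 * Real.pi * w.im)
    have := Real.pi_gt_three
    nlinarith
  rw [Real.exp_neg, ← one_div]
  exact one_div_le_one_div_of_le (by norm_num) h1

lemma highSet_subset : highSet ⊆ domainY := by
  rintro ⟨ζ, ω⟩ ⟨h1, h2⟩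
  have n1 := norm_exp_le_quarter h1
  have n2 := norm_exp_le_quarter h2
  change ‖Complex.exp (2 * Complex.I * Real.pi * (ζ + ω))‖ ≤ 1 / 4 at n1
  change argζ ζ ω ∈ Complex.slitPlane ∧ argω ζ ω ∈ Complex.slitPlane
  rw [argω_eq, argζ, vden]
  generalize Complex.exp (2 * Complex.I * Real.pi * (ζ + ω)) = x at n1
  generalize Complex.exp (2 * Complex.I * Real.pi * ω) = y at n2
  have hx := abs_le.1 ((Complex.abs_re_le_norm x).trans n1)
  have hx' := abs_le.1 ((Complex.abs_im_le_norm x).trans n1)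
  have hy := abs_le.1 ((Complex.abs_re_le_norm y).trans n2)
  have hy' := abs_le.1 ((Complex.abs_im_le_norm y).trans n2)
  have hy0 : 1 - y ≠ 0 := by
    intro h
    have := congrArg Complex.re h
    simp at this
    linarith
  refine ⟨Or.inl ?_, Or.inl ?_⟩
  · simp; linarith
  · rw [Complex.div_re, ← add_div]
    refine div_pos ?_ (Complex.normSq_pos.2 hy0)
    simp only [Complex.sub_re, Complex.one_re, Complex.sub_im, Complex.one_im]
    nlinarith

lemma one_sub_mul_mem_slitPlane {x : ℂ} (hx : 1 - x ∈ Complex.slitPlane) {s : ℝ} (h0 : 0 ≤ s)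
    (h1 : s ≤ 1) : 1 - s * x ∈ Complex.slitPlane := by
  convert star_slitPlane hx h0 h1 using 1; ring

/-- Points with integral first coordinate are joined to high points along a vertical line. -/
lemma joined_vertical {ζ ω : ℂ} (h : (ζ, ω) ∈ domainY)
    (hζ : Complex.exp (2 * Complex.I * Real.pi * ζ) = 1) :
    ∃ q ∈ highSet, JoinedIn domainY (ζ, ω) q := by
  set T : ℝ := |ω.im| + |ζ.im| + 2 with hT
  have hT0 : 0 < T := by positivity
  refine ⟨(ζ, ω + Complex.I * T), ⟨?_, ?_⟩, ?_⟩
  · have := neg_abs_le ω.im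
    have := neg_abs_le ζ.im
    simp; linarith
  · have := neg_abs_le ω.im
    have := abs_nonneg ζ.im
    simp; linarith
  · refine JoinedIn.ofLine (f := fun t : ℝ => (ζ, ω + Complex.I * (t * T))) (by fun_prop) (by simp)
      (by simp) ?_
    rintro _ ⟨t, ht, rfl⟩
    -- Here u = v, so the second argument is 1. Raising ω multiplies e^{2πiω} by a factor in (0, 1],
    -- and the slit plane is star-shaped about 1.
    have hu : ∀ w : ℂ, argζ ζ w = vden w := fun w => by
      rw [argζ, mul_add, Complex.exp_add, hζ, one_mul, vden]
    have h1 : vden ω ∈ Complex.slitPlane := by rw [← hu]; exact h.1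
    have h2 : vden (ω + Complex.I * (t * T)) ∈ Complex.slitPlane := by
      have : Complex.exp (2 * Complex.I * Real.pi * (ω + Complex.I * (t * T))) =
          (Real.exp (-(2 * Real.pi * (t * T))) : ℝ) * Complex.exp (2 * Complex.I * Real.pi * ω) := by
        rw [Complex.ofReal_exp, ← Complex.exp_add]
        congr 1
        push_cast
        linear_combination (2 * Real.pi * t * T : ℂ) * Complex.I_sq
      rw [vden, this]
      refine one_sub_mul_mem_slitPlane h1 (Real.exp_pos _).le ?_
      rw [Real.exp_le_one_iff]
      have := mul_nonneg ht.1 hT0.le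
      have := Real.pi_pos
      nlinarith
    refine ⟨?_, ?_⟩
    · change argζ ζ (ω + Complex.I * (t * T)) ∈ _
      rw [hu]; exact h2
    · change argω ζ (ω + Complex.I * (t * T)) ∈ _
      rw [argω_eq, hu, div_self (Complex.slitPlane_ne_zero h2)]
      simp

/-- Keep ζ + ω, and hence u, fixed while e^{2πis} runs along the segment from 1 to e^{2πiζ}. Then v
moves along the segment from v to u, so v/u moves straight to 1 and stays in the slit plane together
with its inverse. The endpoint satisfies the hypothesis of `joined_vertical`. -/
lemma joined_of_exp_mem_slitPlane {ζ ω : ℂ} (h : (ζ, ω) ∈ domainY)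
    (hζ : Complex.exp (2 * Complex.I * Real.pi * ζ) ∈ Complex.slitPlane) :
    ∃ q ∈ highSet, JoinedIn domainY (ζ, ω) q := by
  have hpi : (2 * Complex.I * Real.pi : ℂ) ≠ 0 := by
    simp [Real.pi_ne_zero]
  set E := Complex.exp (2 * Complex.I * Real.pi * ζ) with hE
  have hu0 : argζ ζ ω ≠ 0 := Complex.slitPlane_ne_zero h.1
  set s : ℝ → ℂ := fun t => Complex.log ((1 - t : ℂ) + t * E) / (2 * Complex.I * Real.pi) with hs
  have hmem : ∀ t ∈ Icc (0 : ℝ) 1, (1 - t : ℂ) + t * E ∈ Complex.slitPlane := fun t ht =>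
    star_slitPlane hζ ht.1 ht.2
  have hexp : ∀ t ∈ Icc (0 : ℝ) 1,
      Complex.exp (2 * Complex.I * Real.pi * s t) = (1 - t : ℂ) + t * E := fun t ht => by
    simp only [hs]
    rw [mul_div_cancel₀ _ hpi, Complex.exp_log (Complex.slitPlane_ne_zero (hmem t ht))]
  have hsc : ContinuousOn s (Icc 0 1) :=
    (ContinuousOn.clog (by fun_prop) hmem).div_const _
  have hdom : ∀ t ∈ Icc (0 : ℝ) 1, (ζ - s t, ω + s t) ∈ domainY := by
    intro t ht
    have hu : argζ (ζ - s t) (ω + s t) = argζ ζ ω := by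
      rw [argζ, argζ]; congr 3; ring
    refine ⟨?_, ?_⟩
    · change argζ (ζ - s t) (ω + s t) ∈ _
      rw [hu]; exact h.1
    · change argω (ζ - s t) (ω + s t) ∈ _
      have hv : vden (ω + s t) = (1 - t : ℂ) * vden ω + t * argζ ζ ω := by
        rw [vden, vden, argζ, mul_add, Complex.exp_add, hexp t ht, mul_add _ ζ, Complex.exp_add, ← hE]
        ring
      have h3 := star_slitPlane (inv_mem_slitPlane h.2) (t := 1 - t) (by linarith [ht.2])
        (by linarith [ht.1])
      have h4 := inv_mem_slitPlane h3
      convert h4 using 1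
      rw [argω_eq, hu, hv]
      change _ = ((1 - ((1 - t : ℝ) : ℂ)) + ((1 - t : ℝ) : ℂ) * (argω ζ ω)⁻¹)⁻¹
      rw [argω_eq, inv_div, ← inv_inj, inv_inv, inv_div]
      push_cast
      field_simp
      ring
  have hjoin : JoinedIn domainY (ζ, ω) (ζ - s 1, ω + s 1) := by
    refine JoinedIn.ofLine (f := fun t : ℝ => (ζ - s t, ω + s t))
      ((continuousOn_const.sub hsc).prodMk (continuousOn_const.add hsc)) (by simp [hs]) rfl ?_
    rintro _ ⟨t, ht, rfl⟩
    exact hdom t ht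
  have h1 : (1 : ℝ) ∈ Icc (0 : ℝ) 1 := right_mem_Icc.2 zero_le_one
  obtain ⟨q, hq, hj⟩ := joined_vertical (hdom 1 h1) (by
    rw [mul_sub, Complex.exp_sub, hexp 1 h1, ← hE]
    simp
    exact Complex.exp_ne_zero _)
  exact ⟨q, hq, hjoin.trans hj⟩

/-- If e^{2πiζ} is on the cut, a small real shift of ζ, possible because D is open, rotates it off.
-/
lemma joined_highSet {p : ℂ × ℂ} (h : p ∈ domainY) : ∃ q ∈ highSet, JoinedIn domainY p q := by
  obtain ⟨ζ, ω⟩ := p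
  by_cases hζ : Complex.exp (2 * Complex.I * Real.pi * ζ) ∈ Complex.slitPlane
  · exact joined_of_exp_mem_slitPlane h hζ
  obtain ⟨r, hr, hball⟩ := Metric.isOpen_iff.1 isOpen_domainY _ h
  set δ : ℝ := min (r / 2) (1 / 4) with hδ
  have hδ0 : 0 < δ := by positivity
  have hδr : δ < r := (min_le_left _ _).trans_lt (by linarith)
  have hδ4 : δ ≤ 1 / 4 := min_le_right _ _
  have hq : (ζ + δ, ω) ∈ Metric.ball ((ζ, ω) : ℂ × ℂ) r := by
    rw [Metric.mem_ball, Prod.dist_eq]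
    simp [abs_of_pos hδ0, hδr, hr]
  have hj : JoinedIn domainY (ζ, ω) (ζ + δ, ω) :=
    JoinedIn.of_segment_subset (((convex_ball _ r).segment_subset (Metric.mem_ball_self hr) hq).trans
      hball)
  rw [Complex.mem_slitPlane_iff, not_or, not_lt, not_not] at hζ
  have hre : (Complex.exp (2 * Complex.I * Real.pi * ζ)).re ≠ 0 := fun h0 =>
    Complex.exp_ne_zero (2 * Complex.I * Real.pi * ζ) (Complex.ext h0 hζ.2)
  have hE : Complex.exp (2 * Complex.I * Real.pi * (ζ + δ)) ∈ Complex.slitPlane := by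
    right
    rw [mul_add, Complex.exp_add, Complex.mul_im, hζ.2, zero_mul, add_zero]
    refine mul_ne_zero hre ?_
    rw [show 2 * Complex.I * Real.pi * δ = ((2 * Real.pi * δ : ℝ) : ℂ) * Complex.I by
      push_cast; ring, Complex.exp_ofReal_mul_I_im]
    have := Real.pi_pos
    exact (Real.sin_pos_of_pos_of_lt_pi (by positivity) (by nlinarith)).ne'
  obtain ⟨q, hq', hj'⟩ := joined_of_exp_mem_slitPlane (hball hq) hE
  exact ⟨q, hq', hj.trans hj'⟩

lemma isPreconnected_domainY : IsPreconnected domainY := by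
  have hb : ((0, Complex.I * 2) : ℂ × ℂ) ∈ highSet := by
    constructor <;> simp
  have : IsPathConnected domainY := by
    refine ⟨_, highSet_subset hb, fun {p} hp => ?_⟩
    obtain ⟨q, hq, hj⟩ := joined_highSet hp
    exact (JoinedIn.of_segment_subset ((convex_highSet.segment_subset hb hq).trans
      highSet_subset)).trans hj.symm
  exact this.isConnected.isPreconnected

/-! ### Uniqueness of the continuation -/

lemma frequently_vertical {f : ℂ → Prop} {z₀ : ℂ} (h : ∀ t : ℝ, f (z₀ + Complex.I * t)) :
    ∃ᶠ z in 𝓝[≠] z₀, f z := by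
  have ht : Tendsto (fun t : ℝ => z₀ + Complex.I * t) (𝓝[≠] 0) (𝓝[≠] z₀) := by
    refine tendsto_nhdsWithin_iff.2 ⟨?_, ?_⟩
    · have : Continuous fun t : ℝ => z₀ + Complex.I * t := by fun_prop
      have h := this.tendsto 0
      simp only [Complex.ofReal_zero, mul_zero, add_zero] at h
      exact h.mono_left nhdsWithin_le_nhds
    · filter_upwards [self_mem_nhdsWithin] with t ht
      have ht : t ≠ 0 := ht
      simpa using ht
  exact ht.frequently (Eventually.of_forall h).frequently

/-- The initial set is not open in ℂ², since ζ is confined to a line. For each ω near 3/4, the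
one-variable identity theorem in ζ gives equality near −1/2, because the line accumulates there.
This yields equality on a ball, and connectedness of D does the rest. -/
lemma eqOn_of_isContinuationOn {Y Y' : ℂ × ℂ → ℂ} (h : IsContinuationOn Y domainY)
    (h' : IsContinuationOn Y' domainY) : EqOn Y' Y domainY := by
  obtain ⟨hsub, hY, hYe⟩ := h
  obtain ⟨-, hY', hYe'⟩ := h'
  set z₀ : ℂ := -(1 / 2) with hz₀
  set w₀ : ℂ := 3 / 4 with hw₀
  have hinit : ∀ (t : ℝ) (w : ℂ), 1 / 2 < w.re → w.re < 1 → (z₀ + Complex.I * t, w) ∈ initialSet :=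
    fun t w h1 h2 => ⟨by simp [hz₀], h1, h2⟩
  have hw₀re : w₀.re = 3 / 4 := by simp [hw₀]
  have hp₀ : (z₀, w₀) ∈ domainY := by
    have := hinit 0 w₀ (by rw [hw₀re]; norm_num) (by rw [hw₀re]; norm_num)
    rw [Complex.ofReal_zero, mul_zero, add_zero] at this
    exact hsub this
  obtain ⟨r, hr, hball⟩ := Metric.isOpen_iff.1 isOpen_domainY _ hp₀
  refine AnalyticOnNhd.eqOn_of_preconnected_of_eventuallyEq hY' hY isPreconnected_domainY hp₀ ?_
  have hrr : 0 < min r (1 / 4) := by positivity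
  filter_upwards [Metric.ball_mem_nhds (z₀, w₀) hrr] with p hp
  obtain ⟨z, w⟩ := p
  rw [Metric.mem_ball, Prod.dist_eq, max_lt_iff] at hp
  obtain ⟨hz, hw⟩ := hp
  simp only at hz hw
  have hwre : |w.re - w₀.re| < 1 / 4 :=
    ((Complex.abs_re_le_norm (w - w₀)).trans_lt (by rw [← dist_eq_norm]; exact hw)).trans_le
      (min_le_right _ _)
  rw [hw₀re, abs_lt] at hwre
  have hslice : ∀ x ∈ Metric.ball z₀ r, (x, w) ∈ domainY := fun x hx => hball (by
    rw [Metric.mem_ball, Prod.dist_eq]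
    exact max_lt hx (hw.trans_le (min_le_left _ _)))
  have han : ∀ F : ℂ × ℂ → ℂ, AnalyticOnNhd ℂ F domainY →
      AnalyticOnNhd ℂ (fun x => F (x, w)) (Metric.ball z₀ r) := fun F hF x hx =>
    (hF _ (hslice x hx)).comp_of_eq (AnalyticAt.prod analyticAt_id analyticAt_const) rfl
  refine AnalyticOnNhd.eqOn_of_preconnected_of_frequently_eq (han Y' hY') (han Y hY)
    (convex_ball z₀ r).isPreconnected (Metric.mem_ball_self hr) (frequently_vertical fun t => ?_)
    (Metric.mem_ball.2 (hz.trans_le (min_le_left _ _)))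
  have := hinit t w (by linarith) (by linarith)
  rw [hYe' _ this, hYe _ this]

lemma isContinuationOn_genY : IsContinuationOn genY domainY :=
  ⟨initialSet_subset, analyticOnNhd_genY, fun _ hp => genY_eq hp⟩

end HypM
theorem theorem2p2 :
    -- the integral defining `𝓜` converges absolutely and does not depend on the contour, and
    -- `𝓜` has the claimed semiclassical limit
    (∀ (ζ : ℝ) (ω : ℂ), 0 < ω.im → ω.im < 1 / 2 →
      (∀ b : ℝ, 0 < b → ∀ c : ℝ, 0 < c → c < HypM.Q b / 2 →
        MeasureTheory.Integrable (fun x : ℝ =>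
          HypM.integrandM b ((ζ : ℂ) / (b : ℂ)) (ω / (b : ℂ)) ((x : ℂ) - Complex.I * (c : ℂ))) ∧
        HypM.M b ((ζ : ℂ) / (b : ℂ)) (ω / (b : ℂ)) =
          HypM.sb b ((ζ : ℂ) / (b : ℂ)) * ∫ x : ℝ,
            HypM.integrandM b ((ζ : ℂ) / (b : ℂ)) (ω / (b : ℂ))
              ((x : ℂ) - Complex.I * (c : ℂ))) ∧
      ∃ E : ℝ → ℂ,
        E =O[nhdsWithin 0 (Set.Ioi 0)] (fun b : ℝ => b) ∧
        ∀ b : ℝ, 0 < b →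
          HypM.M b ((ζ : ℂ) / (b : ℂ)) (ω / (b : ℂ)) =
            ((HypM.coth (Real.pi * ((ζ : ℂ) + ω)) + 1) / 2) ^ (1 / 2 : ℂ) *
              Complex.exp (HypM.fM ζ ω / (b : ℂ) ^ 2) * (1 + E b)) ∧
    -- the analytic continuation `Y` exists, is unique, and is a Painlevé I generating function
    (∃ Y : ℂ × ℂ → ℂ,
      HypM.IsContinuationOn Y HypM.domainY ∧
      (∀ Y' : ℂ × ℂ → ℂ, HypM.IsContinuationOn Y' HypM.domainY →
        Set.EqOn Y' Y HypM.domainY) ∧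
      HypM.IsPainleveIGeneratingFunctionOn Y HypM.domainY) := by
  refine ⟨fun ζ ω h0 h1 => ⟨fun b hb c hc0 hc1 => HypM.M_integral h0 h1 hb hc0 hc1, ?_⟩,
    HypM.genY, HypM.isContinuationOn_genY,
    fun Y' hY' => HypM.eqOn_of_isContinuationOn HypM.isContinuationOn_genY hY',
    HypM.isPainleveIGeneratingFunctionOn_genY⟩
  rw [HypM.fM_eq_expB h0 h1]
  exact HypM.M_asymptotics h0 h1
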